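/- Let $\mathbb T=\{z\in\mathbb C:|z|=1\}$ and $\mathbb D^*=\{z:|z|>1\}\cup\{\infty\}\subset\widehat{\mathbb C}$. An interior hull is a nonempty compact connected set $K\subset\mathbb C$ with $\mathbb C\setminus K$ connected; it is nondegenerate if it contains more than one point. For a nondegenerate interior hull $K$ let $\psi_K$ be the unique conformal map of $\mathbb D^*$ onto $\widehat{\mathbb C}\setminus K$ with $\psi_K(\infty)=\infty$ and $\lim_{w\to\infty}\psi_K(w)/w\in(0,\infty)$. A conformal map on an open subset of $\mathbb C$ is an injective holomorphic function to $\mathbb C$. Let $H$ be a nondegenerate interior hull, let $\Omega\subset\mathbb C$ be an open set containing $\mathbb T$, and let $W$ be a conformal map on $\Omega$ that maps $\mathbb T$ onto $\mathbb T$ and preserves the orientation of $\mathbb T$. Assume that $\Omega$ is connected or, more generally, that $W(\Omega\cap\mathbb D^*)\subset\mathbb D^*$. Let $\Omega^H=H\cup\psi_H(\Omega\cap\mathbb D^*)$. Then there is a conformal map $V$ on $\Omega^H$ such that $V(H)$ is a nondegenerate interior hull and $$V\circ\psi_H=\psi_{V(H)}\circ W\quad\text{on }\Omega\cap\mathbb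 D^*.$$ If $V$ is a conformal map on $\Omega^H$ with this property, then a function $\widetilde V$ on $\Omega^H$ is another one if and only if $\widetilde V=aV+b$ on $\Omega^H$ for some $a>0$ and $b\in\mathbb C$. -/

import Mathlib

open Set Filter Topology

noncomputable section

/-- A conformal map on an open set `U ⊆ ℂ`: a holomorphic injective function. -/
def IsConformalOn (f : ℂ → ℂ) (U : Set ℂ) : Prop :=
  IsOpen U ∧ DifferentiableOn ℂ f U ∧ InjOn f U

/-- The unit circle. -/
def unitCircle : Set ℂ := {z | ‖z‖ = 1}

/-- The finite part `{z ∈ ℂ : |z| > 1}` of the exterior of the closed unit disc in the Riemann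
sphere. -/
def exteriorDisc : Set ℂ := {z | 1 < ‖z‖}

/-- An interior hull: a nonempty compact connected subset of `ℂ` with connected complement.
(`IsConnected` includes nonemptiness.) -/
def IsInteriorHull (K : Set ℂ) : Prop :=
  IsCompact K ∧ IsConnected K ∧ IsConnected Kᶜ

/-- An interior hull is nondegenerate if it contains more than one point. -/
def IsNondegenerateHull (K : Set ℂ) : Prop :=
  IsInteriorHull K ∧ K.Nontrivial

/-- `ψ` is (the restriction to finite points of) a conformal map of the exterior of the closed unit
disc in the Riemann sphere onto the complement of `K` in the Riemann sphere, with `ψ(∞) = ∞` and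
with positive derivative at `∞`. The derivative at `∞` of the inverse map `φ` is
`lim_{z → ∞} z / φ(z)`, which is `lim_{w → ∞} ψ(w) / w`; that this limit exists and is nonzero
gives `ψ(∞) = ∞` and holomorphy at `∞`. -/
def IsExteriorMap (K : Set ℂ) (ψ : ℂ → ℂ) : Prop :=
  DifferentiableOn ℂ ψ exteriorDisc ∧ BijOn ψ exteriorDisc Kᶜ ∧
    ∃ c : ℝ, 0 < c ∧ Tendsto (fun w : ℂ => ψ w / w) (Bornology.cobounded ℂ) (𝓝 (c : ℂ))

open scoped Classical in
/-- The normalized exterior conformal map `ψ_K` of a nondegenerate interior hull `K`. Only its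
values on `exteriorDisc` are meaningful; there the conditions of `IsExteriorMap` determine it
uniquely. (If `K` admits no exterior map, the value is the constant `0`.) -/
def exteriorMap (K : Set ℂ) : ℂ → ℂ :=
  if h : ∃ ψ : ℂ → ℂ, IsExteriorMap K ψ then h.choose else fun _ => 0

/-- `W`, which is to map the unit circle to itself, preserves the orientation of the circle: it has
a continuous strictly increasing lift `θ`, that is, `W (e^{it}) = e^{iθ(t)}`. -/
def PreservesCircleOrientation (W : ℂ → ℂ) : Prop :=
  ∃ θ : ℝ → ℝ, Continuous θ ∧ StrictMono θ ∧
    ∀ t : ℝ, W (Complex.exp (t * Complex.I)) = Complex.exp (θ t * Complex.I)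

/-- The set `Ω^H = H ∪ ψ_H(Ω ∩ 𝔻*)`. -/
def liftDomain (H Ω : Set ℂ) : Set ℂ :=
  H ∪ exteriorMap H '' (Ω ∩ exteriorDisc)

/-- `V` is a conformal map on `Ω^H` with `V ∘ ψ_H = ψ_{V(H)} ∘ W` on `Ω ∩ 𝔻*`. -/
def IsConformalLift (H Ω : Set ℂ) (W V : ℂ → ℂ) : Prop :=
  IsConformalOn V (liftDomain H Ω) ∧
    ∀ z ∈ Ω ∩ exteriorDisc, V (exteriorMap H z) = exteriorMap (V '' H) (W z)

end

/-! ### Injective holomorphic functions and their inverses. -/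

namespace ConformalWelding

open Metric Complex

/-! The proof is a conformal welding. Glue a neighbourhood of `H` to the exterior of the closed unit
disc along an annulus `1 < |w| < R`, identifying `ψ_H(w)` with `W(w)`. The result is topologically a
sphere. A conformal coordinate on it with a simple pole at `∞` gives `V` on the inner piece and
`ψ_{V(H)}` on the outer piece, and the equation `V ∘ ψ_H = ψ_{V(H)} ∘ W` says that the two pieces
are one function.

The coordinate is built without uniformization. A `Collar` records one side of the gluing, with `p =
ψ_H` for the inner side and `q = W` for the outer side. A holomorphic `u` on the annulus is to be
split as `V ∘ p - g ∘ q`, with `V` holomorphic on the inner side, `g` on the outer side and `g(∞) =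
0` (`Collar.exists_decomposition`). Cauchy integrals along `p` and `q` split `u` up to an error
operator. Its kernel is the difference of two Cauchy kernels, which is smooth because their poles
cancel. The operator is therefore compact, and the Fredholm alternative
(`exists_sub_diffTransform_eq`) reduces solvability to injectivity. Injectivity follows from the
maximum principle on the glued surface, `Collar.liouville`.

Splitting `u = q` gives the coordinate (`Collar.exists_gluedMap`). Splitting `u = 1 / (p - z₀)` or
`u = 1 / (q - z₀)` gives functions with a pole at a prescribed point. Multiplied by the coordinate
minus its value at that point, they become constant by Liouville, and this yields injectivity
(`GluedMap.injOn_inner`, `GluedMap.injOn_outer`). Liouville applied to `1 / (F - c)` yields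
surjectivity (`GluedMap.image_inner`).

Two further ingredients are needed. The exterior map of a hull exists by the Riemann mapping
theorem, where polynomial approximation on compact sets with connected complement takes the place of
simple connectivity (`exists_isExteriorMap`). Orientation makes `|W|` increase radially near the
circle, so `W` keeps the two sides apart (`exists_radial_bounds`).

For uniqueness, `V' ∘ V⁻¹` and `ψ_{V'(H)} ∘ ψ_{V(H)}⁻¹` combine to an entire function asymptotic to
a positive multiple of `z`, hence affine (`IsConformalLift.exists_affine`). -/

theorem _root_.IsConformalOn.mono {f : ℂ → ℂ} {U s : Set ℂ} (h : IsConformalOn f U) (hs : IsOpen s)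
    (hsU : s ⊆ U) : IsConformalOn f s :=
  ⟨hs, h.2.1.mono hsU, h.2.2.mono hsU⟩

theorem _root_.IsConformalOn.image_mem_nhds {f : ℂ → ℂ} {U s : Set ℂ} (h : IsConformalOn f U)
    {z : ℂ} (hz : z ∈ U) (hs : s ∈ 𝓝 z) : f '' s ∈ 𝓝 (f z) := by
  have han : AnalyticAt ℂ f z := h.2.1.analyticAt (h.1.mem_nhds hz)
  rcases han.eventually_constant_or_nhds_le_map_nhds with hc | ho
  · exfalso
    have h1 : ∀ᶠ w in 𝓝[≠] z, f w = f z ∧ w ∈ U :=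
      (hc.and (h.1.mem_nhds hz)).filter_mono nhdsWithin_le_nhds
    obtain ⟨w, ⟨hw, hwU⟩, hne⟩ := (h1.and self_mem_nhdsWithin).exists
    exact hne (h.2.2 hwU hz hw)
  · exact ho (image_mem_map hs)

theorem _root_.IsConformalOn.isOpen_image {f : ℂ → ℂ} {U s : Set ℂ} (h : IsConformalOn f U)
    (hs : IsOpen s) (hsU : s ⊆ U) : IsOpen (f '' s) := by
  rw [isOpen_iff_mem_nhds]
  rintro _ ⟨z, hz, rfl⟩
  exact h.image_mem_nhds (hsU hz) (hs.mem_nhds hz)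

theorem _root_.IsConformalOn.continuousOn_invFunOn {f : ℂ → ℂ} {U : Set ℂ}
    (h : IsConformalOn f U) : ContinuousOn (Function.invFunOn f U) (f '' U) := by
  rintro _ ⟨x, hx, rfl⟩
  apply ContinuousAt.continuousWithinAt
  rw [ContinuousAt, h.2.2.leftInvOn_invFunOn hx]
  intro N hN
  rw [mem_map]
  filter_upwards [h.image_mem_nhds hx (inter_mem hN (h.1.mem_nhds hx))]
  rintro _ ⟨w, ⟨hwN, hwU⟩, rfl⟩
  rw [mem_preimage, h.2.2.leftInvOn_invFunOn hwU]
  exact hwN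

/-- Where `f' ≠ 0` this is the inverse function theorem. Zeros of `f'` are isolated, as `f` is not
locally constant, so at such a zero the continuous inverse has a removable singularity. That `f'`
has no zeros at all is then a consequence, by the chain rule. -/
theorem _root_.IsConformalOn.differentiableAt_invFunOn {f : ℂ → ℂ} {U : Set ℂ}
    (h : IsConformalOn f U) {x : ℂ} (hx : x ∈ U) :
    DifferentiableAt ℂ (Function.invFunOn f U) (f x) := by
  have hVo : IsOpen (f '' U) := h.isOpen_image h.1 subset_rfl
  have hcont : ∀ y ∈ U, ContinuousAt (Function.invFunOn f U) (f y) := fun y hy =>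
    h.continuousOn_invFunOn.continuousAt (hVo.mem_nhds (mem_image_of_mem f hy))
  have hgood : ∀ y ∈ U, deriv f y ≠ 0 → DifferentiableAt ℂ (Function.invFunOn f U) (f y) := by
    intro y hy hd
    have h1 : HasDerivAt f (deriv f y) (Function.invFunOn f U (f y)) := by
      rw [h.2.2.leftInvOn_invFunOn hy]
      exact (h.2.1.differentiableAt (h.1.mem_nhds hy)).hasDerivAt
    refine (h1.of_local_left_inverse (hcont y hy) hd ?_).differentiableAt
    filter_upwards [hVo.mem_nhds (mem_image_of_mem f hy)] with w hw
    exact Function.invFunOn_eq hw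
  have hder : AnalyticAt ℂ (deriv f) x := (h.2.1.analyticAt (h.1.mem_nhds hx)).deriv
  rcases hder.eventually_eq_zero_or_eventually_ne_zero with h0 | hne
  · exfalso
    obtain ⟨r, hr, hball⟩ := Metric.mem_nhds_iff.1 (inter_mem h0 (h.1.mem_nhds hx))
    have hconst : ∀ w ∈ ball x r, f w = f x := fun w hw =>
      isOpen_ball.is_const_of_deriv_eq_zero (convex_ball x r).isPreconnected
        (h.2.1.mono fun z hz => (hball hz).2) (fun z hz => (hball hz).1) hw (mem_ball_self hr)
    have h1 : ∀ᶠ w in 𝓝[≠] x, w ∈ ball x r := mem_nhdsWithin_of_mem_nhds (ball_mem_nhds x hr)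
    obtain ⟨w, hw, hwx⟩ := (h1.and self_mem_nhdsWithin).exists
    exact hwx (h.2.2 (hball hw).2 hx (hconst w hw))
  · have hN : {w | (w ≠ x → deriv f w ≠ 0) ∧ w ∈ U} ∈ 𝓝 x := by
      filter_upwards [eventually_nhdsWithin_iff.1 hne, h.1.mem_nhds hx] with w h1 h2
      exact ⟨h1, h2⟩
    refine (analyticAt_of_differentiable_on_punctured_nhds_of_continuousAt ?_
      (hcont x hx)).differentiableAt
    filter_upwards [mem_nhdsWithin_of_mem_nhds (h.image_mem_nhds hx hN), self_mem_nhdsWithin]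
    rintro _ ⟨w, ⟨hw, hwU⟩, rfl⟩ hne'
    exact hgood w hwU (hw fun e => hne' (by rw [e]; rfl))

theorem _root_.IsConformalOn.deriv_ne_zero {f : ℂ → ℂ} {U : Set ℂ} (h : IsConformalOn f U)
    {x : ℂ} (hx : x ∈ U) : deriv f x ≠ 0 := by
  intro h0
  have h1 := (h.differentiableAt_invFunOn hx).hasDerivAt.comp x
    (h.2.1.differentiableAt (h.1.mem_nhds hx)).hasDerivAt
  have h2 : (Function.invFunOn f U ∘ f) =ᶠ[𝓝 x] id := by
    filter_upwards [h.1.mem_nhds hx] with w hw using h.2.2.leftInvOn_invFunOn hw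
  have h3 := (h1.congr_of_eventuallyEq h2.symm).unique (hasDerivAt_id x)
  simp [h0] at h3

theorem _root_.IsConformalOn.differentiableOn_invFunOn {f : ℂ → ℂ} {U : Set ℂ}
    (h : IsConformalOn f U) : DifferentiableOn ℂ (Function.invFunOn f U) (f '' U) := by
  rintro _ ⟨x, hx, rfl⟩
  exact (h.differentiableAt_invFunOn hx).differentiableWithinAt

/-! ### Annuli and Hurwitz's theorem. -/

/-- The open annulus `{w | r < ‖w‖ < R}`. -/
def annulus (r R : ℝ) : Set ℂ := {w | r < ‖w‖ ∧ ‖w‖ < R}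

theorem isOpen_annulus (r R : ℝ) : IsOpen (annulus r R) :=
  (isOpen_lt continuous_const continuous_norm).inter (isOpen_lt continuous_norm continuous_const)

theorem isOpen_exteriorDisc : IsOpen exteriorDisc := isOpen_lt continuous_const continuous_norm

theorem annulus_subset_annulus {r R r' R' : ℝ} (h : r ≤ r') (h' : R' ≤ R) :
    annulus r' R' ⊆ annulus r R := fun _ hw => ⟨h.trans_lt hw.1, hw.2.trans_le h'⟩

theorem isPreconnected_annulus {r R : ℝ} (hr : 0 < r) : IsPreconnected (annulus r R) := by
  by_cases hR : 0 < R
  · have : annulus r R = Complex.exp '' (Complex.re ⁻¹' (Ioo (Real.log r) (Real.log R))) := by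
      ext w
      constructor
      · rintro ⟨h1, h2⟩
        have hw : w ≠ 0 := norm_pos_iff.1 (hr.trans h1)
        refine ⟨Complex.log w, ⟨?_, ?_⟩, Complex.exp_log hw⟩
        · rw [Complex.log_re]; exact Real.log_lt_log hr h1
        · rw [Complex.log_re]; exact Real.log_lt_log (hr.trans h1) h2
      · rintro ⟨z, ⟨h1, h2⟩, rfl⟩
        refine ⟨?_, ?_⟩
        · rw [Complex.norm_exp]; exact (Real.log_lt_iff_lt_exp hr).1 h1
        · rw [Complex.norm_exp]; exact (Real.lt_log_iff_exp_lt hR).1 h2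
    rw [this]
    refine (Convex.isPreconnected ?_).image _ Complex.continuous_exp.continuousOn
    exact (convex_Ioo _ _).linear_preimage Complex.reLm
  · have : annulus r R = ∅ := by
      ext w
      simp only [annulus, mem_ofPred_eq, mem_empty_iff_false, iff_false, not_and, not_lt]
      intro _
      exact (not_lt.1 hR).trans (norm_nonneg w)
    rw [this]
    exact isPreconnected_empty

theorem isPreconnected_exteriorDisc : IsPreconnected exteriorDisc := by
  have : exteriorDisc = Complex.exp '' (Complex.re ⁻¹' (Ioi 0)) := by
    ext w
    constructor
    · intro h1
      have h1 : 1 < ‖w‖ := h1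
      have hw : w ≠ 0 := norm_pos_iff.1 (zero_lt_one.trans h1)
      refine ⟨Complex.log w, ?_, Complex.exp_log hw⟩
      rw [mem_preimage, Complex.log_re]; exact Real.log_pos h1
    · rintro ⟨z, h1, rfl⟩
      have h1 : 0 < z.re := h1
      change (1 : ℝ) < ‖Complex.exp z‖
      rw [Complex.norm_exp]; exact Real.one_lt_exp_iff.2 h1
  rw [this]
  refine (Convex.isPreconnected ?_).image _ Complex.continuous_exp.continuousOn
  exact (convex_Ioi _).linear_preimage Complex.reLm

/-- **Hurwitz's theorem** for injective functions: a nonconstant locally uniform limit of injective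
holomorphic functions on a connected open set is injective. -/
theorem injOn_of_tendstoLocallyUniformlyOn {ι : Type*} {l : Filter ι} [l.NeBot] {F : ι → ℂ → ℂ}
    {f : ℂ → ℂ} {U : Set ℂ} (hU : IsOpen U) (hUc : IsPreconnected U)
    (hF : ∀ i, DifferentiableOn ℂ (F i) U) (hinj : ∀ i, InjOn (F i) U)
    (hlim : TendstoLocallyUniformlyOn F f l U) (hnc : ∃ a ∈ U, ∃ b ∈ U, f a ≠ f b) :
    InjOn f U := by
  have hf : DifferentiableOn ℂ f U := hlim.differentiableOn (Eventually.of_forall hF) hU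
  intro a ha b hb hab
  by_contra hne
  have hiso : ∀ᶠ w in 𝓝[≠] a, f w ≠ f a := by
    have hfa := (hf.analyticOnNhd hU)
    rcases ((hfa a ha).sub (analyticAt_const (v := f a))).eventually_eq_zero_or_eventually_ne_zero
      with h0 | h1
    · exfalso
      obtain ⟨x, hx, y, hy, hxy⟩ := hnc
      have h2 : EqOn f (fun _ => f a) U := by
        refine hfa.eqOn_of_preconnected_of_eventuallyEq (fun z _ => analyticAt_const) hUc ha ?_
        filter_upwards [h0] with w hw using sub_eq_zero.1 hw
      exact hxy ((h2 hx).trans (h2 hy).symm)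
    · filter_upwards [h1] with w hw using sub_ne_zero.1 hw
  obtain ⟨r, hr, hball⟩ := Metric.mem_nhds_iff.1
    (inter_mem (eventually_nhdsWithin_iff.1 hiso) (hU.mem_nhds ha))
  -- The circle of radius `ρ` about `a` avoids the other solutions of `f w = f a`, and `b` lies
  -- outside the closed ball.
  set ρ := min (r / 2) (dist a b / 2) with hρ
  have hdab : 0 < dist a b := dist_pos.2 hne
  have hρ0 : 0 < ρ := lt_min (by linarith) (by linarith)
  have hρr : ρ < r := (min_le_left _ _).trans_lt (by linarith)
  have hρb : ρ < dist a b := (min_le_right _ _).trans_lt (by linarith)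
  have hcb : closedBall a ρ ⊆ ball a r := closedBall_subset_ball hρr
  have hcU : closedBall a ρ ⊆ U := fun w hw => (hball (hcb hw)).2
  have hsph : (sphere a ρ).Nonempty := (NormedSpace.sphere_nonempty).2 hρ0.le
  obtain ⟨w₀, hw₀, hmin⟩ := (isCompact_sphere a ρ).exists_isMinOn hsph
    (f := fun w => ‖f w - f a‖)
    ((hf.continuousOn.mono (sphere_subset_closedBall.trans hcU)).sub continuousOn_const).norm
  set ε := ‖f w₀ - f a‖ with hε
  have hε0 : 0 < ε := norm_pos_iff.2 (sub_ne_zero.2 ((hball (hcb (sphere_subset_closedBall hw₀))).1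
    (fun e => by rw [e] at hw₀; simp at hw₀; linarith)))
  have hunif : TendstoUniformlyOn F f l (closedBall a ρ) :=
    (tendstoLocallyUniformlyOn_iff_forall_isCompact hU).1 hlim _ hcU (isCompact_closedBall a ρ)
  have hev := (Metric.tendstoUniformlyOn_iff.1 hunif) (ε / 8) (by linarith)
  have hevb : ∀ᶠ n in l, dist (F n b) (f b) < ε / 8 := by
    have := (hlim.tendsto_at hb)
    exact (Metric.tendsto_nhds.1 this) _ (by linarith)
  obtain ⟨n, hn, hnb⟩ := (hev.and hevb).exists
  have hna := hn a (mem_closedBall_self hρ0.le)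
  have hbd : ∀ z ∈ sphere a ρ, ε / 2 ≤ ‖F n z - F n a‖ := by
    intro z hz
    have h1 := hn z (sphere_subset_closedBall hz)
    have h2 : ε ≤ ‖f z - f a‖ := hmin hz
    rw [dist_eq_norm] at h1 hna
    have h3 : ‖f z - f a‖ ≤ ‖f z - F n z‖ + ‖F n z - F n a‖ + ‖f a - F n a‖ := by
      have e : f z - f a = (f z - F n z) + (F n z - F n a) - (f a - F n a) := by ring
      rw [e]
      exact (norm_sub_le _ _).trans (by gcongr; exact norm_add_le _ _)
    linarith
  have hdc : DiffContOnCl ℂ (F n) (ball a ρ) := by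
    refine DifferentiableOn.diffContOnCl ?_
    rw [closure_ball a hρ0.ne']
    exact (hF n).mono hcU
  have hfreq : ∃ᶠ z in 𝓝 a, F n z ≠ F n a := by
    have h1 : ∃ᶠ z in 𝓝[≠] a, F n z ≠ F n a := by
      apply Eventually.frequently
      filter_upwards [mem_nhdsWithin_of_mem_nhds (hU.mem_nhds ha), self_mem_nhdsWithin]
        with z hz hza e
      exact hza (hinj n hz ha e)
    exact h1.filter_mono nhdsWithin_le_nhds
  -- A quantitative open mapping theorem: near `a`, the function `F n` takes every value within `ε /
  -- 4` of `F n a`. Since `f a = f b`, the value `F n b` is among these, which contradicts the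
  -- injectivity of `F n`.
  have hsub := hdc.ball_subset_image_closedBall hρ0 hbd hfreq
  have hmem : F n b ∈ ball (F n a) (ε / 2 / 2) := by
    rw [mem_ball]
    rw [← hab] at hnb
    rw [dist_comm] at hna
    calc dist (F n b) (F n a) ≤ dist (F n b) (f a) + dist (F n a) (f a) := dist_triangle_right _ _ _
      _ < ε / 2 / 2 := by linarith
  obtain ⟨c, hc, hcb'⟩ := hsub hmem
  have : c = b := hinj n (hcU hc) hb hcb'
  rw [this, mem_closedBall, dist_comm] at hc
  linarith

end ConformalWelding

/-! ### Uniform polynomial approximation on compact sets, and logarithms. -/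

namespace ConformalWelding

open Metric Complex Polynomial

/-- `f` can be approximated by polynomials uniformly on `L`. -/
def PolyApprox (L : Set ℂ) (f : ℂ → ℂ) : Prop :=
  ∀ ε > 0, ∃ p : ℂ[X], ∀ x ∈ L, ‖f x - p.eval x‖ < ε

/-- The closure of the algebra of polynomial functions in `C(L, ℂ)`. -/
noncomputable abbrev polyClosure (L : Set ℂ) [CompactSpace L] : Subalgebra ℂ C(L, ℂ) :=
  (polynomialFunctions L).topologicalClosure

/-- Passing to the Banach algebra `polyClosure L` makes products, exponentials and the inverse
function theorem available for approximable functions. -/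
theorem polyApprox_iff {L : Set ℂ} [CompactSpace L] {f : ℂ → ℂ} :
    PolyApprox L f ↔ ∃ F ∈ polyClosure L, ∀ x : L, F x = f x := by
  constructor
  · intro h
    have hc : ContinuousOn f L := by
      have : TendstoUniformlyOn (fun (n : ℕ) x => ((h (1 / ((n : ℝ) + 1)) (by positivity)).choose).eval x)
          f atTop L := by
        rw [Metric.tendstoUniformlyOn_iff]
        intro ε hε
        have := tendsto_one_div_add_atTop_nhds_zero_nat (𝕜 := ℝ)
        filter_upwards [this.eventually_lt_const hε] with n hn x hx
        rw [dist_eq_norm]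
        exact ((h (1 / ((n : ℝ) + 1)) (by positivity)).choose_spec x hx).trans hn
      exact this.continuousOn (Frequently.of_forall fun n => (Polynomial.continuous _).continuousOn)
    refine ⟨⟨L.domRestrict f, continuousOn_iff_continuous_domRestrict.1 hc⟩, ?_, fun x => rfl⟩
    rw [← SetLike.mem_coe, Subalgebra.topologicalClosure_coe, Metric.mem_closure_iff]
    intro ε hε
    obtain ⟨p, hp⟩ := h (ε / 2) (by linarith)
    refine ⟨p.toContinuousMapOn L, ?_, ?_⟩
    · rw [polynomialFunctions_coe]
      exact ⟨p, rfl⟩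
    · refine lt_of_le_of_lt ((ContinuousMap.dist_le (by linarith)).2 fun x => ?_)
        (half_lt_self hε)
      rw [dist_eq_norm]
      exact (hp x x.2).le
  · rintro ⟨F, hF, hFf⟩ ε hε
    rw [← SetLike.mem_coe, Subalgebra.topologicalClosure_coe, Metric.mem_closure_iff] at hF
    obtain ⟨G, hG, hFG⟩ := hF ε hε
    rw [polynomialFunctions_coe] at hG
    obtain ⟨p, rfl⟩ := hG
    refine ⟨p, fun x hx => ?_⟩
    have := (ContinuousMap.dist_lt_iff hε).1 hFG ⟨x, hx⟩
    rw [dist_eq_norm, hFf] at this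
    exact this

theorem PolyApprox.mono {L M : Set ℂ} {f : ℂ → ℂ} (h : PolyApprox L f) (hM : M ⊆ L) :
    PolyApprox M f := fun ε hε =>
  (h ε hε).imp fun _ hp x hx => hp x (hM hx)

theorem PolyApprox.congr {L : Set ℂ} {f g : ℂ → ℂ} (h : PolyApprox L f) (hfg : EqOn f g L) :
    PolyApprox L g := fun ε hε =>
  (h ε hε).imp fun p hp x hx => by rw [← hfg hx]; exact hp x hx

theorem polyApprox_eval (L : Set ℂ) (p : ℂ[X]) : PolyApprox L (fun x => p.eval x) :=
  fun ε hε => ⟨p, fun x _ => by simpa using hε⟩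

theorem polyApprox_const (L : Set ℂ) (c : ℂ) : PolyApprox L (fun _ => c) := by
  simpa using polyApprox_eval L (C c)

theorem polyApprox_id (L : Set ℂ) : PolyApprox L (fun x => x) := by
  simpa using polyApprox_eval L X

section compact

variable {L : Set ℂ} {f g : ℂ → ℂ}

theorem PolyApprox.add (hL : IsCompact L) (hf : PolyApprox L f) (hg : PolyApprox L g) :
    PolyApprox L (fun x => f x + g x) := by
  have := isCompact_iff_compactSpace.1 hL
  obtain ⟨F, hF, hFf⟩ := polyApprox_iff.1 hf
  obtain ⟨G, hG, hGg⟩ := polyApprox_iff.1 hg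
  exact polyApprox_iff.2 ⟨F + G, add_mem hF hG, fun x => by simp [hFf, hGg]⟩

theorem PolyApprox.mul (hL : IsCompact L) (hf : PolyApprox L f) (hg : PolyApprox L g) :
    PolyApprox L (fun x => f x * g x) := by
  have := isCompact_iff_compactSpace.1 hL
  obtain ⟨F, hF, hFf⟩ := polyApprox_iff.1 hf
  obtain ⟨G, hG, hGg⟩ := polyApprox_iff.1 hg
  exact polyApprox_iff.2 ⟨F * G, mul_mem hF hG, fun x => by simp [hFf, hGg]⟩

theorem PolyApprox.const_mul (hL : IsCompact L) (c : ℂ) (hf : PolyApprox L f) :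
    PolyApprox L (fun x => c * f x) :=
  (polyApprox_const L c).mul hL hf

theorem PolyApprox.neg (hL : IsCompact L) (hf : PolyApprox L f) : PolyApprox L (fun x => - f x) :=
  (hf.const_mul hL (-1)).congr fun x _ => by simp

theorem PolyApprox.sub (hL : IsCompact L) (hf : PolyApprox L f) (hg : PolyApprox L g) :
    PolyApprox L (fun x => f x - g x) :=
  (hf.add hL (hg.neg hL)).congr fun x _ => by simp [sub_eq_add_neg]

theorem polyClosure_exp_apply [CompactSpace L] (G : polyClosure L) (x : L) :
    ((NormedSpace.exp G : polyClosure L) : C(L, ℂ)) x = Complex.exp ((G : C(L, ℂ)) x) := by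
  have : CompleteSpace (polyClosure L) :=
    (Subalgebra.isClosed_topologicalClosure (polynomialFunctions L)).completeSpace_coe
  let _ : NormedAlgebra ℚ (polyClosure L) := NormedAlgebra.restrictScalars ℚ ℂ _
  let φ : polyClosure L →+* ℂ :=
    (ContinuousMap.evalAlgHom ℂ ℂ x : C(L, ℂ) →+* ℂ).comp (polyClosure L).val.toRingHom
  have hφ : Continuous φ :=
    (continuous_eval_const x).comp continuous_subtype_val
  have := NormedSpace.map_exp φ hφ G
  rw [Complex.exp_eq_exp_ℂ]
  exact this

theorem PolyApprox.exp (hL : IsCompact L) (hf : PolyApprox L f) :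
    PolyApprox L (fun x => Complex.exp (f x)) := by
  have := isCompact_iff_compactSpace.1 hL
  obtain ⟨F, hF, hFf⟩ := polyApprox_iff.1 hf
  refine polyApprox_iff.2 ⟨(NormedSpace.exp (⟨F, hF⟩ : polyClosure L) : polyClosure L),
    SetLike.coe_mem _, fun x => ?_⟩
  rw [polyClosure_exp_apply, ← hFf]

/-- On `L`, the function `f` has a logarithm that can be approximated by polynomials. -/
def HasPolyLog (L : Set ℂ) (f : ℂ → ℂ) : Prop :=
  ∃ g, PolyApprox L g ∧ ∀ x ∈ L, f x = Complex.exp (g x)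

theorem HasPolyLog.polyApprox (hL : IsCompact L) (h : HasPolyLog L f) : PolyApprox L f := by
  obtain ⟨g, hg, hfg⟩ := h
  exact (hg.exp hL).congr fun x hx => (hfg x hx).symm

theorem HasPolyLog.inv (hL : IsCompact L) (h : HasPolyLog L f) :
    HasPolyLog L (fun x => (f x)⁻¹) := by
  obtain ⟨g, hg, hfg⟩ := h
  exact ⟨_, hg.neg hL, fun x hx => by simp only [hfg x hx, Complex.exp_neg]⟩

theorem HasPolyLog.mul (hL : IsCompact L) (hf : HasPolyLog L f) (hg : HasPolyLog L g) :
    HasPolyLog L (fun x => f x * g x) := by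
  obtain ⟨a, ha, hfa⟩ := hf
  obtain ⟨b, hb, hgb⟩ := hg
  exact ⟨_, ha.add hL hb, fun x hx => by simp only [hfa x hx, hgb x hx, Complex.exp_add]⟩

theorem HasPolyLog.congr (h : HasPolyLog L f) (hfg : EqOn f g L) : HasPolyLog L g := by
  obtain ⟨a, ha, hfa⟩ := h
  exact ⟨a, ha, fun x hx => by rw [← hfg hx, hfa x hx]⟩

theorem hasPolyLog_const {c : ℂ} (hc : c ≠ 0) : HasPolyLog L (fun _ => c) :=
  ⟨_, polyApprox_const L (Complex.log c), fun _ _ => (Complex.exp_log hc).symm⟩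

/-- Functions close to `1` have logarithms. -/
theorem exists_hasPolyLog_of_near_one (hL : IsCompact L) :
    ∃ η > 0, ∀ f, PolyApprox L f → (∀ x ∈ L, ‖f x - 1‖ < η) → HasPolyLog L f := by
  have := isCompact_iff_compactSpace.1 hL
  have : CompleteSpace (polyClosure L) :=
    (Subalgebra.isClosed_topologicalClosure (polynomialFunctions L)).completeSpace_coe
  have h1 := (hasStrictFDerivAt_exp_zero (𝕂 := ℂ) (𝔸 := polyClosure L))
  -- The derivative of `exp` at `0` is the identity, so `exp` maps neighbourhoods of `0` in the
  -- algebra onto neighbourhoods of `1`.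
  have h2 : Filter.map (NormedSpace.exp : polyClosure L → polyClosure L) (𝓝 0) = 𝓝 1 := by
    have := HasStrictFDerivAt.map_nhds_eq_of_equiv
      (f' := ContinuousLinearEquiv.refl ℂ (polyClosure L)) h1
    rwa [NormedSpace.exp_zero] at this
  have h3 : range (NormedSpace.exp : polyClosure L → polyClosure L) ∈ 𝓝 (1 : polyClosure L) := by
    rw [← h2, mem_map]
    exact univ_mem' fun x => mem_range_self x
  obtain ⟨η, hη, hball⟩ := Metric.mem_nhds_iff.1 h3
  refine ⟨η / 2, by linarith, fun f hf hfn => ?_⟩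
  obtain ⟨F, hF, hFf⟩ := polyApprox_iff.1 hf
  have hmem : (⟨F, hF⟩ : polyClosure L) ∈ ball (1 : polyClosure L) η := by
    rw [mem_ball, Subtype.dist_eq]
    refine lt_of_le_of_lt ((ContinuousMap.dist_le (by linarith)).2 fun x => ?_) (half_lt_self hη)
    have h4 := (hfn x x.2).le
    rw [← hFf] at h4
    rw [dist_eq_norm]
    exact h4
  obtain ⟨G, hG⟩ := hball hmem
  refine ⟨fun z => open Classical in if hz : z ∈ L then (G : C(L, ℂ)) ⟨z, hz⟩ else 0, ?_, ?_⟩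
  · exact polyApprox_iff.2 ⟨G, G.2, fun x => by simp⟩
  · intro x hx
    simp only [hx, dite_true]
    rw [← polyClosure_exp_apply, hG]
    exact (hFf ⟨x, hx⟩).symm

/-- If `Lᶜ` is connected and unbounded, then `x - q` has a logarithm on `L` for `q ∉ L`. -/
theorem hasPolyLog_sub (hL : IsCompact L) (hLc : IsPreconnected Lᶜ) {q : ℂ} (hq : q ∉ L) :
    HasPolyLog L (fun x => x - q) := by
  obtain ⟨η, hη, hone⟩ := exists_hasPolyLog_of_near_one hL
  -- Write `x - q' = (x - q) (1 + (q - q') / (x - q))`. The second factor is close to `1` when `q'`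
  -- is close to `q`.
  have key : ∀ q ∉ L, ∀ q' ∉ L, (∀ x ∈ L, ‖q - q'‖ < η * ‖x - q‖) →
      HasPolyLog L (fun x => x - q) → HasPolyLog L (fun x => x - q') := by
    intro q hq q' hq' hd h
    have h1 : HasPolyLog L (fun x => 1 + (q - q') * (x - q)⁻¹) := by
      refine hone _ ((polyApprox_const L 1).add hL
        (((h.inv hL).polyApprox hL).const_mul hL (q - q'))) fun x hx => ?_
      have hx0 : 0 < ‖x - q‖ := norm_pos_iff.2 (sub_ne_zero.2 fun e => hq (e ▸ hx))
      rw [add_sub_cancel_left, norm_mul, norm_inv, ← div_eq_mul_inv, div_lt_iff₀ hx0]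
      exact hd x hx
    refine (h.mul hL h1).congr fun x hx => ?_
    have hx0 : x - q ≠ 0 := sub_ne_zero.2 fun e => hq (e ▸ hx)
    field_simp
    ring
  obtain ⟨M, hM⟩ := hL.isBounded.exists_norm_le
  -- a point near infinity
  obtain ⟨q₀, hq₀L, hq₀⟩ : ∃ q₀ ∉ L, HasPolyLog L (fun x => x - q₀) := by
    -- The summand `(|M| + 1) / η` makes `|x| / t < η` on `L`, and `|M| + 1` keeps `t` off `L`.
    set t : ℝ := |M| + 1 + (|M| + 1) / η with ht
    have ht1 : |M| + 1 ≤ t := by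
      have : 0 ≤ (|M| + 1) / η := by positivity
      linarith
    have ht0 : 0 < t := by have := abs_nonneg M; linarith
    have hnt : ‖(t : ℂ)‖ = t := by rw [Complex.norm_real, Real.norm_of_nonneg ht0.le]
    refine ⟨(t : ℂ), fun h => ?_, ?_⟩
    · have := hM _ h
      rw [hnt] at this
      have := le_abs_self M
      linarith
    · have htc : (t : ℂ) ≠ 0 := by exact_mod_cast ht0.ne'
      have h1 : HasPolyLog L (fun x => 1 + (-(t : ℂ)⁻¹) * x) := by
        refine hone _ ((polyApprox_const L 1).add hL ((polyApprox_id L).const_mul hL _))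
          fun x hx => ?_
        rw [add_sub_cancel_left, norm_mul, norm_neg, norm_inv, hnt, inv_mul_lt_iff₀ ht0]
        have h2 : ‖x‖ ≤ |M| := (hM x hx).trans (le_abs_self M)
        have h3 : (|M| + 1) / η * η = |M| + 1 := div_mul_cancel₀ _ hη.ne'
        have h4 := abs_nonneg M
        nlinarith
      refine ((hasPolyLog_const (neg_ne_zero.2 htc)).mul hL h1).congr fun x _ => ?_
      field_simp
      ring
  -- The property is locally constant in `q ∈ Lᶜ`, so it spreads from `q₀` over the connected set
  -- `Lᶜ`.
  refine (hLc.induction₂ (fun q q' => HasPolyLog L (fun x => x - q) ↔ HasPolyLog L (fun x => x - q'))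
    ?_ (fun _ _ _ _ _ _ h1 h2 => h1.trans h2) (fun _ _ _ _ h => h.symm) hq₀L hq).1 hq₀
  intro q hq
  obtain ⟨d, hd, hdL⟩ : ∃ d > 0, ∀ x ∈ L, d ≤ ‖x - q‖ := by
    obtain ⟨d, hd, hball⟩ := Metric.isOpen_iff.1 hL.isClosed.isOpen_compl q hq
    refine ⟨d, hd, fun x hx => ?_⟩
    by_contra hlt
    refine hball (a := x) ?_ hx
    rw [mem_ball, dist_eq_norm]
    exact not_le.1 hlt
  have hball : ball q (min (d / 2) (η * (d / 2))) ∈ 𝓝 q := ball_mem_nhds _ (by positivity)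
  filter_upwards [mem_nhdsWithin_of_mem_nhds hball, self_mem_nhdsWithin] with q' hq'b hq'
  rw [mem_ball, dist_eq_norm, lt_min_iff] at hq'b
  constructor
  · refine key q hq q' hq' fun x hx => ?_
    rw [norm_sub_rev]
    have := hdL x hx
    nlinarith [hq'b.2]
  · refine key q' hq' q hq fun x hx => ?_
    have h1 := hdL x hx
    have h2 : ‖x - q‖ ≤ ‖x - q'‖ + ‖q' - q‖ := by
      have := norm_add_le (x - q') (q' - q); simpa using this
    have h3 : d / 2 ≤ ‖x - q'‖ := by linarith [hq'b.1]
    nlinarith [hq'b.2]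

/-- The polynomial splits into linear factors `x - q` with `q ∉ L`, and each of them has a
logarithm. -/
theorem hasPolyLog_eval (hL : IsCompact L) (hLc : IsPreconnected Lᶜ) (p : ℂ[X])
    (hp0 : p ≠ 0) (hp : ∀ x ∈ L, p.eval x ≠ 0) : HasPolyLog L (fun x => p.eval x) := by
  have hs := IsAlgClosed.splits p
  have key : ∀ s : Multiset ℂ, (∀ q ∈ s, q ∉ L) →
      HasPolyLog L (fun x => (s.map fun a => x - a).prod) := by
    intro s
    induction s using Multiset.induction_on with
    | empty => intro _; simpa using hasPolyLog_const (L := L) one_ne_zero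
    | cons a s ih =>
      intro h
      have h1 := ih fun q hq => h q (Multiset.mem_cons_of_mem hq)
      simpa using (hasPolyLog_sub hL hLc (h a (Multiset.mem_cons_self a s))).mul hL h1
  have h1 := key p.roots fun q hq hqL => hp q hqL (by
    rw [mem_roots hp0] at hq; exact hq)
  refine ((hasPolyLog_const (leadingCoeff_ne_zero.2 hp0)).mul hL h1).congr fun x _ => ?_
  have h2 := hs.eval_eq_prod_roots x
  exact h2.symm

/-- A nonvanishing limit of polynomials on a compact set with connected complement has a
logarithm. -/
theorem PolyApprox.hasPolyLog (hL : IsCompact L) (hLc : IsPreconnected Lᶜ) (hf : PolyApprox L f)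
    (hne : ∀ x ∈ L, f x ≠ 0) : HasPolyLog L f := by
  rcases L.eq_empty_or_nonempty with rfl | hLne
  · exact ⟨0, fun ε hε => ⟨0, by simp⟩, by simp⟩
  obtain ⟨η, hη, hone⟩ := exists_hasPolyLog_of_near_one hL
  have := isCompact_iff_compactSpace.1 hL
  have hcont : ContinuousOn f L := by
    obtain ⟨F, hF, hFf⟩ := polyApprox_iff.1 hf
    rw [continuousOn_iff_continuous_domRestrict]
    exact F.continuous.congr hFf
  obtain ⟨x₀, hx₀, hmin⟩ := hL.exists_isMinOn hLne hcont.norm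
  set m := ‖f x₀‖ with hm
  have hm0 : 0 < m := norm_pos_iff.2 (hne x₀ hx₀)
  -- The bound `m / 2` keeps `p` away from zero on `L`, and `η * (m / 2)` then brings `f / p` within
  -- `η` of `1`.
  obtain ⟨p, hp⟩ := hf (min (m / 2) (η * (m / 2))) (by positivity)
  have hpm : ∀ x ∈ L, m / 2 < ‖p.eval x‖ := by
    intro x hx
    have h1 : m ≤ ‖f x‖ := hmin hx
    have h2 := (lt_min_iff.1 (hp x hx)).1
    have h3 := norm_sub_norm_le (f x) (p.eval x)
    linarith
  have hp0 : p ≠ 0 := by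
    rintro rfl
    have := hpm x₀ hx₀
    simp at this
    linarith
  have hpne : ∀ x ∈ L, p.eval x ≠ 0 := fun x hx =>
    norm_pos_iff.1 ((half_pos hm0).trans (hpm x hx))
  have hpl := hasPolyLog_eval hL hLc p hp0 hpne
  have h1 : HasPolyLog L (fun x => f x * (p.eval x)⁻¹) := by
    refine hone _ (hf.mul hL ((hpl.inv hL).polyApprox hL)) fun x hx => ?_
    have h2 := (lt_min_iff.1 (hp x hx)).2
    have h3 : f x * (p.eval x)⁻¹ - 1 = (f x - p.eval x) * (p.eval x)⁻¹ := by
      rw [sub_mul, mul_inv_cancel₀ (hpne x hx)]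
    rw [h3, norm_mul, norm_inv, ← div_eq_mul_inv, div_lt_iff₀ (norm_pos_iff.2 (hpne x hx))]
    nlinarith [hpm x hx]
  refine (hpl.mul hL h1).congr fun x hx => ?_
  have := hpne x hx
  field_simp

end compact

end ConformalWelding

/-! ### Normal families and square roots of locally approximable functions. -/

namespace ConformalWelding

open Metric Complex Polynomial

/-- **Montel's theorem**, in terms of ultrafilters. -/
theorem exists_tendstoLocallyUniformlyOn_ultrafilter {ι : Type*} {F : ι → ℂ → ℂ} {U : Set ℂ}
    (hU : IsOpen U) (hF : ∀ n, DifferentiableOn ℂ (F n) U) {C : ℝ}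
    (hC : ∀ n, ∀ x ∈ U, ‖F n x‖ ≤ C) (𝒰 : Ultrafilter ι) :
    ∃ f : ℂ → ℂ, TendstoLocallyUniformlyOn F f 𝒰 U := by
  have hlim : ∀ x, ∃ y, x ∈ U → Tendsto (fun n => F n x) 𝒰 (𝓝 y) := by
    intro x
    by_cases hx : x ∈ U
    · obtain ⟨y, -, hy⟩ := (isCompact_closedBall (0 : ℂ) C).ultrafilter_le_nhds
        (𝒰.map fun n => F n x) (by
          rw [le_principal_iff]
          exact Filter.mem_map.2 (univ_mem' fun n => by simpa using hC n x hx))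
      exact ⟨y, fun _ => hy⟩
    · exact ⟨0, fun h => absurd h hx⟩
  choose f hf using hlim
  refine ⟨f, Metric.tendstoLocallyUniformlyOn_iff.2 fun ε hε x hx => ?_⟩
  obtain ⟨r, hr, hball⟩ := Metric.isOpen_iff.1 hU x hx
  -- The Schwarz lemma bounds the Lipschitz constants near `x` independently of `n`. This turns
  -- pointwise convergence along the ultrafilter into locally uniform convergence.
  have hlip : ∀ n, ∀ y ∈ ball x r, dist (F n y) (F n x) ≤ 2 * C / r * dist y x := by
    intro n y hy
    refine dist_le_div_mul_dist_of_mapsTo_ball ((hF n).mono hball) (fun z hz => ?_) hy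
    rw [mem_closedBall, dist_eq_norm]
    linarith [norm_sub_le (F n z) (F n x), hC n z (hball hz), hC n x hx]
  have hlipf : ∀ y ∈ ball x r, dist (f y) (f x) ≤ 2 * C / r * dist y x := fun y hy =>
    le_of_tendsto ((hf y (hball hy)).dist (hf x hx)) (Eventually.of_forall fun n => hlip n y hy)
  have h1 : ∀ᶠ y in 𝓝 x, y ∈ ball x r ∧ 2 * C / r * dist y x < ε / 3 := by
    have h2 : Tendsto (fun y => 2 * C / r * dist y x) (𝓝 x) (𝓝 (2 * C / r * dist x x)) :=
      (tendsto_id.dist tendsto_const_nhds).const_mul _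
    rw [dist_self, mul_zero] at h2
    exact Filter.Eventually.and (ball_mem_nhds x hr) (h2.eventually_lt_const (by linarith))
  refine ⟨_, mem_nhdsWithin_of_mem_nhds h1, ?_⟩
  filter_upwards [Metric.tendsto_nhds.1 (hf x hx) (ε / 3) (by linarith)] with n hn y hy
  calc dist (f y) (F n y) ≤ dist (f y) (f x) + dist (f x) (F n x) + dist (F n x) (F n y) :=
        dist_triangle4 _ _ _ _
    _ < ε / 3 + ε / 3 + ε / 3 := by
        have h2 := (hlipf y hy.1).trans_lt hy.2
        have h3 := (hlip n y hy.1).trans_lt hy.2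
        rw [dist_comm] at hn h3
        exact add_lt_add (add_lt_add h2 hn) h3
    _ = ε := by ring

/-- `f` can be approximated by polynomials on all compact subsets of `G`. -/
def Tame (G : Set ℂ) (f : ℂ → ℂ) : Prop := ∀ L ⊆ G, IsCompact L → PolyApprox L f

/-- Every compact subset of `G` is contained in a compact subset of `G` with connected
complement. -/
def HasRungeExhaustion (G : Set ℂ) : Prop :=
  ∀ M ⊆ G, IsCompact M → ∃ L, M ⊆ L ∧ L ⊆ G ∧ IsCompact L ∧ IsPreconnected Lᶜ

variable {G : Set ℂ} {f g : ℂ → ℂ}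

theorem Tame.add (hf : Tame G f) (hg : Tame G g) : Tame G (fun x => f x + g x) :=
  fun L hL hc => (hf L hL hc).add hc (hg L hL hc)

theorem Tame.sub (hf : Tame G f) (hg : Tame G g) : Tame G (fun x => f x - g x) :=
  fun L hL hc => (hf L hL hc).sub hc (hg L hL hc)

theorem Tame.mul (hf : Tame G f) (hg : Tame G g) : Tame G (fun x => f x * g x) :=
  fun L hL hc => (hf L hL hc).mul hc (hg L hL hc)

theorem Tame.const_mul (c : ℂ) (hf : Tame G f) : Tame G (fun x => c * f x) :=
  fun L hL hc => (hf L hL hc).const_mul hc c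

theorem tame_const (c : ℂ) : Tame G (fun _ => c) := fun L _ _ => polyApprox_const L c

theorem tame_id : Tame G (fun x => x) := fun L _ _ => polyApprox_id L

/-- After enlarging the compact set to one with connected complement, `f` has a logarithm there, and
`exp` of its negative is approximable. Here and in `Tame.exists_sq` the Runge exhaustion plays the
part of simple connectivity. -/
theorem Tame.inv (hG : HasRungeExhaustion G) (hf : Tame G f) (hne : ∀ x ∈ G, f x ≠ 0) :
    Tame G (fun x => (f x)⁻¹) := by
  intro M hM hMc
  obtain ⟨L, hML, hLG, hL, hLc⟩ := hG M hM hMc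
  exact ((((hf L hLG hL).hasPolyLog hL hLc fun x hx => hne x (hLG hx)).inv hL).polyApprox hL).mono
    hML

theorem Tame.differentiableOn (hGo : IsOpen G) (hf : Tame G f) : DifferentiableOn ℂ f G := by
  intro x hx
  obtain ⟨r, hr, hball⟩ := Metric.isOpen_iff.1 hGo x hx
  have h := hf (closedBall x (r / 2)) ((closedBall_subset_ball (half_lt_self hr)).trans hball)
    (isCompact_closedBall _ _)
  choose p hp using fun n : ℕ => h (1 / ((n : ℝ) + 1)) (by positivity)
  have h1 : TendstoUniformlyOn (fun (n : ℕ) x => (p n).eval x) f atTop (ball x (r / 2)) := by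
    rw [Metric.tendstoUniformlyOn_iff]
    intro ε hε
    filter_upwards [(tendsto_one_div_add_atTop_nhds_zero_nat (𝕜 := ℝ)).eventually_lt_const hε]
      with n hn y hy
    rw [dist_eq_norm]
    exact (hp n y (ball_subset_closedBall hy)).trans hn
  have h2 := h1.tendstoLocallyUniformlyOn.differentiableOn
    (Eventually.of_forall fun n => (p n).differentiable.differentiableOn) isOpen_ball
  exact (h2.differentiableAt (ball_mem_nhds x (half_pos hr))).differentiableWithinAt

theorem tame_of_tendsto {ι : Type*} {l : Filter ι} [l.NeBot] {F : ι → ℂ → ℂ}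
    (hGo : IsOpen G) (hF : ∀ i, Tame G (F i)) (h : TendstoLocallyUniformlyOn F f l G) :
    Tame G f := by
  intro L hL hLc ε hε
  have hu := (tendstoLocallyUniformlyOn_iff_forall_isCompact hGo).1 h L hL hLc
  obtain ⟨n, hn⟩ := (Metric.tendstoUniformlyOn_iff.1 hu (ε / 2) (half_pos hε)).exists
  obtain ⟨p, hp⟩ := hF n L hL hLc (ε / 2) (half_pos hε)
  refine ⟨p, fun x hx => ?_⟩
  have h1 := hn x hx
  rw [dist_eq_norm] at h1
  have h2 := norm_add_le (f x - F n x) (F n x - p.eval x)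
  rw [sub_add_sub_cancel] at h2
  linarith [hp x hx]

/-- A compact subset of a connected open set is contained in a compact connected subset. -/
theorem exists_isCompact_isPreconnected_superset (hGo : IsOpen G) (hGc : IsPreconnected G)
    {z₀ : ℂ} (hz₀ : z₀ ∈ G) {L : Set ℂ} (hL : IsCompact L) (hLG : L ⊆ G) :
    ∃ M, L ⊆ M ∧ M ⊆ G ∧ IsCompact M ∧ IsPreconnected M ∧ z₀ ∈ M := by
  have hpath : IsPathConnected G :=
    hGo.isConnected_iff_isPathConnected.1 ⟨⟨z₀, hz₀⟩, hGc⟩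
  refine hL.induction_on (p := fun L => ∃ M, L ⊆ M ∧ M ⊆ G ∧ IsCompact M ∧ IsPreconnected M ∧ z₀ ∈ M)
    ⟨{z₀}, by simp, by simpa using hz₀, isCompact_singleton, isPreconnected_singleton, rfl⟩
    (fun s t hst ⟨M, h1, h2⟩ => ⟨M, hst.trans h1, h2⟩) ?_ ?_
  · rintro s t ⟨M, h1, h2, h3, h4, h5⟩ ⟨M', h1', h2', h3', h4', h5'⟩
    exact ⟨M ∪ M', union_subset_union h1 h1', union_subset h2 h2', h3.union h3',
      h4.union z₀ h5 h5' h4', Or.inl h5⟩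
  · intro x hx
    obtain ⟨r, hr, hball⟩ := Metric.nhds_basis_closedBall.mem_iff.1 (hGo.mem_nhds (hLG hx))
    obtain ⟨γ, hγ⟩ := hpath.joinedIn z₀ hz₀ x (hLG hx)
    refine ⟨closedBall x r, mem_nhdsWithin_of_mem_nhds (closedBall_mem_nhds x hr),
      range γ ∪ closedBall x r, subset_union_right, union_subset ?_ hball,
      (isCompact_range γ.continuous).union (isCompact_closedBall x r), ?_, Or.inl ⟨0, γ.source⟩⟩
    · rintro _ ⟨t, rfl⟩
      exact hγ t
    · exact (isPreconnected_range γ.continuous).union x ⟨1, γ.target⟩ (mem_closedBall_self hr.le)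
        (convex_closedBall x r).isPreconnected

theorem PolyApprox.continuousOn {L : Set ℂ} (hL : IsCompact L) (h : PolyApprox L f) :
    ContinuousOn f L := by
  have := isCompact_iff_compactSpace.1 hL
  obtain ⟨F, hF, hFf⟩ := polyApprox_iff.1 h
  rw [continuousOn_iff_continuous_domRestrict]
  exact F.continuous.congr hFf

/-- Nonvanishing tame functions have tame square roots. -/
theorem Tame.exists_sq (hGo : IsOpen G) (hGc : IsPreconnected G) (hG : HasRungeExhaustion G)
    {z₀ : ℂ} (hz₀ : z₀ ∈ G) (hf : Tame G f) (hne : ∀ x ∈ G, f x ≠ 0) :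
    ∃ s, Tame G s ∧ ∀ x ∈ G, s x ^ 2 = f x := by
  obtain ⟨c, hc⟩ : ∃ c : ℂ, c ^ 2 = f z₀ := IsAlgClosed.exists_pow_nat_eq _ two_pos
  have hc0 : c ≠ 0 := by
    rintro rfl
    exact hne z₀ hz₀ (by simpa using hc.symm)
  -- square roots on compact sets
  have hex : ∀ M : Set ℂ, ∃ s : ℂ → ℂ, IsCompact M → M ⊆ G → z₀ ∈ M →
      PolyApprox M s ∧ (∀ x ∈ M, s x ^ 2 = f x) ∧ s z₀ = c := by
    intro M
    by_cases hM : IsCompact M ∧ M ⊆ G ∧ z₀ ∈ M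
    · obtain ⟨hMc, hMG, hzM⟩ := hM
      obtain ⟨L, hML, hLG, hL, hLc⟩ := hG M hMG hMc
      obtain ⟨g, hg, hfg⟩ := (hf L hLG hL).hasPolyLog hL hLc fun x hx => hne x (hLG hx)
      have he : PolyApprox L (fun x => Complex.exp ((2 : ℂ)⁻¹ * g x)) :=
        (hg.const_mul hL _).exp hL
      have hsq : ∀ x ∈ L, Complex.exp ((2 : ℂ)⁻¹ * g x) ^ 2 = f x := by
        intro x hx
        rw [hfg x hx, ← Complex.exp_nat_mul]
        congr 1
        push_cast
        ring
      set e := Complex.exp ((2 : ℂ)⁻¹ * g z₀) with he_def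
      have he0 : e ≠ 0 := Complex.exp_ne_zero _
      have hce : (c / e) ^ 2 = 1 := by
        rw [div_pow, hc, hsq z₀ (hML hzM), div_self (hne z₀ hz₀)]
      refine ⟨fun x => c / e * Complex.exp ((2 : ℂ)⁻¹ * g x), fun _ _ _ =>
        ⟨(he.const_mul hL _).mono hML, fun x hx => ?_, ?_⟩⟩
      · rw [mul_pow, hce, one_mul, hsq x (hML hx)]
      · exact div_mul_cancel₀ c he0
    · exact ⟨0, fun h1 h2 h3 => absurd ⟨h1, h2, h3⟩ hM⟩
  choose S hS using hex
  -- Two continuous square roots that agree at `z₀` agree on every connected set containing `z₀`.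
  -- Hence the roots found on compact sets are compatible and define one function on `G`.
  have huniq : ∀ M N : Set ℂ, M ⊆ N → IsPreconnected M → IsCompact M → IsCompact N → N ⊆ G →
      z₀ ∈ M → EqOn (S M) (S N) M := by
    intro M N hMN hMp hMc hNc hN hz
    obtain ⟨a1, a2, a3⟩ := hS M hMc (hMN.trans hN) hz
    obtain ⟨b1, b2, b3⟩ := hS N hNc hN (hMN hz)
    refine hMp.eq_of_sq_eq (a1.continuousOn hMc) ((b1.continuousOn hNc).mono hMN) ?_ ?_ hz
      (a3.trans b3.symm)
    · intro x hx
      simp only [Pi.pow_apply, a2 x hx, b2 x (hMN hx)]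
    · intro x hx h0
      refine hne x (hN (hMN hx)) ?_
      rw [← b2 x (hMN hx), h0]
      simp
  choose! N hxN hNG hNc hNp hzN using fun x (hx : x ∈ G) =>
    (exists_isCompact_isPreconnected_superset hGo hGc hz₀ (isCompact_singleton (x := x))
      (singleton_subset_iff.2 hx))
  have hxN : ∀ x ∈ G, x ∈ N x := fun x hx => hxN x hx rfl
  have hagree : ∀ M : Set ℂ, IsPreconnected M → IsCompact M → M ⊆ G → z₀ ∈ M →
      EqOn (S M) (fun x => S (N x) x) M := by
    intro M hMp hMc hMG hz x hx
    have hxG := hMG hx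
    have h1 := huniq M (M ∪ N x) subset_union_left hMp hMc (hMc.union (hNc x hxG))
      (union_subset hMG (hNG x hxG)) hz hx
    have h2 := huniq (N x) (M ∪ N x) subset_union_right (hNp x hxG) (hNc x hxG)
      (hMc.union (hNc x hxG)) (union_subset hMG (hNG x hxG)) (hzN x hxG) (hxN x hxG)
    exact h1.trans h2.symm
  refine ⟨fun x => S (N x) x, ?_, fun x hx =>
    (hS (N x) (hNc x hx) (hNG x hx) (hzN x hx)).2.1 x (hxN x hx)⟩
  intro L hLG hL
  obtain ⟨M, hLM, hMG, hMc, hMp, hzM⟩ :=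
    exists_isCompact_isPreconnected_superset hGo hGc hz₀ hL hLG
  exact ((hS M hMc hMG hzM).1.congr (hagree M hMp hMc hMG hzM)).mono hLM

end ConformalWelding

/-! ### The Riemann mapping theorem by the extremal method. -/

namespace ConformalWelding

open Metric Complex Polynomial

/-- The disc automorphism `z ↦ (z - a) / (1 - conj a * z)`. -/
noncomputable def discAut (a z : ℂ) : ℂ := (z - a) * (1 - (starRingEnd ℂ) a * z)⁻¹

theorem one_sub_conj_mul_ne_zero {a z : ℂ} (ha : ‖a‖ < 1) (hz : ‖z‖ < 1) :
    1 - (starRingEnd ℂ) a * z ≠ 0 := by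
  intro h
  have h1 : ‖(starRingEnd ℂ) a * z‖ = 1 := by
    rw [← sub_eq_zero.1 h, norm_one]
  rw [norm_mul, RCLike.norm_conj] at h1
  nlinarith [norm_nonneg a, norm_nonneg z]

theorem norm_discAut_lt_one {a z : ℂ} (ha : ‖a‖ < 1) (hz : ‖z‖ < 1) : ‖discAut a z‖ < 1 := by
  have h0 := norm_pos_iff.2 (one_sub_conj_mul_ne_zero ha hz)
  rw [discAut, norm_mul, norm_inv, ← div_eq_mul_inv, div_lt_one h0]
  refine lt_of_pow_lt_pow_left₀ 2 h0.le ?_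
  have h1 : ‖1 - (starRingEnd ℂ) a * z‖ ^ 2 - ‖z - a‖ ^ 2 = (1 - ‖a‖ ^ 2) * (1 - ‖z‖ ^ 2) := by
    simp only [← Complex.normSq_eq_norm_sq, Complex.normSq_apply]
    simp
    ring
  have h2 : 0 < (1 - ‖a‖ ^ 2) * (1 - ‖z‖ ^ 2) := by
    have := norm_nonneg a
    have := norm_nonneg z
    exact mul_pos (by nlinarith) (by nlinarith)
  linarith

theorem discAut_injective {a z w : ℂ} (ha : ‖a‖ < 1) (hz : ‖z‖ < 1) (hw : ‖w‖ < 1)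
    (h : discAut a z = discAut a w) : z = w := by
  have hz0 := one_sub_conj_mul_ne_zero ha hz
  have hw0 := one_sub_conj_mul_ne_zero ha hw
  have ha0 := one_sub_conj_mul_ne_zero ha ha
  rw [discAut, discAut, ← div_eq_mul_inv, ← div_eq_mul_inv, div_eq_div_iff hz0 hw0] at h
  have : (z - w) * (1 - (starRingEnd ℂ) a * a) = 0 := by linear_combination h
  exact sub_eq_zero.1 ((mul_eq_zero.1 this).resolve_right ha0)

theorem hasDerivAt_discAut_comp {a : ℂ} {f : ℂ → ℂ} {f' x : ℂ} (hf : HasDerivAt f f' x)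
    (h0 : 1 - (starRingEnd ℂ) a * f x ≠ 0) :
    HasDerivAt (fun z => discAut a (f z))
      (f' * (1 - (starRingEnd ℂ) a * a) / (1 - (starRingEnd ℂ) a * f x) ^ 2) x := by
  have h1 : HasDerivAt (fun z => 1 - (starRingEnd ℂ) a * f z) (-((starRingEnd ℂ) a * f')) x :=
    (hf.const_mul _).const_sub 1
  have h2 := (hf.sub_const a).mul (h1.inv h0)
  refine h2.congr_deriv ?_
  simp only [Pi.inv_apply]
  field_simp
  ring

variable {G : Set ℂ} {f g : ℂ → ℂ}

theorem Tame.discAut (hG : HasRungeExhaustion G) (hf : Tame G f) {a : ℂ} (ha : ‖a‖ < 1)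
    (hf1 : MapsTo f G (ball 0 1)) : Tame G (fun x => discAut a (f x)) :=
  (hf.sub (tame_const a)).mul (((tame_const 1).sub (hf.const_mul _)).inv hG fun x hx =>
    one_sub_conj_mul_ne_zero ha (by simpa using hf1 hx))

/-- The competitors in the extremal problem for the Riemann mapping theorem. -/
structure RiemannCompetitor (G : Set ℂ) (f : ℂ → ℂ) : Prop where
  tame : Tame G f
  injOn : InjOn f G
  mapsTo : MapsTo f G (ball 0 1)
  map_zero : f 0 = 0

/-- Let `s` be a square root of `x - q`. Since `s` is injective with injective square, its image is
disjoint from the negative of its image. It therefore omits a disc about `-s 0`, and `1 / (s + s 0)`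
is bounded. -/
theorem exists_riemannCompetitor (hGo : IsOpen G) (hGc : IsPreconnected G)
    (hG : HasRungeExhaustion G) (h0 : (0 : ℂ) ∈ G) {q : ℂ} (hq : q ∉ G) :
    ∃ f, RiemannCompetitor G f ∧ deriv f 0 ≠ 0 := by
  obtain ⟨s, hs, hsq⟩ := (tame_id.sub (tame_const q)).exists_sq hGo hGc hG h0
    fun x hx h => hq (by rwa [sub_eq_zero.1 h] at hx)
  have hs0 : ∀ x ∈ G, s x ≠ 0 := fun x hx h => by
    have := hsq x hx
    rw [h] at this
    apply hq
    rwa [show q = x by linear_combination this]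
  have hsinj : InjOn s G := fun x hx y hy h => by
    have h1 := hsq x hx
    rw [h, hsq y hy] at h1
    linear_combination -h1
  have hconf : IsConformalOn s G := ⟨hGo, hs.differentiableOn hGo, hsinj⟩
  obtain ⟨δ, hδ, hball⟩ := Metric.mem_nhds_iff.1 (hconf.image_mem_nhds h0 (hGo.mem_nhds h0))
  have hfar : ∀ x ∈ G, δ ≤ ‖s x + s 0‖ := by
    intro x hx
    by_contra hlt
    have hmem : -s x ∈ ball (s 0) δ := by
      rw [mem_ball, dist_eq_norm, ← norm_neg]
      simpa [add_comm] using not_le.1 hlt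
    obtain ⟨y, hy, hyx⟩ := hball hmem
    have h1 := hsq y hy
    rw [hyx, neg_sq, hsq x hx] at h1
    have hxy : x = y := by linear_combination h1
    rw [← hxy] at hyx
    exact hs0 x hx (by linear_combination hyx / 2)
  have hne : ∀ x ∈ G, s x + s 0 ≠ 0 := fun x hx => norm_pos_iff.1 (hδ.trans_le (hfar x hx))
  have hbd : ∀ x ∈ G, ‖(s x + s 0)⁻¹‖ ≤ δ⁻¹ := fun x hx => by
    rw [norm_inv]; exact inv_anti₀ hδ (hfar x hx)
  have hδc : ((δ / 3 : ℝ) : ℂ) ≠ 0 := by exact_mod_cast (by positivity : δ / 3 ≠ 0)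
  -- Both inverses are at most `δ⁻¹` in modulus, so the factor `δ / 3` gives the bound `2 / 3 < 1`.
  refine ⟨fun x => ((δ / 3 : ℝ) : ℂ) * ((s x + s 0)⁻¹ - (s 0 + s 0)⁻¹), ⟨?_, ?_, ?_, ?_⟩, ?_⟩
  · exact (((hs.add (tame_const (s 0))).inv hG hne).sub (tame_const _)).const_mul _
  · intro x hx y hy h
    have h1 := mul_left_cancel₀ hδc h
    have h2 := inv_injective (sub_left_injective h1)
    exact hsinj hx hy (add_right_cancel h2)
  · intro x hx
    rw [mem_ball_zero_iff, norm_mul, Complex.norm_real, Real.norm_of_nonneg (by positivity)]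
    have h1 := norm_sub_le (s x + s 0)⁻¹ (s 0 + s 0)⁻¹
    have h2 := hbd x hx
    have h3 := hbd 0 h0
    calc δ / 3 * ‖(s x + s 0)⁻¹ - (s 0 + s 0)⁻¹‖ ≤ δ / 3 * (δ⁻¹ + δ⁻¹) := by gcongr; linarith
      _ = 2 / 3 := by field_simp; ring
      _ < 1 := by norm_num
  · simp
  · have h1 := (hconf.2.1.differentiableAt (hGo.mem_nhds h0)).hasDerivAt
    have h2 := ((((h1.add_const (s 0)).inv (hne 0 h0)).sub_const (s 0 + s 0)⁻¹).const_mul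
      ((δ / 3 : ℝ) : ℂ)).deriv
    have h3 : deriv s 0 ≠ 0 := hconf.deriv_ne_zero h0
    have h4 := hne 0 h0
    intro h5
    have h6 := h2.symm.trans h5
    rcases mul_eq_zero.1 h6 with h7 | h7
    · exact hδc h7
    · rcases div_eq_zero_iff.1 h7 with h8 | h8
      · exact h3 (neg_eq_zero.1 h8)
      · exact h4 (pow_eq_zero_iff two_ne_zero |>.1 h8)

/-- Koebe's square root trick: move the omitted value `a` to `0`, take a square root, and move the
image `b` of the base point back to `0`. With `|a| = |b|²` the derivative at `0` grows by the factor
`(1 + |b|²) / (2 |b|) > 1`. -/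
theorem RiemannCompetitor.exists_norm_deriv_lt (hGo : IsOpen G) (hGc : IsPreconnected G)
    (hG : HasRungeExhaustion G) (h0 : (0 : ℂ) ∈ G) (hf : RiemannCompetitor G f)
    (hd : deriv f 0 ≠ 0) {a : ℂ} (ha : ‖a‖ < 1) (haf : a ∉ f '' G) :
    ∃ k, RiemannCompetitor G k ∧ ‖deriv f 0‖ < ‖deriv k 0‖ := by
  have hf1 : ∀ x ∈ G, ‖f x‖ < 1 := fun x hx => by simpa using hf.mapsTo hx
  have hht : Tame G (fun x => ConformalWelding.discAut a (f x)) := hf.tame.discAut hG ha hf.mapsTo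
  obtain ⟨s, hs, hsq⟩ := hht.exists_sq hGo hGc hG h0 fun x hx h => by
    rcases mul_eq_zero.1 h with h1 | h1
    · exact haf ⟨x, hx, sub_eq_zero.1 h1⟩
    · exact one_sub_conj_mul_ne_zero ha (hf1 x hx) (inv_eq_zero.1 h1)
  have hs1 : ∀ x ∈ G, ‖s x‖ < 1 := fun x hx => by
    have h1 := norm_discAut_lt_one ha (hf1 x hx)
    rw [← hsq x hx, norm_pow] at h1
    exact (pow_lt_one_iff_of_nonneg (norm_nonneg _) two_ne_zero).1 h1
  have hsinj : InjOn s G := fun x hx y hy h => by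
    refine hf.injOn hx hy (discAut_injective ha (hf1 x hx) (hf1 y hy) ?_)
    rw [← hsq x hx, ← hsq y hy, h]
  have hsm : MapsTo s G (ball 0 1) := fun x hx => by simpa using hs1 x hx
  set b := s 0 with hb
  have hb1 : ‖b‖ < 1 := hs1 0 h0
  have hb2 : b ^ 2 = -a := by
    rw [hb, hsq 0 h0, ConformalWelding.discAut, hf.map_zero]
    simp
  have hb0 : b ≠ 0 := by
    rintro h
    rw [h] at hb2
    refine haf ⟨0, h0, ?_⟩
    rw [hf.map_zero]
    linear_combination -hb2
  refine ⟨fun x => ConformalWelding.discAut b (s x), ⟨hs.discAut hG hb1 hsm, ?_, ?_, ?_⟩, ?_⟩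
  · intro x hx y hy h
    exact hsinj hx hy (discAut_injective hb1 (hs1 x hx) (hs1 y hy) h)
  · intro x hx
    simpa using norm_discAut_lt_one hb1 (hs1 x hx)
  · simp [ConformalWelding.discAut, hb]
  · have hds := ((hs.differentiableOn hGo).differentiableAt (hGo.mem_nhds h0)).hasDerivAt
    have hdf := ((hf.tame.differentiableOn hGo).differentiableAt (hGo.mem_nhds h0)).hasDerivAt
    have h1 := hasDerivAt_discAut_comp (a := a) hdf (one_sub_conj_mul_ne_zero ha (hf1 0 h0))
    have h2 : HasDerivAt (fun x => ConformalWelding.discAut a (f x)) (2 * b * deriv s 0) 0 := by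
      have h3 : HasDerivAt (fun x => s x ^ 2) (2 * b * deriv s 0) 0 := by
        refine (hds.fun_pow 2).congr_deriv ?_
        simp [hb]
      refine h3.congr_of_eventuallyEq ?_
      filter_upwards [hGo.mem_nhds h0] with x hx using (hsq x hx).symm
    have h4 := h1.unique h2
    rw [hf.map_zero, mul_zero, sub_zero, one_pow, div_one] at h4
    have h5 := (hasDerivAt_discAut_comp (a := b) hds (one_sub_conj_mul_ne_zero hb1 hb1)).deriv
    rw [h5]
    have hcb : ∀ z : ℂ, (starRingEnd ℂ) z * z = ((‖z‖ ^ 2 : ℝ) : ℂ) := fun z => by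
      rw [mul_comm, Complex.mul_conj, Complex.normSq_eq_norm_sq]
    have hna : ‖a‖ = ‖b‖ ^ 2 := by rw [← norm_pow, hb2, norm_neg]
    have hbn : 0 < ‖b‖ := norm_pos_iff.2 hb0
    have hbb : 0 < 1 - ‖b‖ ^ 2 := by nlinarith
    have hnb : ∀ z : ℂ, ‖z‖ < 1 → ‖1 - (starRingEnd ℂ) z * z‖ = 1 - ‖z‖ ^ 2 := fun z hz => by
      rw [hcb, ← Complex.ofReal_one, ← Complex.ofReal_sub, Complex.norm_real,
        Real.norm_of_nonneg (by nlinarith [norm_nonneg z])]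
    have h6 := congrArg norm h4
    rw [norm_mul, norm_mul, norm_mul, hnb a ha, hna, RCLike.norm_ofNat] at h6
    rw [norm_div, norm_mul, norm_pow, hnb b hb1]
    have h7 : ‖deriv s 0‖ * (1 - ‖b‖ ^ 2) / (1 - ‖b‖ ^ 2) ^ 2 = ‖deriv s 0‖ / (1 - ‖b‖ ^ 2) := by
      field_simp
    rw [h7, lt_div_iff₀ hbb]
    have hdn : 0 < ‖deriv f 0‖ := norm_pos_iff.2 hd
    have h8 : 2 * ‖b‖ * (‖deriv f 0‖ * (1 - ‖b‖ ^ 2)) < 2 * ‖b‖ * ‖deriv s 0‖ := by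
      rw [← h6]
      have h9 : 0 < ‖deriv f 0‖ * (1 - ‖b‖ ^ 2) := by positivity
      have h10 : 2 * ‖b‖ < 1 + ‖b‖ ^ 2 := by nlinarith
      nlinarith
    exact lt_of_mul_lt_mul_left h8 (by positivity)

/-- A solution of the extremal problem in the Riemann mapping theorem exists. -/
theorem exists_riemannCompetitor_isMax (hGo : IsOpen G) (hGc : IsPreconnected G)
    (hG : HasRungeExhaustion G) (h0 : (0 : ℂ) ∈ G) {q : ℂ} (hq : q ∉ G) :
    ∃ f, RiemannCompetitor G f ∧ deriv f 0 ≠ 0 ∧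
      ∀ k, RiemannCompetitor G k → ‖deriv k 0‖ ≤ ‖deriv f 0‖ := by
  obtain ⟨f₀, hf₀, hd₀⟩ := exists_riemannCompetitor hGo hGc hG h0 hq
  set S : Set ℝ := (fun f : ℂ → ℂ => ‖deriv f 0‖) '' {f | RiemannCompetitor G f} with hS
  have hSne : S.Nonempty := ⟨_, f₀, hf₀, rfl⟩
  obtain ⟨r, hr, hball⟩ := Metric.isOpen_iff.1 hGo 0 h0
  have hSb : BddAbove S := by
    refine ⟨1 / r, ?_⟩
    rintro _ ⟨f, hf, rfl⟩
    refine norm_deriv_le_div_of_mapsTo_ball ((hf.tame.differentiableOn hGo).mono hball)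
      (fun z hz => ?_) hr
    rw [hf.map_zero]
    exact ball_subset_closedBall (hf.mapsTo (hball hz))
  obtain ⟨u, -, hu, huS⟩ := exists_seq_tendsto_sSup hSne hSb
  choose F hF hFu using huS
  have hF : ∀ n, RiemannCompetitor G (F n) := hF
  obtain ⟨f, hlim⟩ := exists_tendstoLocallyUniformlyOn_ultrafilter hGo
    (fun n => (hF n).tame.differentiableOn hGo) (C := 1)
    (fun n x hx => by simpa using (mem_ball_zero_iff.1 ((hF n).mapsTo hx)).le) (hyperfilter ℕ)
  have hft : Tame G f := tame_of_tendsto hGo (fun n => (hF n).tame) hlim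
  have hfd := hft.differentiableOn hGo
  have hf0 : f 0 = 0 := by
    refine tendsto_nhds_unique (hlim.tendsto_at h0) ?_
    simp only [(hF _).map_zero]
    exact tendsto_const_nhds
  have hder : ‖deriv f 0‖ = sSup S := by
    have h1 := ((hlim.deriv (Eventually.of_forall fun n => (hF n).tame.differentiableOn hGo)
      hGo).tendsto_at h0).norm
    have h2 := hu.mono_left Nat.hyperfilter_le_atTop
    exact tendsto_nhds_unique (h1.congr fun n => hFu n) h2
  have hmax : ∀ k, RiemannCompetitor G k → ‖deriv k 0‖ ≤ ‖deriv f 0‖ := fun k hk => by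
    rw [hder]
    exact le_csSup hSb ⟨k, hk, rfl⟩
  have hd : deriv f 0 ≠ 0 := by
    rw [← norm_pos_iff]
    exact (norm_pos_iff.2 hd₀).trans_le (hmax f₀ hf₀)
  have hnc : ∃ x ∈ G, f x ≠ 0 := by
    by_contra! hcon
    apply hd
    have : f =ᶠ[𝓝 0] fun _ => 0 := by
      filter_upwards [hGo.mem_nhds h0] with x hx using hcon x hx
    rw [this.deriv_eq, deriv_const]
  have hle : ∀ x ∈ G, ‖f x‖ ≤ 1 := fun x hx =>
    le_of_tendsto (hlim.tendsto_at hx).norm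
      (Eventually.of_forall fun n => (mem_ball_zero_iff.1 ((hF n).mapsTo hx)).le)
  refine ⟨f, ⟨hft, ?_, ?_, hf0⟩, hd, hmax⟩
  · obtain ⟨x, hx, hfx⟩ := hnc
    exact injOn_of_tendstoLocallyUniformlyOn hGo hGc (fun n => (hF n).tame.differentiableOn hGo)
      (fun n => (hF n).injOn) hlim ⟨x, hx, 0, h0, by rwa [hf0]⟩
  · intro x hx
    rw [mem_ball_zero_iff]
    by_contra hge
    obtain ⟨y, hy, hfy⟩ := hnc
    -- A value of modulus at least `1` would be a maximum of `|f|`, so `f` would be constant, equal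
    -- to `f 0 = 0`.
    have h1 : IsMaxOn (norm ∘ f) G x := fun z hz => (hle z hz).trans (not_lt.1 hge)
    have h2 := eqOn_of_isPreconnected_of_isMaxOn_norm hGc hGo hfd hx h1
    have h3 := h2 h0
    rw [hf0, Function.const_apply] at h3
    rw [← h3] at hge
    simp at hge

/-- The **Riemann mapping theorem** for domains with a Runge exhaustion. -/
theorem exists_isConformalOn_ball (hGo : IsOpen G) (hGc : IsPreconnected G)
    (hG : HasRungeExhaustion G) (h0 : (0 : ℂ) ∈ G) {q : ℂ} (hq : q ∉ G) :
    ∃ F : ℂ → ℂ, IsConformalOn F (ball 0 1) ∧ F '' ball 0 1 = G ∧ F 0 = 0 ∧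
      ∃ c : ℝ, 0 < c ∧ HasDerivAt F c 0 := by
  obtain ⟨f, hf, hd, hmax⟩ := exists_riemannCompetitor_isMax hGo hGc hG h0 hq
  have himg : f '' G = ball 0 1 := by
    refine hf.mapsTo.image_subset.antisymm fun a ha => ?_
    by_contra haf
    obtain ⟨k, hk, hlt⟩ := hf.exists_norm_deriv_lt hGo hGc hG h0 hd (by simpa using ha) haf
    exact absurd (hmax k hk) (not_le.2 hlt)
  have hconf : IsConformalOn f G := ⟨hGo, hf.tame.differentiableOn hGo, hf.injOn⟩
  set g := Function.invFunOn f G with hg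
  have hleft : LeftInvOn g f G := hf.injOn.leftInvOn_invFunOn
  have hgd : DifferentiableOn ℂ g (ball 0 1) := himg ▸ hconf.differentiableOn_invFunOn
  have hright : ∀ y ∈ ball (0 : ℂ) 1, f (g y) = y ∧ g y ∈ G := by
    rw [← himg]
    exact fun y hy => ⟨Function.invFunOn_eq hy, Function.invFunOn_mem hy⟩
  have hg0 : g 0 = 0 := by
    have := hleft h0
    rwa [hf.map_zero] at this
  have hgc : IsConformalOn g (ball 0 1) := ⟨isOpen_ball, hgd, fun x hx y hy h => by
    rw [← (hright x hx).1, h, (hright y hy).1]⟩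
  have h01 : (0 : ℂ) ∈ ball (0 : ℂ) 1 := mem_ball_self one_pos
  set d := deriv g 0 with hd'
  have hd0 : d ≠ 0 := hgc.deriv_ne_zero h01
  -- Precomposing with the rotation by `u` changes the derivative `d` into `|d| > 0`.
  set u : ℂ := (starRingEnd ℂ) d / ‖d‖ with hu
  have hdn : (‖d‖ : ℂ) ≠ 0 := by exact_mod_cast norm_ne_zero_iff.2 hd0
  have hu1 : ‖u‖ = 1 := by
    rw [hu, norm_div, RCLike.norm_conj, Complex.norm_real, norm_norm,
      div_self (norm_ne_zero_iff.2 hd0)]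
  have hu0 : u ≠ 0 := norm_pos_iff.1 (by rw [hu1]; exact one_pos)
  have humaps : ∀ z ∈ ball (0 : ℂ) 1, u * z ∈ ball (0 : ℂ) 1 := fun z hz => by
    rw [mem_ball_zero_iff] at hz ⊢
    rwa [norm_mul, hu1, one_mul]
  refine ⟨fun z => g (u * z), ⟨isOpen_ball, ?_, ?_⟩, ?_, by simp [hg0], ‖d‖,
    norm_pos_iff.2 hd0, ?_⟩
  · exact hgd.comp (differentiableOn_id.const_mul u) humaps
  · intro x hx y hy h
    exact mul_left_cancel₀ hu0 (hgc.2.2 (humaps x hx) (humaps y hy) h)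
  · ext z
    constructor
    · rintro ⟨x, hx, rfl⟩
      exact (hright _ (humaps x hx)).2
    · intro hz
      refine ⟨u⁻¹ * f z, ?_, ?_⟩
      · have := hf.mapsTo hz
        rw [mem_ball_zero_iff] at this ⊢
        rwa [norm_mul, norm_inv, hu1, inv_one, one_mul]
      · simp only [mul_inv_cancel_left₀ hu0]
        exact hleft hz
  · have h1 : HasDerivAt g d (u * 0) := by
      rw [mul_zero]
      exact (hgd.differentiableAt (isOpen_ball.mem_nhds h01)).hasDerivAt
    have h2 := h1.comp (0 : ℂ) ((hasDerivAt_id (0 : ℂ)).const_mul u)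
    refine h2.congr_deriv ?_
    rw [hu, mul_one, mul_div_assoc', Complex.mul_conj, Complex.normSq_eq_norm_sq]
    push_cast
    field_simp

end ConformalWelding

/-! ### Existence of the exterior map. -/

namespace ConformalWelding

open Metric Complex Bornology

theorem isPreconnected_puncturedBall (a : ℂ) (r : ℝ) : IsPreconnected (ball a r \ {a}) := by
  by_cases hr : 0 < r
  · have : ball a r \ {a} = (fun z => a + Complex.exp z) '' (Complex.re ⁻¹' (Iio (Real.log r))) := by
      ext w
      constructor
      · rintro ⟨h1, h2⟩
        have hw : w - a ≠ 0 := sub_ne_zero.2 h2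
        refine ⟨Complex.log (w - a), ?_, ?_⟩
        · rw [mem_preimage, Complex.log_re]
          exact Real.log_lt_log (norm_pos_iff.2 hw) (by rwa [mem_ball, dist_eq_norm] at h1)
        · simp only [Complex.exp_log hw]
          ring
      · rintro ⟨z, h1, rfl⟩
        have h1 : z.re < Real.log r := h1
        refine ⟨?_, ?_⟩
        · rw [mem_ball, dist_eq_norm, add_sub_cancel_left, Complex.norm_exp]
          exact (Real.lt_log_iff_exp_lt hr).1 h1
        · simp [Complex.exp_ne_zero]
    rw [this]
    refine (Convex.isPreconnected ?_).image _
      (continuous_const.add Complex.continuous_exp).continuousOn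
    exact (convex_Iio _).linear_preimage Complex.reLm
  · rw [ball_eq_empty.2 (not_lt.1 hr), empty_sdiff]
    exact isPreconnected_empty

/-- A punctured disc about `a` is connected, so it lies on one side of any separation of `U \ {a}`.
Adding `a` to that side would separate `U`. -/
theorem IsPreconnected.sdiff_singleton {U : Set ℂ} (hc : IsPreconnected U) (hU : IsOpen U)
    (a : ℂ) : IsPreconnected (U \ {a}) := by
  by_cases ha : a ∈ U
  · obtain ⟨r, hr, hball⟩ := Metric.isOpen_iff.1 hU a ha
    have main : ∀ u v : Set ℂ, IsOpen u → IsOpen v → U \ {a} ⊆ u ∪ v →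
        (U \ {a}) ∩ (u ∩ v) = ∅ → ball a r \ {a} ⊆ u → U \ {a} ⊆ u := by
      intro u v hu hv huv hdisj hB
      have h1 := isPreconnected_iff_subset_of_disjoint.1 hc (u ∪ ball a r) (v \ {a})
        (hu.union isOpen_ball) (hv.sdiff isClosed_singleton) (fun x hx => ?_) ?_
      · rcases h1 with h1 | h1
        · intro x hx
          rcases h1 hx.1 with h2 | h2
          · exact h2
          · exact hB ⟨h2, hx.2⟩
        · exact absurd rfl (h1 ha).2
      · by_cases hxa : x = a
        · exact Or.inl (Or.inr (hxa ▸ mem_ball_self hr))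
        · rcases huv ⟨hx, hxa⟩ with h2 | h2
          · exact Or.inl (Or.inl h2)
          · exact Or.inr ⟨h2, hxa⟩
      · rw [eq_empty_iff_forall_notMem] at hdisj ⊢
        rintro x ⟨hxU, hx1, hx2, hx3⟩
        refine hdisj x ⟨⟨hxU, hx3⟩, ?_, hx2⟩
        rcases hx1 with h2 | h2
        · exact h2
        · exact hB ⟨h2, hx3⟩
    rw [isPreconnected_iff_subset_of_disjoint]
    intro u v hu hv huv hdisj
    have hsub : ball a r \ {a} ⊆ U \ {a} := sdiff_subset_sdiff_left hball
    rcases isPreconnected_iff_subset_of_disjoint.1 (isPreconnected_puncturedBall a r) u v hu hv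
      (hsub.trans huv) (subset_empty_iff.1 (hdisj ▸ inter_subset_inter_left _ hsub)) with h | h
    · exact Or.inl (main u v hu hv huv hdisj h)
    · exact Or.inr (main v u hv hu (by rwa [union_comm]) (by rwa [inter_comm v u]) h)
  · rwa [sdiff_singleton_eq_self ha]

theorem exteriorDisc_mem_cobounded : exteriorDisc ∈ cobounded ℂ := by
  filter_upwards [eventually_cobounded_le_norm (E := ℂ) 2] with w hw
  exact lt_of_lt_of_le one_lt_two hw

theorem tendsto_inv_cobounded_nhdsNE : Tendsto (fun w : ℂ => w⁻¹) (cobounded ℂ) (𝓝[≠] 0) :=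
  (Filter.tendsto_inv₀_cobounded' : _)

theorem tendsto_inv_nhdsNE_cobounded : Tendsto (fun w : ℂ => w⁻¹) (𝓝[≠] 0) (cobounded ℂ) :=
  Filter.tendsto_inv₀_nhdsNE_zero

section domain

variable {K : Set ℂ} {a : ℂ}

/-- The image of the complement of `K` in the Riemann sphere under `z ↦ (z - a)⁻¹`. -/
def invertedCompl (K : Set ℂ) (a : ℂ) : Set ℂ := {w | w = 0 ∨ a + w⁻¹ ∉ K}

theorem eventually_notMem_of_isBounded (hK : IsBounded K) (a : ℂ) :
    ∀ᶠ w : ℂ in 𝓝 0, w = 0 ∨ a + w⁻¹ ∉ K := by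
  have h1 : Tendsto (fun w : ℂ => a + w⁻¹) (𝓝[≠] 0) (cobounded ℂ) := by
    have h2 : Tendsto (fun w : ℂ => w⁻¹ - (-a)) (𝓝[≠] 0) (cobounded ℂ) :=
      (tendsto_sub_const_cobounded (-a)).comp tendsto_inv_nhdsNE_cobounded
    exact h2.congr fun w => by ring
  have h3 := eventually_nhdsWithin_iff.1 (h1.eventually (Bornology.isBounded_def.1 hK))
  filter_upwards [h3] with w hw
  by_cases h0 : w = 0
  · exact Or.inl h0
  · exact Or.inr (hw h0)

theorem isOpen_invertedCompl (hKc : IsClosed K) (hK : IsBounded K) :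
    IsOpen (invertedCompl K a) := by
  rw [isOpen_iff_mem_nhds]
  intro w hw
  by_cases h0 : w = 0
  · rw [h0]
    exact eventually_notMem_of_isBounded hK a
  · have h1 : a + w⁻¹ ∉ K := hw.resolve_left h0
    have h2 : ContinuousAt (fun w : ℂ => a + w⁻¹) w := continuousAt_const.add (continuousAt_inv₀ h0)
    filter_upwards [h2 (hKc.isOpen_compl.mem_nhds h1)] with z hz using Or.inr hz

/-- Apart from `0`, the set is the image of `Kᶜ` under `z ↦ (z - a)⁻¹`. The point `0`, which stands
for `∞`, lies in the closure of this image because `K` is bounded. -/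
theorem isPreconnected_invertedCompl (hK : IsBounded K) (ha : a ∈ K)
    (hc : IsPreconnected Kᶜ) : IsPreconnected (invertedCompl K a) := by
  have himg : IsPreconnected ((fun z : ℂ => (z - a)⁻¹) '' Kᶜ) := by
    refine hc.image _ (ContinuousOn.inv₀ (by fun_prop) fun z hz => ?_)
    exact sub_ne_zero.2 fun e => hz (e ▸ ha)
  have hmem : ∀ w : ℂ, w ≠ 0 → a + w⁻¹ ∉ K → w ∈ (fun z : ℂ => (z - a)⁻¹) '' Kᶜ :=
    fun w _ h => ⟨a + w⁻¹, h, by simp⟩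
  refine himg.subset_closure ?_ ?_
  · rintro _ ⟨z, hz, rfl⟩
    exact Or.inr (by simpa using hz)
  · rintro w hw
    by_cases h0 : w = 0
    · rw [h0, mem_closure_iff_frequently]
      have h1 : ∀ᶠ w : ℂ in 𝓝[≠] 0, w ∈ (fun z : ℂ => (z - a)⁻¹) '' Kᶜ := by
        filter_upwards [mem_nhdsWithin_of_mem_nhds (eventually_notMem_of_isBounded hK a),
          self_mem_nhdsWithin] with w hw hw0
        exact hmem w hw0 (hw.resolve_left hw0)
      exact h1.frequently.filter_mono nhdsWithin_le_nhds
    · exact subset_closure (hmem w h0 (hw.resolve_left h0))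

/-- Replace `K` by a thin thickening `U`, which is open, connected and avoids what `M` stands for.
The complement of `invertedCompl U a` is the image of `U \ {a}` under inversion, and a connected
open plane set stays connected without a point. -/
theorem hasRungeExhaustion_invertedCompl (hK : IsCompact K) (hc : IsPreconnected K) (ha : a ∈ K) :
    HasRungeExhaustion (invertedCompl K a) := by
  intro M hMG hM
  obtain ⟨ε, hε, hMε⟩ : ∃ ε > 0, M ⊆ invertedCompl (thickening ε K) a := by
    refine hM.induction_on (p := fun M => ∃ ε > 0, M ⊆ invertedCompl (thickening ε K) a)
      ⟨1, one_pos, empty_subset _⟩ (fun s t hst ⟨ε, h1, h2⟩ => ⟨ε, h1, hst.trans h2⟩) ?_ ?_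
    · rintro s t ⟨ε, h1, h2⟩ ⟨ε', h1', h2'⟩
      refine ⟨min ε ε', lt_min h1 h1', ?_⟩
      rintro w (hw | hw)
      · exact (h2 hw).imp_right fun h h3 => h (thickening_mono (min_le_left _ _) _ h3)
      · exact (h2' hw).imp_right fun h h3 => h (thickening_mono (min_le_right _ _) _ h3)
    · intro w hw
      by_cases h0 : w = 0
      · rw [h0]
        exact ⟨invertedCompl (thickening 1 K) a, mem_nhdsWithin_of_mem_nhds
          (eventually_notMem_of_isBounded hK.isBounded.thickening a), 1, one_pos, subset_rfl⟩
      · have h1 : a + w⁻¹ ∉ K := (hMG hw).resolve_left h0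
        obtain ⟨r, hr, hball⟩ := Metric.isOpen_iff.1 hK.isClosed.isOpen_compl _ h1
        have h2 : ContinuousAt (fun w : ℂ => a + w⁻¹) w :=
          continuousAt_const.add (continuousAt_inv₀ h0)
        refine ⟨_, mem_nhdsWithin_of_mem_nhds (h2 (ball_mem_nhds _ (half_pos hr))), r / 2,
          half_pos hr, fun z hz => Or.inr fun h3 => ?_⟩
        obtain ⟨k, hk, hdk⟩ := mem_thickening_iff.1 h3
        refine hball (a := k) ?_ hk
        have h4 : dist (a + z⁻¹) (a + w⁻¹) < r / 2 := mem_ball.1 (mem_preimage.1 hz)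
        rw [mem_ball]
        calc dist k (a + w⁻¹) ≤ dist (a + z⁻¹) k + dist (a + z⁻¹) (a + w⁻¹) :=
              dist_triangle_left _ _ _
          _ < r := by linarith
  set U := thickening ε K with hU
  have hUo : IsOpen U := isOpen_thickening
  have haU : a ∈ U := self_subset_thickening hε K ha
  have hballU : ball a ε ⊆ U := fun z hz => mem_thickening_iff.2 ⟨a, ha, mem_ball.1 hz⟩
  have hUc : IsPreconnected U := by
    rw [hU, thickening_eq_biUnion_ball]
    have : (⋃ x ∈ K, ball x ε) = K ∪ ⋃ x ∈ K, ball x ε := by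
      refine (union_eq_right.2 fun x hx => ?_).symm
      exact mem_biUnion hx (mem_ball_self hε)
    refine isPreconnected_of_forall_pair fun x hx y hy => ?_
    obtain ⟨x', hx', hxx⟩ := mem_iUnion₂.1 hx
    obtain ⟨y', hy', hyy⟩ := mem_iUnion₂.1 hy
    refine ⟨ball x' ε ∪ K ∪ ball y' ε, ?_, Or.inl (Or.inl hxx), Or.inr hyy, ?_⟩
    · refine union_subset (union_subset (subset_biUnion_of_mem (u := fun x => ball x ε) hx') ?_)
        (subset_biUnion_of_mem (u := fun x => ball x ε) hy')
      rw [this]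
      exact subset_union_left
    · exact (isPreconnected_ball.union x' (mem_ball_self hε) hx' hc).union y' (Or.inr hy')
        (mem_ball_self hε) isPreconnected_ball
  have hcompl : (invertedCompl U a)ᶜ = (fun z : ℂ => (z - a)⁻¹) '' (U \ {a}) := by
    ext w
    constructor
    · intro hw
      have hw : ¬ (w = 0 ∨ a + w⁻¹ ∉ U) := hw
      push Not at hw
      refine ⟨a + w⁻¹, ⟨hw.2, ?_⟩, by simp⟩
      simp [hw.1]
    · rintro ⟨z, ⟨hz, hza⟩, rfl⟩ h
      rcases h with h | h
      · exact hza (sub_eq_zero.1 (inv_eq_zero.1 h))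
      · exact h (by simpa using hz)
  refine ⟨invertedCompl U a, hMε, fun w hw => hw.imp_right fun h h' =>
    h (self_subset_thickening hε K h'), ?_, ?_⟩
  · refine Metric.isCompact_of_isClosed_isBounded ?_ ?_
    · rw [← isOpen_compl_iff, isOpen_iff_mem_nhds]
      intro w hw
      have hw : ¬ (w = 0 ∨ a + w⁻¹ ∉ U) := hw
      push Not at hw
      have h2 : ContinuousAt (fun w : ℂ => a + w⁻¹) w :=
        continuousAt_const.add (continuousAt_inv₀ hw.1)
      have h3 : ∀ᶠ z in 𝓝 w, a + z⁻¹ ∈ U := h2.eventually_mem (hUo.mem_nhds hw.2)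
      have h4 : ∀ᶠ z in 𝓝 w, z ≠ 0 := eventually_ne_nhds hw.1
      filter_upwards [h3, h4] with z hz hz0 h
      exact h.elim hz0 fun h' => h' hz
    · refine isBounded_iff_forall_norm_le.2 ⟨ε⁻¹, fun w hw => ?_⟩
      rcases hw with rfl | h
      · simpa using hε.le
      · by_contra hlt
        apply h
        apply hballU
        rw [mem_ball, dist_eq_norm, add_sub_cancel_left, norm_inv]
        exact inv_lt_of_inv_lt₀ hε (not_le.1 hlt)
  · rw [hcompl]
    refine (IsPreconnected.sdiff_singleton hUc hUo a).image _ (ContinuousOn.inv₀ (by fun_prop)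
      fun z hz => sub_ne_zero.2 hz.2)

end domain

/-- The exterior map of a nondegenerate hull exists. -/
theorem exists_isExteriorMap {K : Set ℂ} (hK : IsNondegenerateHull K) :
    ∃ ψ, IsExteriorMap K ψ := by
  obtain ⟨⟨hKc, hKconn, hKcc⟩, a, ha, b, hb, hab⟩ := hK
  set G := invertedCompl K a with hG
  have hq : (b - a)⁻¹ ∉ G := by
    rintro (h | h)
    · exact hab (sub_eq_zero.1 (inv_eq_zero.1 h)).symm
    · exact h (by simpa using hb)
  obtain ⟨F, hF, hFG, hF0, c, hc, hder⟩ := exists_isConformalOn_ball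
    (isOpen_invertedCompl hKc.isClosed hKc.isBounded)
    (isPreconnected_invertedCompl hKc.isBounded ha hKcc.isPreconnected)
    (hasRungeExhaustion_invertedCompl hKc hKconn.isPreconnected ha) (Or.inl rfl) hq
  have h01 : (0 : ℂ) ∈ ball (0 : ℂ) 1 := mem_ball_self one_pos
  have hinv : ∀ w ∈ exteriorDisc, w⁻¹ ∈ ball (0 : ℂ) 1 ∧ w⁻¹ ≠ 0 := by
    intro w hw
    have hw : 1 < ‖w‖ := hw
    refine ⟨?_, inv_ne_zero (norm_pos_iff.1 (zero_lt_one.trans hw))⟩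
    rw [mem_ball_zero_iff, norm_inv]
    exact inv_lt_one_of_one_lt₀ hw
  have hne : ∀ w ∈ exteriorDisc, F w⁻¹ ≠ 0 := fun w hw h =>
    (hinv w hw).2 (hF.2.2 (hinv w hw).1 h01 (h.trans hF0.symm))
  -- The disc map is conjugated by the two inversions `w ↦ w⁻¹` and `z ↦ (z - a)⁻¹`, so its
  -- derivative `c` at `0` becomes the limit `c⁻¹` of `ψ w / w` at `∞`.
  refine ⟨fun w => a + (F w⁻¹)⁻¹, ?_, ⟨?_, ?_, ?_⟩, c⁻¹, inv_pos.2 hc, ?_⟩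
  · refine (DifferentiableOn.inv (hF.2.1.comp (fun w hw => ?_) fun w hw => (hinv w hw).1)
      hne).const_add a
    exact (differentiableAt_inv (norm_pos_iff.1 (zero_lt_one.trans hw))).differentiableWithinAt
  · intro w hw
    have h1 : F w⁻¹ ∈ G := by
      rw [hG, ← hFG]
      exact mem_image_of_mem F (hinv w hw).1
    exact h1.resolve_left (hne w hw)
  · intro w hw z hz h
    exact inv_injective (hF.2.2 (hinv w hw).1 (hinv z hz).1 (inv_injective (add_left_cancel h)))
  · intro z hz
    have hza : z - a ≠ 0 := sub_ne_zero.2 fun e => hz (e ▸ ha)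
    have h1 : (z - a)⁻¹ ∈ G := Or.inr (by simpa using hz)
    rw [hG, ← hFG] at h1
    obtain ⟨y, hy, hyz⟩ := h1
    have hy0 : y ≠ 0 := by
      rintro rfl
      rw [hF0] at hyz
      exact inv_ne_zero hza hyz.symm
    refine ⟨y⁻¹, ?_, ?_⟩
    · change (1 : ℝ) < ‖y⁻¹‖
      rw [norm_inv]
      exact (one_lt_inv₀ (norm_pos_iff.2 hy0)).2 (by simpa using hy)
    · simp [hyz]
  · have h1 : Tendsto (fun t => t⁻¹ * F t) (𝓝[≠] 0) (𝓝 c) := by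
      have := hasDerivAt_iff_tendsto_slope.1 hder
      refine this.congr fun t => ?_
      simp [slope_def_field, hF0, div_eq_inv_mul]
    have h2 : Tendsto (fun w : ℂ => (w * F w⁻¹)⁻¹) (cobounded ℂ) (𝓝 (c : ℂ)⁻¹) :=
      ((h1.comp tendsto_inv_cobounded_nhdsNE).inv₀ (by exact_mod_cast hc.ne')).congr fun w => by
        simp
    have h3 : Tendsto (fun w : ℂ => a * w⁻¹) (cobounded ℂ) (𝓝 (a * 0)) :=
      (tendsto_inv_cobounded_nhdsNE.mono_right nhdsWithin_le_nhds).const_mul a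
    have h4 := h3.add h2
    rw [mul_zero, zero_add] at h4
    rw [Complex.ofReal_inv]
    refine h4.congr fun w => ?_
    rw [mul_inv]
    field_simp

end ConformalWelding

/-! ### Behaviour at infinity and uniqueness of the exterior map. -/

namespace ConformalWelding

open Metric Complex Bornology

theorem isExteriorMap_exteriorMap {K : Set ℂ} (h : ∃ ψ, IsExteriorMap K ψ) :
    IsExteriorMap K (exteriorMap K) := by
  rw [exteriorMap, dif_pos h]
  exact h.choose_spec

/-- The function `ζ ↦ 1 / f (1 / ζ)`, with value `0` at `0`. -/
noncomputable def inversion (f : ℂ → ℂ) : ℂ → ℂ :=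
  Function.update (fun ζ => (f ζ⁻¹)⁻¹) 0 0

theorem inversion_of_ne_zero {f : ℂ → ℂ} {ζ : ℂ} (h : ζ ≠ 0) :
    inversion f ζ = (f ζ⁻¹)⁻¹ := Function.update_of_ne h _ _

theorem inversion_zero {f : ℂ → ℂ} : inversion f 0 = 0 := Function.update_self _ _ _

/-- If `f` is holomorphic near infinity with `f(∞) = ∞`, then its inversion is holomorphic. -/
theorem differentiableOn_inversion {f : ℂ → ℂ} {δ : ℝ} (hδ : 0 < δ)
    (hd : ∀ w : ℂ, δ⁻¹ < ‖w‖ → DifferentiableAt ℂ f w ∧ f w ≠ 0)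
    (hf : Tendsto f (cobounded ℂ) (cobounded ℂ)) :
    DifferentiableOn ℂ (inversion f) (ball 0 δ) := by
  refine (differentiableOn_compl_singleton_and_continuousAt_iff (ball_mem_nhds 0 hδ)).1 ⟨?_, ?_⟩
  · rintro ζ ⟨hζ, hζ0⟩
    have hζ0 : ζ ≠ 0 := hζ0
    have h1 : δ⁻¹ < ‖ζ⁻¹‖ := by
      rw [norm_inv]
      exact inv_strictAnti₀ (norm_pos_iff.2 hζ0) (by simpa using hζ)
    obtain ⟨h2, h3⟩ := hd _ h1
    have h4 : DifferentiableAt ℂ (fun ζ => (f ζ⁻¹)⁻¹) ζ :=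
      (h2.comp ζ (differentiableAt_inv hζ0)).inv h3
    refine (h4.congr_of_eventuallyEq ?_).differentiableWithinAt
    filter_upwards [eventually_ne_nhds hζ0] with z hz using inversion_of_ne_zero hz
  · rw [inversion, continuousAt_update_same]
    exact (tendsto_inv_cobounded_nhdsNE.mono_right nhdsWithin_le_nhds).comp
      (hf.comp tendsto_inv_nhdsNE_cobounded)

theorem tendsto_cobounded_of_div {f : ℂ → ℂ} {c : ℂ} (hc : c ≠ 0)
    (h : Tendsto (fun w => f w / w) (cobounded ℂ) (𝓝 c)) :
    Tendsto f (cobounded ℂ) (cobounded ℂ) := by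
  rw [← tendsto_norm_atTop_iff_cobounded]
  have h1 : Tendsto (fun w => ‖f w / w‖ * ‖w‖) (cobounded ℂ) atTop :=
    h.norm.pos_mul_atTop (norm_pos_iff.2 hc) tendsto_norm_cobounded_atTop
  refine h1.congr' ?_
  filter_upwards [eventually_ne_cobounded (0 : ℂ)] with w hw
  rw [norm_div, div_mul_cancel₀ _ (norm_ne_zero_iff.2 hw)]

section props

variable {K : Set ℂ} {ψ : ℂ → ℂ}

theorem _root_.IsExteriorMap.isConformalOn (h : IsExteriorMap K ψ) :
    IsConformalOn ψ exteriorDisc :=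
  ⟨isOpen_exteriorDisc, h.1, h.2.1.injOn⟩

theorem _root_.IsExteriorMap.tendsto_cobounded (h : IsExteriorMap K ψ) :
    Tendsto ψ (cobounded ℂ) (cobounded ℂ) := by
  obtain ⟨c, hc, hlim⟩ := h.2.2
  exact tendsto_cobounded_of_div (by exact_mod_cast hc.ne') hlim

/-- Injective maps with `f(∞) = ∞` are bounded on bounded sets. -/
theorem exists_norm_le_of_injOn {f : ℂ → ℂ} (hf : IsConformalOn f exteriorDisc)
    (hlim : Tendsto f (cobounded ℂ) (cobounded ℂ)) (M : ℝ) :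
    ∃ N, ∀ w ∈ exteriorDisc, ‖w‖ ≤ M → ‖f w‖ ≤ N := by
  obtain ⟨R, hR⟩ : ∃ R, ∀ w : ℂ, R ≤ ‖w‖ → f w ≠ 0 := by
    obtain ⟨R, -, hR⟩ := hasBasis_cobounded_norm.mem_iff.1 (hlim.eventually_ne_cobounded 0)
    exact ⟨R, fun w hw => hR hw⟩
  set S := max (max R M) 1 with hS
  have hS1 : 1 ≤ S := le_max_right _ _
  have hS0 : 0 < S := one_pos.trans_le hS1
  have hRS : R ≤ S := (le_max_left _ _).trans (le_max_left _ _)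
  have hMS : M ≤ S := (le_max_right _ _).trans (le_max_left _ _)
  have hd : DifferentiableOn ℂ (inversion f) (ball 0 S⁻¹) := by
    refine differentiableOn_inversion (inv_pos.2 hS0) (fun w hw => ?_) hlim
    rw [inv_inv] at hw
    exact ⟨hf.2.1.differentiableAt (hf.1.mem_nhds (lt_of_le_of_lt hS1 hw)), hR w (hRS.trans hw.le)⟩
  have hext : ∀ ζ ∈ ball (0 : ℂ) S⁻¹, ζ ≠ 0 → S < ‖ζ⁻¹‖ := by
    intro ζ hζ h0
    rw [norm_inv]
    exact (lt_inv_comm₀ hS0 (norm_pos_iff.2 h0)).2 (by simpa using hζ)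
  have hne : ∀ ζ ∈ ball (0 : ℂ) S⁻¹, ζ ≠ 0 → inversion f ζ ≠ 0 := fun ζ hζ h0 => by
    rw [inversion_of_ne_zero h0]
    exact inv_ne_zero (hR _ (hRS.trans (hext ζ hζ h0).le))
  have hconf : IsConformalOn (inversion f) (ball 0 S⁻¹) := by
    refine ⟨isOpen_ball, hd, fun x hx y hy hxy => ?_⟩
    by_cases hx0 : x = 0
    · by_contra hne'
      have hy0 : y ≠ 0 := fun e => hne' (hx0.trans e.symm)
      rw [hx0, inversion_zero] at hxy
      exact hne y hy hy0 hxy.symm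
    · have hy0 : y ≠ 0 := by
        rintro rfl
        rw [inversion_zero] at hxy
        exact hne x hx hx0 hxy
      rw [inversion_of_ne_zero hx0, inversion_of_ne_zero hy0] at hxy
      exact inv_injective (hf.2.2 (hS1.trans_lt (hext x hx hx0)) (hS1.trans_lt (hext y hy hy0))
        (inv_injective hxy))
  have h0 : (0 : ℂ) ∈ ball (0 : ℂ) S⁻¹ := mem_ball_self (inv_pos.2 hS0)
  -- The inversion covers a disc of radius `η` about `0`, so all values of modulus above `η⁻¹` are
  -- already taken where `|w| > S ≥ M`. By injectivity they are not taken where `|w| ≤ M`.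
  have hnhds := hconf.image_mem_nhds h0 (isOpen_ball.mem_nhds h0)
  rw [inversion_zero] at hnhds
  obtain ⟨η, hη, hball⟩ := Metric.mem_nhds_iff.1 hnhds
  refine ⟨η⁻¹, fun w hw hwM => ?_⟩
  by_contra hlt
  have hlt := not_le.1 hlt
  have hfw : 0 < ‖f w‖ := (inv_pos.2 hη).trans hlt
  have h1 : (f w)⁻¹ ∈ ball (0 : ℂ) η := by
    rw [mem_ball_zero_iff, norm_inv]
    exact inv_lt_of_inv_lt₀ hη hlt
  obtain ⟨ζ, hζ, hζw⟩ := hball h1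
  have hζ0 : ζ ≠ 0 := by
    rintro rfl
    rw [inversion_zero] at hζw
    exact inv_ne_zero (norm_pos_iff.1 hfw) hζw.symm
  rw [inversion_of_ne_zero hζ0] at hζw
  have h2 := hf.2.2 (hS1.trans_lt (hext ζ hζ hζ0)) hw (inv_injective hζw)
  have h3 := hext ζ hζ hζ0
  rw [h2] at h3
  linarith

/-- The inverse of an exterior map tends to infinity at infinity. -/
theorem _root_.IsExteriorMap.tendsto_invFunOn (h : IsExteriorMap K ψ) (hK : IsBounded K) :
    Tendsto (Function.invFunOn ψ exteriorDisc) (cobounded ℂ) (cobounded ℂ) := by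
  rw [← tendsto_norm_atTop_iff_cobounded, Filter.tendsto_atTop]
  intro M
  obtain ⟨N, hN⟩ := exists_norm_le_of_injOn h.isConformalOn h.tendsto_cobounded M
  filter_upwards [isBounded_def.1 hK, eventually_cobounded_le_norm (E := ℂ) (N + 1)] with z hz hzN
  by_contra hlt
  have hzim : z ∈ ψ '' exteriorDisc := h.2.1.surjOn hz
  have h1 := hN _ (Function.invFunOn_mem hzim) (not_le.1 hlt).le
  rw [Function.invFunOn_eq hzim] at h1
  linarith

/-- The Schwarz lemma, applied to the inversion of `f`. -/
theorem norm_le_norm_of_mapsTo_exteriorDisc {f : ℂ → ℂ} (hd : DifferentiableOn ℂ f exteriorDisc)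
    (hm : MapsTo f exteriorDisc exteriorDisc) (hlim : Tendsto f (cobounded ℂ) (cobounded ℂ))
    {w : ℂ} (hw : w ∈ exteriorDisc) : ‖w‖ ≤ ‖f w‖ := by
  have hw1 : 1 < ‖w‖ := hw
  have hinv : ∀ ζ ∈ ball (0 : ℂ) 1, ζ ≠ 0 → ζ⁻¹ ∈ exteriorDisc := by
    intro ζ hζ h0
    change (1 : ℝ) < ‖ζ⁻¹‖
    rw [norm_inv]
    exact (one_lt_inv₀ (norm_pos_iff.2 h0)).2 (by simpa using hζ)
  have h1 : DifferentiableOn ℂ (inversion f) (ball 0 1) := by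
    refine differentiableOn_inversion one_pos (fun w hw => ?_) hlim
    rw [inv_one] at hw
    refine ⟨hd.differentiableAt (isOpen_exteriorDisc.mem_nhds hw), ?_⟩
    have h3 : 1 < ‖f w‖ := hm hw
    exact norm_pos_iff.1 (one_pos.trans h3)
  have h2 : MapsTo (inversion f) (ball 0 1) (closedBall 0 1) := by
    intro ζ hζ
    by_cases h0 : ζ = 0
    · rw [h0, inversion_zero]
      exact mem_closedBall_self zero_le_one
    · rw [inversion_of_ne_zero h0, mem_closedBall_zero_iff, norm_inv]
      have h3 : 1 < ‖f ζ⁻¹‖ := hm (hinv ζ hζ h0)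
      exact inv_le_one_of_one_le₀ h3.le
  have hw0 : w⁻¹ ≠ 0 := inv_ne_zero (norm_pos_iff.1 (one_pos.trans hw1))
  have h3 := Complex.norm_le_norm_of_mapsTo_ball h1 h2 inversion_zero (z := w⁻¹)
    (by rw [norm_inv]; exact inv_lt_one_of_one_lt₀ hw1)
  rw [inversion_of_ne_zero hw0, inv_inv, norm_inv, norm_inv] at h3
  exact (inv_le_inv₀ (one_pos.trans (hm hw)) (one_pos.trans hw1)).1 h3

/-- The exterior map is unique. -/
theorem _root_.IsExteriorMap.eqOn {ψ' : ℂ → ℂ} (hK : IsBounded K) (h : IsExteriorMap K ψ)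
    (h' : IsExteriorMap K ψ') : EqOn ψ ψ' exteriorDisc := by
  -- By the Schwarz lemma neither `ψ'⁻¹ ∘ ψ` nor its inverse decreases the modulus, so both preserve
  -- it. Then `f w / w` has constant modulus and is a constant `u` with `|u| = 1`, and positivity of
  -- the two limits at `∞` forces `u = 1`.
  have main : ∀ φ χ : ℂ → ℂ, IsExteriorMap K φ → IsExteriorMap K χ →
      (∀ w ∈ exteriorDisc, Function.invFunOn χ exteriorDisc (φ w) ∈ exteriorDisc ∧
        χ (Function.invFunOn χ exteriorDisc (φ w)) = φ w ∧
        ‖w‖ ≤ ‖Function.invFunOn χ exteriorDisc (φ w)‖) ∧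
      DifferentiableOn ℂ (fun w => Function.invFunOn χ exteriorDisc (φ w)) exteriorDisc ∧
      Tendsto (fun w => Function.invFunOn χ exteriorDisc (φ w)) (cobounded ℂ) (cobounded ℂ) := by
    intro φ χ hφ hχ
    have him : ∀ w ∈ exteriorDisc, φ w ∈ χ '' exteriorDisc := fun w hw => by
      rw [hχ.2.1.image_eq]; exact hφ.2.1.mapsTo hw
    have hd : DifferentiableOn ℂ (fun w => Function.invFunOn χ exteriorDisc (φ w)) exteriorDisc :=
      hχ.isConformalOn.differentiableOn_invFunOn.comp hφ.1 him
    have hlim := (hχ.tendsto_invFunOn hK).comp hφ.tendsto_cobounded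
    refine ⟨fun w hw => ⟨Function.invFunOn_mem (him w hw), Function.invFunOn_eq (him w hw), ?_⟩,
      hd, hlim⟩
    exact norm_le_norm_of_mapsTo_exteriorDisc hd (fun z hz => Function.invFunOn_mem (him z hz))
      hlim hw
  obtain ⟨h1, hd, hlim⟩ := main ψ ψ' h h'
  obtain ⟨h2, -, -⟩ := main ψ' ψ h' h
  set f := fun w => Function.invFunOn ψ' exteriorDisc (ψ w) with hf
  have hnorm : ∀ w ∈ exteriorDisc, ‖f w‖ = ‖w‖ := by
    intro w hw
    obtain ⟨a1, a2, a3⟩ := h1 w hw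
    obtain ⟨b1, b2, b3⟩ := h2 _ a1
    refine le_antisymm ?_ a3
    rw [a2, h.2.1.injOn.leftInvOn_invFunOn hw] at b3
    exact b3
  have hne : ∀ w ∈ exteriorDisc, w ≠ 0 := fun w (hw : 1 < ‖w‖) => norm_pos_iff.1 (one_pos.trans hw)
  have h2mem : (2 : ℂ) ∈ exteriorDisc := by
    change (1 : ℝ) < ‖(2 : ℂ)‖
    rw [RCLike.norm_ofNat]
    norm_num
  have hquot : ∀ w ∈ exteriorDisc, ‖f w / w‖ = 1 := fun w hw => by
    rw [norm_div, hnorm w hw, div_self (norm_ne_zero_iff.2 (hne w hw))]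
  have hconst := eqOn_of_isPreconnected_of_isMaxOn_norm isPreconnected_exteriorDisc
    isOpen_exteriorDisc (hd.div differentiableOn_id hne) h2mem (fun w hw => by
      change ‖f w / w‖ ≤ ‖f 2 / 2‖
      rw [hquot w hw, hquot 2 h2mem])
  set u := f 2 / 2 with hu
  have hfu : ∀ w ∈ exteriorDisc, f w = u * w := fun w hw => by
    have h3 : f w / w = u := hconst hw
    rw [← h3, div_mul_cancel₀ _ (hne w hw)]
  have hu1 : ‖u‖ = 1 := hquot 2 h2mem
  have hu0 : u ≠ 0 := norm_pos_iff.1 (by rw [hu1]; exact one_pos)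
  obtain ⟨c, hc, hcl⟩ := h.2.2
  obtain ⟨c', hc', hcl'⟩ := h'.2.2
  have hlim2 : Tendsto (fun w => ψ w / w) (cobounded ℂ) (𝓝 (c' * u)) := by
    have h3 : Tendsto (fun w => u * w) (cobounded ℂ) (cobounded ℂ) :=
      tendsto_mul_left_cobounded hu0
    refine ((hcl'.comp h3).mul_const u).congr' ?_
    filter_upwards [exteriorDisc_mem_cobounded] with w hw
    have h4 := (h1 w hw).2.1
    have h5 := hfu w hw
    have h6 := hne w hw
    simp only [Function.comp_apply]
    rw [← h5, h4, h5]
    field_simp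
  have hcu : (c : ℂ) = c' * u := tendsto_nhds_unique hcl hlim2
  have hcc : c = c' := by
    have := congrArg norm hcu
    rw [norm_mul, hu1, mul_one, Complex.norm_real, Complex.norm_real, Real.norm_of_nonneg hc.le,
      Real.norm_of_nonneg hc'.le] at this
    exact this
  have hu' : u = 1 := by
    rw [hcc] at hcu
    have h3 : (c' : ℂ) ≠ 0 := by exact_mod_cast hc'.ne'
    exact mul_left_cancel₀ h3 (by rw [← hcu, mul_one])
  intro w hw
  have h4 := (h1 w hw).2.1
  have h5 := hfu w hw
  rw [hu', one_mul] at h5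
  rw [← h4]
  exact congrArg ψ' h5

theorem _root_.IsExteriorMap.eqOn_exteriorMap (hK : IsBounded K) (h : IsExteriorMap K ψ) :
    EqOn (exteriorMap K) ψ exteriorDisc :=
  (isExteriorMap_exteriorMap ⟨ψ, h⟩).eqOn hK h

/-- Behaviour of exterior maps under positive affine maps. -/
theorem _root_.IsExteriorMap.affine (h : IsExteriorMap K ψ) {a : ℝ} (ha : 0 < a) (b : ℂ) :
    IsExteriorMap ((fun z => a * z + b) '' K) (fun w => a * ψ w + b) := by
  have ha0 : (a : ℂ) ≠ 0 := by exact_mod_cast ha.ne'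
  have hbij : Function.Bijective (fun z : ℂ => a * z + b) :=
    ⟨fun x y hxy => mul_left_cancel₀ ha0 (add_right_cancel hxy),
      fun z => ⟨(z - b) / a, by field_simp; ring⟩⟩
  obtain ⟨c, hc, hlim⟩ := h.2.2
  refine ⟨(h.1.const_mul _).add_const _, ?_, a * c, mul_pos ha hc, ?_⟩
  · rw [← image_compl_eq hbij]
    exact (hbij.1.injOn.bijOn_image (s := Kᶜ)).comp h.2.1
  · have h1 : Tendsto (fun w : ℂ => b * w⁻¹) (cobounded ℂ) (𝓝 (b * 0)) :=
      (tendsto_inv_cobounded_nhdsNE.mono_right nhdsWithin_le_nhds).const_mul b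
    have h2 := (hlim.const_mul (a : ℂ)).add h1
    rw [mul_zero, add_zero] at h2
    push_cast
    refine h2.congr fun w => ?_
    rw [add_div, mul_div_assoc, div_eq_mul_inv b]

end props

end ConformalWelding

/-! ### Collars and Liouville's theorem on the glued surface. -/

namespace ConformalWelding

open Metric Complex Bornology

/-- The half-open annulus `{w | r < ‖w‖ ≤ R}`. -/
def annulusIoc (r R : ℝ) : Set ℂ := {w | r < ‖w‖ ∧ ‖w‖ ≤ R}

theorem annulusIoc_self (r : ℝ) : annulusIoc r r = ∅ :=
  eq_empty_of_forall_notMem fun _ h => absurd (h.1.trans_le h.2) (lt_irrefl _)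

theorem annulusIoc_subset_annulus {r s R : ℝ} (h : s < R) : annulusIoc r s ⊆ annulus r R :=
  fun _ hw => ⟨hw.1, hw.2.trans_lt h⟩

theorem annulus_subset_annulusIoc {r s : ℝ} : annulus r s ⊆ annulusIoc r s :=
  fun _ hw => ⟨hw.1, hw.2.le⟩

theorem annulusIoc_union_annulus {r r' s : ℝ} (h : r ≤ r') (h' : r' < s) :
    annulusIoc r r' ∪ annulus r' s = annulus r s := by
  ext w
  constructor
  · rintro (hw | hw)
    · exact ⟨hw.1, hw.2.trans_lt h'⟩
    · exact ⟨h.trans_lt hw.1, hw.2⟩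
  · intro hw
    rcases le_or_gt ‖w‖ r' with h1 | h1
    · exact Or.inl ⟨hw.1, h1⟩
    · exact Or.inr ⟨h1, hw.2⟩

theorem annulusIoc_union_annulusIoc {r r' s : ℝ} (h : r ≤ r') (h' : r' ≤ s) :
    annulusIoc r r' ∪ annulusIoc r' s = annulusIoc r s := by
  ext w
  constructor
  · rintro (hw | hw)
    · exact ⟨hw.1, hw.2.trans h'⟩
    · exact ⟨h.trans_lt hw.1, hw.2⟩
  · intro hw
    rcases le_or_gt ‖w‖ r' with h1 | h1
    · exact Or.inl ⟨hw.1, h1⟩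
    · exact Or.inr ⟨h1, hw.2⟩

theorem exists_mem_annulus {r R : ℝ} (hr : 0 < r) (h : r < R) : ∃ w, w ∈ annulus r R := by
  refine ⟨(((r + R) / 2 : ℝ) : ℂ), ?_⟩
  rw [annulus, mem_ofPred_eq, Complex.norm_real, Real.norm_of_nonneg (by linarith)]
  constructor <;> linarith

/-- A collar of `H`: a conformal map `p` of an annulus such that the images of the circles surround
the set `H`, the inner circle corresponding to the boundary of `H`. -/
structure Collar (H : Set ℂ) (p : ℂ → ℂ) (r R : ℝ) : Prop where
  pos : 0 < r
  lt : r < R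
  conf : IsConformalOn p (annulus r R)
  notMem : ∀ w ∈ annulus r R, p w ∉ H
  isOpen_union' : ∀ s, r < s → s < R → IsOpen (H ∪ p '' annulus r s)
  isCompact_union : ∀ s, r < s → s < R → IsCompact (H ∪ p '' annulusIoc r s)
  isPreconnected_compl : IsPreconnected Hᶜ

namespace Collar

variable {H Hp Hq : Set ℂ} {p q : ℂ → ℂ} {r R : ℝ}

theorem isOpen_union (h : Collar H p r R) : IsOpen (H ∪ p '' annulus r R) := by
  have h1 : r < (r + R) / 2 := by linarith [h.lt]
  have h2 : (r + R) / 2 < R := by linarith [h.lt]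
  have : H ∪ p '' annulus r R = (H ∪ p '' annulus r ((r + R) / 2)) ∪ p '' annulus r R := by
    rw [union_assoc, ← image_union, union_eq_right.2 (annulus_subset_annulus le_rfl h2.le)]
  rw [this]
  exact (h.isOpen_union' _ h1 h2).union (h.conf.isOpen_image h.conf.1 subset_rfl)

theorem isClosed (h : Collar H p r R) : IsClosed H := by
  have h1 : r < (r + R) / 2 := by linarith [h.lt]
  have h2 : (r + R) / 2 < R := by linarith [h.lt]
  have : H = (H ∪ p '' annulusIoc r ((r + R) / 2)) \ p '' annulus r R := by
    ext z
    constructor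
    · intro hz
      refine ⟨Or.inl hz, ?_⟩
      rintro ⟨w, hw, rfl⟩
      exact h.notMem w hw hz
    · rintro ⟨hz | ⟨w, hw, rfl⟩, hz'⟩
      · exact hz
      · exact absurd (mem_image_of_mem p (annulusIoc_subset_annulus h2 hw)) hz'
  rw [this]
  exact (h.isCompact_union _ h1 h2).isClosed.sdiff (h.conf.isOpen_image h.conf.1 subset_rfl)

theorem closure_union_subset (h : Collar H p r R) {s : ℝ} (h1 : r < s) (h2 : s < R) :
    closure (H ∪ p '' annulus r s) ⊆ H ∪ p '' annulusIoc r s :=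
  closure_minimal (union_subset_union_right _ (image_mono annulus_subset_annulusIoc))
    (h.isCompact_union s h1 h2).isClosed

theorem mem_circle_of_mem_sdiff {s : ℝ} {z : ℂ}
    (h1 : z ∈ H ∪ p '' annulusIoc r s) (h2 : z ∉ H ∪ p '' annulus r s) :
    ∃ w, ‖w‖ = s ∧ p w = z := by
  rcases h1 with h1 | ⟨w, hw, rfl⟩
  · exact absurd (Or.inl h1) h2
  · refine ⟨w, le_antisymm hw.2 (not_lt.1 fun hlt => h2 (Or.inr ⟨w, ⟨hw.1, hlt⟩, rfl⟩)), rfl⟩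

/-- Absorbing the inner part of the annulus into `H` turns ring points into points of the hull, and
gives room between the circles of integration. -/
theorem restrict (h : Collar H p r R) {r' R' : ℝ} (h1 : r ≤ r') (h2 : r' < R') (h3 : R' ≤ R) :
    Collar (H ∪ p '' annulusIoc r r') p r' R' := by
  have hopen : ∀ s, r' < s → (H ∪ p '' annulusIoc r r') ∪ p '' annulus r' s = H ∪ p '' annulus r s :=
    fun s hs => by rw [union_assoc, ← image_union, annulusIoc_union_annulus h1 hs]
  have hcomp : ∀ s, r' < s →
      (H ∪ p '' annulusIoc r r') ∪ p '' annulusIoc r' s = H ∪ p '' annulusIoc r s :=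
    fun s hs => by rw [union_assoc, ← image_union, annulusIoc_union_annulusIoc h1 hs.le]
  refine ⟨h.pos.trans_le h1, h2, h.conf.mono (isOpen_annulus _ _) (annulus_subset_annulus h1 h3),
    ?_, ?_, ?_, ?_⟩
  · intro w hw hmem
    have hwA := annulus_subset_annulus h1 h3 hw
    rcases hmem with hmem | ⟨z, hz, hzw⟩
    · exact h.notMem w hwA hmem
    · have := h.conf.2.2 (annulusIoc_subset_annulus (h2.trans_le h3) hz) hwA hzw
      rw [this] at hz
      exact absurd hz.2 (not_le.2 hw.1)
  · intro s hs hsR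
    rw [hopen s hs]
    exact h.isOpen_union' s (h1.trans_lt hs) (hsR.trans_le h3)
  · intro s hs hsR
    rw [hcomp s hs]
    exact h.isCompact_union s (h1.trans_lt hs) (hsR.trans_le h3)
  · rcases h1.eq_or_lt with rfl | h1
    · rw [annulusIoc_self, image_empty, union_empty]
      exact h.isPreconnected_compl
    have hr'R := h2.trans_le h3
    set H' := H ∪ p '' annulusIoc r r' with hH'
    have hH'c : IsClosed H' := (h.isCompact_union r' h1 hr'R).isClosed
    have hring : ∀ z ∈ p '' annulus r R, z ∉ H' → z ∈ p '' annulus r' R := by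
      rintro _ ⟨w, hw, rfl⟩ hz
      refine ⟨w, ⟨not_le.1 fun hle => hz (Or.inr ⟨w, ⟨hw.1, hle⟩, rfl⟩), hw.2⟩, rfl⟩
    have hringH : p '' annulus r' R ⊆ H'ᶜ := by
      rintro _ ⟨w, hw, rfl⟩ hmem
      have hwA := annulus_subset_annulus h1.le le_rfl hw
      rcases hmem with hmem | ⟨z, hz, hzw⟩
      · exact h.notMem w hwA hmem
      · have := h.conf.2.2 (annulusIoc_subset_annulus hr'R hz) hwA hzw
        rw [this] at hz
        exact absurd hz.2 (not_le.2 hw.1)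
    have hringc : IsPreconnected (p '' annulus r' R) :=
      (isPreconnected_annulus (h.pos.trans h1)).image p
        (h.conf.2.1.continuousOn.mono (annulus_subset_annulus h1.le le_rfl))
    -- The outer ring is connected, so it lies on one side of a separation of `H'ᶜ`. Filling the
    -- whole ring into that side would separate `Hᶜ`.
    have main : ∀ u v : Set ℂ, IsOpen u → IsOpen v → H'ᶜ ⊆ u ∪ v → H'ᶜ ∩ (u ∩ v) = ∅ →
        p '' annulus r' R ⊆ u → H'ᶜ ⊆ u := by
      intro u v hu hv huv hdisj hB
      rw [eq_empty_iff_forall_notMem] at hdisj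
      have hcov : Hᶜ ⊆ (u ∪ p '' annulus r R) ∪ (v ∩ H'ᶜ) := by
        intro x hx
        by_cases hxA : x ∈ p '' annulus r R
        · exact Or.inl (Or.inr hxA)
        · have hxH' : x ∈ H'ᶜ := by
            rintro (h5 | h5)
            · exact hx h5
            · exact hxA (image_mono (annulusIoc_subset_annulus hr'R) h5)
          rcases huv hxH' with h5 | h5
          · exact Or.inl (Or.inl h5)
          · exact Or.inr ⟨h5, hxH'⟩
      have hdis : Hᶜ ∩ ((u ∪ p '' annulus r R) ∩ (v ∩ H'ᶜ)) = ∅ := by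
        rw [eq_empty_iff_forall_notMem]
        rintro x ⟨-, h5 | h5, h6, h7⟩
        · exact hdisj x ⟨h7, h5, h6⟩
        · exact hdisj x ⟨h7, hB (hring x h5 h7), h6⟩
      rcases isPreconnected_iff_subset_of_disjoint.1 h.isPreconnected_compl (u ∪ p '' annulus r R)
        (v ∩ H'ᶜ) (hu.union (h.conf.isOpen_image h.conf.1 subset_rfl))
        (hv.inter hH'c.isOpen_compl) hcov hdis with h4 | h4
      · intro x hx
        rcases h4 (fun hxH => hx (Or.inl hxH)) with h5 | h5
        · exact h5
        · exact hB (hring x h5 hx)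
      · obtain ⟨w, hw⟩ := exists_mem_annulus (h.pos.trans h1) hr'R
        have hpw := mem_image_of_mem p hw
        have h5 := h4 (fun hxH => hringH hpw (Or.inl hxH))
        exact (hdisj (p w) ⟨h5.2, hB hpw, h5.1⟩).elim
    rw [isPreconnected_iff_subset_of_disjoint]
    intro u v hu hv huv hdisj
    rcases isPreconnected_iff_subset_of_disjoint.1 hringc u v hu hv (hringH.trans huv)
      (subset_empty_iff.1 (hdisj ▸ inter_subset_inter_left _ hringH)) with h4 | h4
    · exact Or.inl (main u v hu hv huv hdisj h4)
    · exact Or.inr (main v u hv hu (by rwa [union_comm]) (by rwa [inter_comm v u]) h4)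

/-- The maximum principle on the inner side of a collar. -/
theorem norm_le_inside (h : Collar H p r R) {V : ℂ → ℂ}
    (hV : DifferentiableOn ℂ V (H ∪ p '' annulus r R)) {s C : ℝ} (h1 : r < s) (h2 : s < R)
    (hC : ∀ w : ℂ, ‖w‖ = s → ‖V (p w)‖ ≤ C) {z : ℂ} (hz : z ∈ H ∪ p '' annulusIoc r s) :
    ‖V z‖ ≤ C := by
  by_cases hz' : z ∈ H ∪ p '' annulus r s
  · have hcl := h.closure_union_subset h1 h2
    refine norm_le_of_forall_mem_frontier_norm_le (U := H ∪ p '' annulus r s)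
      ((h.isCompact_union s h1 h2).isBounded.subset
        (union_subset_union_right _ (image_mono annulus_subset_annulusIoc)))
      (DifferentiableOn.diffContOnCl (hV.mono (hcl.trans
        (union_subset_union_right _ (image_mono (annulusIoc_subset_annulus h2))))))
      (fun y hy => ?_) (subset_closure hz')
    rw [(h.isOpen_union' s h1 h2).frontier_eq] at hy
    obtain ⟨w, hw, rfl⟩ := mem_circle_of_mem_sdiff (hcl hy.1) hy.2
    exact hC w hw
  · obtain ⟨w, hw, rfl⟩ := mem_circle_of_mem_sdiff hz hz'
    exact hC w hw

/-- The maximum principle on the outer side of a collar. -/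
theorem norm_le_outside (h : Collar H p r R) {g : ℂ → ℂ} (hg : DifferentiableOn ℂ g Hᶜ)
    (hlim : Tendsto g (cobounded ℂ) (𝓝 0)) {s C : ℝ} (h1 : r < s) (h2 : s < R) (hC0 : 0 ≤ C)
    (hC : ∀ w : ℂ, ‖w‖ = s → ‖g (p w)‖ ≤ C) {z : ℂ} (hz : z ∉ H ∪ p '' annulus r s) :
    ‖g z‖ ≤ C := by
  by_cases hz' : z ∈ H ∪ p '' annulusIoc r s
  · obtain ⟨w, hw, rfl⟩ := mem_circle_of_mem_sdiff hz' hz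
    exact hC w hw
  -- The outer region is unbounded, so it is cut off at a large circle on which `|g| < ε`. The
  -- maximum principle on the bounded part then gives `C + ε`.
  refine le_of_forall_pos_le_add fun ε hε => ?_
  have hev : ∀ᶠ y in cobounded ℂ, ‖g y‖ < ε := by
    have := hlim.norm
    rw [norm_zero] at this
    exact this.eventually_lt_const hε
  obtain ⟨N, -, hN⟩ := hasBasis_cobounded_norm.mem_iff.1 hev
  set N' := max N (‖z‖ + 1) with hN'
  set O := (H ∪ p '' annulusIoc r s)ᶜ with hO
  have hOo : IsOpen O := (h.isCompact_union s h1 h2).isClosed.isOpen_compl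
  have hOcl : closure O ⊆ (H ∪ p '' annulus r s)ᶜ :=
    closure_minimal (compl_subset_compl.2
      (union_subset_union_right _ (image_mono annulus_subset_annulusIoc)))
      (h.isOpen_union' s h1 h2).isClosed_compl
  refine norm_le_of_forall_mem_frontier_norm_le (U := O ∩ ball 0 N')
    (isBounded_ball.subset inter_subset_right)
    (DifferentiableOn.diffContOnCl (hg.mono ?_)) (fun y hy => ?_)
    (subset_closure ⟨hz', by simp [hN']⟩)
  · refine (closure_mono inter_subset_left).trans (hOcl.trans (compl_subset_compl.2 ?_))
    exact subset_union_left
  · rcases frontier_inter_subset _ _ hy with ⟨hy1, -⟩ | ⟨-, hy2⟩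
    · have hyc := hOcl (frontier_subset_closure hy1)
      rw [hOo.frontier_eq] at hy1
      obtain ⟨w, hw, rfl⟩ := mem_circle_of_mem_sdiff (not_not.1 hy1.2) hyc
      exact (hC w hw).trans (by linarith)
    · have hyN : ‖y‖ = N' := by
        have := frontier_ball_subset_sphere hy2
        simpa using this
      have : ‖g y‖ < ε := hN (by
        change N ≤ ‖y‖
        rw [hyN]
        exact le_max_left _ _)
      linarith

theorem notMem_union_of_le (h : Collar H p r R) {w : ℂ} (hw : w ∈ annulus r R) {s : ℝ}
    (hs : s ≤ ‖w‖) : p w ∉ H ∪ p '' annulus r s := by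
  rintro (h1 | ⟨z, hz, hzw⟩)
  · exact h.notMem w hw h1
  · have hzA : z ∈ annulus r R := ⟨hz.1, hz.2.trans_le (hs.trans hw.2.le)⟩
    rw [h.conf.2.2 hzA hw hzw] at hz
    exact absurd hz.2 (not_lt.2 hs)

theorem mapsTo_compl (h : Collar H p r R) : MapsTo p (annulus r R) Hᶜ := fun w hw => h.notMem w hw

/-- **Liouville's theorem** on the surface obtained by gluing the inner side of a collar to the
outer side of another collar. -/
theorem liouville (hp : Collar Hp p r R) (hq : Collar Hq q r R) {V g : ℂ → ℂ} {l : ℂ}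
    (hV : DifferentiableOn ℂ V (Hp ∪ p '' annulus r R)) (hg : DifferentiableOn ℂ g Hqᶜ)
    (hVg : ∀ w ∈ annulus r R, V (p w) = g (q w)) (hlim : Tendsto g (cobounded ℂ) (𝓝 l)) :
    (∀ z ∈ Hp ∪ p '' annulus r R, V z = l) ∧ ∀ z ∈ Hqᶜ, g z = l := by
  have hr := hp.pos
  have hlt := hp.lt
  set s := (r + R) / 2 with hs
  have h1 : r < s := by linarith
  have h2 : s < R := by linarith
  have hsA : ∀ w : ℂ, ‖w‖ = s → w ∈ annulus r R := fun w hw => ⟨by rw [hw]; exact h1, by rw [hw]; exact h2⟩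
  set f := fun w => V (p w) - l with hf
  have hfd : DifferentiableOn ℂ f (annulus r R) :=
    (hV.comp hp.conf.2.1 fun w hw => Or.inr (mem_image_of_mem p hw)).sub_const l
  have hsph : (sphere (0 : ℂ) s).Nonempty := NormedSpace.sphere_nonempty.2 (by linarith)
  obtain ⟨w₀, hw₀, hmax⟩ := (isCompact_sphere (0 : ℂ) s).exists_isMaxOn hsph
    (f := fun w => ‖f w‖) ((hfd.continuousOn.mono fun w hw => hsA w (by simpa using hw)).norm)
  have hw₀s : ‖w₀‖ = s := by simpa using hw₀
  have hmax' : ∀ w : ℂ, ‖w‖ = s → ‖V (p w) - l‖ ≤ ‖f w₀‖ := fun w hw =>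
    hmax (mem_sphere_zero_iff_norm.2 hw)
  have hlim0 : Tendsto (fun z => g z - l) (cobounded ℂ) (𝓝 0) := by
    simpa using hlim.sub_const l
  -- The maximum principle on either side of the middle circle bounds `|f|` by its maximum on that
  -- circle. Thus `|f|` attains its maximum inside the annulus and `f` is constant; the identity
  -- theorem carries this to `g`, whose limit at `∞` makes the constant zero.
  have hle : ∀ w ∈ annulus r R, ‖f w‖ ≤ ‖f w₀‖ := by
    intro w hw
    rcases le_or_gt ‖w‖ s with h3 | h3
    · exact hp.norm_le_inside (hV.sub_const l) h1 h2 hmax'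
        (Or.inr (mem_image_of_mem p ⟨hw.1, h3⟩))
    · have := hq.norm_le_outside (hg.sub_const l) hlim0 h1 h2 (norm_nonneg (f w₀))
        (fun y hy => by rw [← hVg y (hsA y hy)]; exact hmax' y hy)
        (hq.notMem_union_of_le hw h3.le)
      rwa [← hVg w hw] at this
  have hconst := eqOn_of_isPreconnected_of_isMaxOn_norm (isPreconnected_annulus hr)
    (isOpen_annulus r R) hfd (hsA w₀ hw₀s) hle
  set c := f w₀ with hc
  have hfc : ∀ w ∈ annulus r R, V (p w) - l = c := fun w hw => hconst hw
  have hqo : IsOpen Hqᶜ := hq.isClosed.isOpen_compl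
  have hgc : EqOn g (fun _ => l + c) Hqᶜ := by
    refine (hg.analyticOnNhd hqo).eqOn_of_preconnected_of_eventuallyEq
      (fun z _ => analyticAt_const) hq.isPreconnected_compl (hq.mapsTo_compl (hsA w₀ hw₀s)) ?_
    filter_upwards [hq.conf.image_mem_nhds (hsA w₀ hw₀s) ((isOpen_annulus r R).mem_nhds
      (hsA w₀ hw₀s))]
    rintro _ ⟨w, hw, rfl⟩
    rw [← hVg w hw, ← hfc w hw]
    ring
  have hc0 : c = 0 := by
    have hbd : ∀ᶠ z in cobounded ℂ, z ∈ Hqᶜ := by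
      have := (hq.isCompact_union s h1 h2).isBounded.subset subset_union_left
      exact isBounded_def.1 this
    have h3 : Tendsto g (cobounded ℂ) (𝓝 (l + c)) :=
      tendsto_const_nhds.congr' (hbd.mono fun z hz => (hgc hz).symm)
    have := tendsto_nhds_unique hlim h3
    simpa using this
  refine ⟨?_, fun z hz => by rw [hgc hz, hc0, add_zero]⟩
  rintro z hz
  have hVz : ‖V z - l‖ ≤ 0 := by
    rcases hz with hz | ⟨w, hw, rfl⟩
    · exact hp.norm_le_inside (hV.sub_const l) h1 h2
        (fun w hw => by rw [hfc w (hsA w hw), hc0, norm_zero]) (Or.inl hz)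
    · rw [hfc w hw, hc0, norm_zero]
  exact sub_eq_zero.1 (norm_le_zero_iff.1 hVz)

end Collar

end ConformalWelding

/-! ### Circle integrals with parameters and the Fredholm alternative. -/

namespace ConformalWelding

open Metric Complex Bornology MeasureTheory

/-- Continuity of a circle integral depending on a parameter. -/
theorem continuousOn_circleIntegral {X : Type*} [TopologicalSpace X] [FirstCountableTopology X]
    {s : ℝ} (hs : 0 ≤ s) {φ : ℂ → X → ℂ} {U : Set X}
    (hφ : ContinuousOn (fun x : ℂ × X => φ x.1 x.2) (sphere 0 s ×ˢ U)) :
    ContinuousOn (fun x => ∮ w in C(0, s), φ w x) U := by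
  rw [continuousOn_iff_continuous_domRestrict]
  have : Continuous (Function.uncurry fun (x : U) (t : ℝ) =>
      deriv (circleMap 0 s) t • φ (circleMap 0 s t) x) := by
    have h1 : Continuous fun y : U × ℝ => deriv (circleMap 0 s) y.2 := by
      simp only [deriv_circleMap]
      fun_prop
    have h2 : Continuous fun y : U × ℝ => φ (circleMap 0 s y.2) y.1 := by
      refine hφ.comp_continuous (f := fun y : U × ℝ => (circleMap 0 s y.2, (y.1 : X)))
        (by fun_prop) fun y => ⟨circleMap_mem_sphere 0 hs _, y.1.2⟩
    exact h1.smul h2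
  exact intervalIntegral.continuous_parametric_intervalIntegral_of_continuous' this 0 (2 * Real.pi)

/-- Holomorphy of a circle integral depending on a parameter. -/
theorem differentiableOn_circleIntegral {s : ℝ} (hs : 0 ≤ s) {φ : ℂ → ℂ → ℂ} {U : Set ℂ}
    (hU : IsOpen U) (hφ : ContinuousOn (fun x : ℂ × ℂ => φ x.1 x.2) (sphere 0 s ×ˢ U))
    (hd : ∀ w ∈ sphere (0 : ℂ) s, DifferentiableOn ℂ (φ w) U) :
    DifferentiableOn ℂ (fun z => ∮ w in C(0, s), φ w z) U := by
  intro z₀ hz₀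
  obtain ⟨δ, hδ, hδU⟩ := nhds_basis_closedBall.mem_iff.1 (hU.mem_nhds hz₀)
  set ε := δ / 2 with hε
  have hε0 : 0 < ε := by positivity
  obtain ⟨C, hC⟩ := ((isCompact_sphere (0 : ℂ) s).prod
    (isCompact_closedBall z₀ δ)).exists_bound_of_continuousOn
    (hφ.mono (prod_mono_right hδU))
  have hsub : ∀ z ∈ ball z₀ ε, closedBall z ε ⊆ closedBall z₀ δ := fun z hz =>
    closedBall_subset_closedBall' (by have := mem_ball.1 hz; linarith)
  have hmem : ∀ t, circleMap 0 s t ∈ sphere (0 : ℂ) s := fun t => circleMap_mem_sphere 0 hs t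
  have hcontθ : ∀ z ∈ U, Continuous fun t : ℝ => φ (circleMap 0 s t) z := fun z hz =>
    hφ.comp_continuous (f := fun t : ℝ => (circleMap 0 s t, z)) (by fun_prop)
      fun t => ⟨hmem t, hz⟩
  have hdc : Continuous fun t : ℝ => deriv (circleMap 0 s) t := by
    simp only [deriv_circleMap]
    fun_prop
  -- The `z`-derivative of `φ` is written as a Cauchy integral over a small circle about `z₀`, which
  -- makes it continuous, hence measurable, in `w`.
  have hderivc : ContinuousOn (fun w => deriv (φ w) z₀) (sphere 0 s) := by
    have h1 : ContinuousOn (fun w => ∮ ζ in C(0, ε), (1 / (ζ : ℂ) ^ 2) • φ w (z₀ + ζ))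
        (sphere 0 s) := by
      refine continuousOn_circleIntegral hε0.le
        (φ := fun ζ w => (1 / (ζ : ℂ) ^ 2) • φ w (z₀ + ζ)) ?_
      have h2 : ContinuousOn (fun y : ℂ × ℂ => 1 / y.1 ^ 2) (sphere 0 ε ×ˢ sphere 0 s) := by
        refine continuousOn_const.div (by fun_prop) ?_
        rintro ⟨ζ, w⟩ ⟨h1, -⟩
        exact pow_ne_zero 2 (ne_zero_of_mem_sphere hε0.ne' ⟨ζ, h1⟩)
      have h3 : ContinuousOn (fun y : ℂ × ℂ => φ y.2 (z₀ + y.1)) (sphere 0 ε ×ˢ sphere 0 s) := by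
        refine hφ.comp (f := fun y : ℂ × ℂ => (y.2, z₀ + y.1)) (by fun_prop) ?_
        rintro ⟨ζ, w⟩ ⟨h1, h2⟩
        refine ⟨h2, hδU ?_⟩
        have : ‖ζ‖ = ε := by simpa using h1
        rw [mem_closedBall_iff_norm, add_sub_cancel_left, this]
        linarith
      exact h2.smul h3
    refine (h1.const_smul (2 * Real.pi * I : ℂ)⁻¹).congr fun w hw => ?_
    have h2 := (((hd w hw).mono hδU).diffContOnCl_ball (closedBall_subset_closedBall
      (show ε ≤ δ by linarith))).deriv_eq_smul_circleIntegral hε0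
    rw [eq_comm, Pi.smul_apply, inv_smul_eq_iff₀ two_pi_I_ne_zero, ← h2]
    simp only [circleIntegral, circleMap, deriv_circleMap]
    simp
  refine DifferentiableAt.differentiableWithinAt ?_
  have main := intervalIntegral.hasDerivAt_integral_of_dominated_loc_of_deriv_le (𝕜 := ℂ)
    (μ := volume) (a := 0) (b := 2 * Real.pi) (bound := fun _ => |s| * (C / ε)) (x₀ := z₀)
    (F := fun z t => deriv (circleMap 0 s) t • φ (circleMap 0 s t) z)
    (F' := fun z t => deriv (circleMap 0 s) t • deriv (φ (circleMap 0 s t)) z)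
    (ball_mem_nhds z₀ hε0) ?_ ?_ ?_ ?_ ?_ ?_
  · exact main.2.differentiableAt
  · filter_upwards [hU.mem_nhds hz₀] with z hz
    exact (hdc.smul (hcontθ z hz)).aestronglyMeasurable
  · exact (hdc.smul (hcontθ z₀ hz₀)).intervalIntegrable _ _
  · refine (hdc.smul ?_).aestronglyMeasurable
    exact hderivc.comp_continuous (continuous_circleMap 0 s) hmem
  · refine Eventually.of_forall fun t _ z hz => ?_
    rw [norm_smul]
    have h1 : ‖deriv (circleMap 0 s) t‖ = |s| := by simp
    rw [h1]
    refine mul_le_mul_of_nonneg_left ?_ (abs_nonneg s)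
    refine norm_deriv_le_of_forall_mem_sphere_norm_le hε0
      ((hd _ (hmem t)).diffContOnCl_ball ((hsub z hz).trans hδU)) fun y hy => ?_
    exact hC (_, y) ⟨hmem t, hsub z hz (sphere_subset_closedBall hy)⟩
  · exact intervalIntegrable_const
  · refine Eventually.of_forall fun t _ z hz => ?_
    have hzU : z ∈ U := hδU (hsub z hz (mem_closedBall_self hε0.le))
    exact (((hd _ (hmem t)).differentiableAt (hU.mem_nhds hzU)).hasDerivAt).const_mul _

/-- The integral operator with a continuous kernel on a compact space, the integration being along
a curve. -/
noncomputable def curveOperator {K : Type*} [TopologicalSpace K] [CompactSpace K]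
    [FirstCountableTopology K] (θ : C(ℝ, K)) (k : C(K × ℝ, ℂ)) (b : ℝ) :
    BoundedContinuousFunction K ℂ →ₗ[ℂ] BoundedContinuousFunction K ℂ where
  toFun f := BoundedContinuousFunction.mkOfCompact
    ⟨fun x => ∫ t in (0 : ℝ)..b, k (x, t) * f (θ t), by
      refine intervalIntegral.continuous_parametric_intervalIntegral_of_continuous'
        (f := fun x t => k (x, t) * f (θ t)) ?_ 0 b
      change Continuous fun y : K × ℝ => k (y.1, y.2) * f (θ y.2)
      fun_prop⟩
  map_add' f g := by
    ext x
    have hk : Continuous fun t : ℝ => k (x, t) := by fun_prop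
    have h1 : IntervalIntegrable (fun t => k (x, t) * f (θ t)) volume 0 b :=
      (hk.mul (f.continuous.comp θ.continuous)).intervalIntegrable _ _
    have h2 : IntervalIntegrable (fun t => k (x, t) * g (θ t)) volume 0 b :=
      (hk.mul (g.continuous.comp θ.continuous)).intervalIntegrable _ _
    simp only [BoundedContinuousFunction.mkOfCompact_apply, ContinuousMap.coe_mk,
      BoundedContinuousFunction.coe_add, Pi.add_apply, mul_add]
    exact intervalIntegral.integral_add h1 h2
  map_smul' c f := by
    ext x
    simp only [BoundedContinuousFunction.mkOfCompact_apply, ContinuousMap.coe_mk,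
      BoundedContinuousFunction.coe_smul, smul_eq_mul, RingHom.id_apply]
    rw [← intervalIntegral.integral_const_mul]
    exact intervalIntegral.integral_congr fun t _ => by ring

section

variable {K : Type*} [TopologicalSpace K] [CompactSpace K] [FirstCountableTopology K]
  (θ : C(ℝ, K)) (k : C(K × ℝ, ℂ)) (b : ℝ)

theorem curveOperator_apply (f : BoundedContinuousFunction K ℂ) (x : K) :
    curveOperator θ k b f x = ∫ t in (0 : ℝ)..b, k (x, t) * f (θ t) := rfl

theorem exists_norm_curveOperator_le :
    ∃ C, ∀ f, ‖curveOperator θ k b f‖ ≤ C * ‖f‖ := by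
  obtain ⟨C, hC⟩ := ((isCompact_univ (X := K)).prod
    (isCompact_uIcc (a := (0 : ℝ)) (b := b))).exists_bound_of_continuousOn k.continuous.continuousOn
  refine ⟨max C 0 * |b - 0|, fun f => (BoundedContinuousFunction.norm_le (by positivity)).2
    fun x => ?_⟩
  rw [curveOperator_apply, mul_right_comm]
  refine intervalIntegral.norm_integral_le_of_norm_le_const fun t ht => ?_
  rw [norm_mul]
  exact mul_le_mul ((hC (x, t) ⟨mem_univ _, uIoc_subset_uIcc ht⟩).trans (le_max_left _ _))
    (f.norm_coe_le_norm _) (norm_nonneg _) (le_max_right _ _)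

theorem isCompactOperator_curveOperator : IsCompactOperator (curveOperator θ k b) := by
  obtain ⟨C, hC⟩ := exists_norm_curveOperator_le θ k b
  rw [isCompactOperator_iff_isCompact_closure_image_closedBall _ one_pos]
  refine BoundedContinuousFunction.arzela_ascoli (closedBall (0 : ℂ) |C|)
    (isCompact_closedBall _ _) _ ?_ ?_
  · rintro _ x ⟨f, hf, rfl⟩
    rw [mem_closedBall_zero_iff] at hf ⊢
    calc ‖curveOperator θ k b f x‖ ≤ ‖curveOperator θ k b f‖ :=
          BoundedContinuousFunction.norm_coe_le_norm _ _
      _ ≤ C * ‖f‖ := hC f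
      _ ≤ |C| * 1 := mul_le_mul (le_abs_self C) hf (norm_nonneg _) (abs_nonneg _)
      _ = |C| := mul_one _
  · intro x₀
    -- This modulus of continuity does not depend on `f` in the unit ball, so the images are
    -- equicontinuous.
    have hc : Continuous fun x => |∫ t in (0 : ℝ)..b, ‖k (x₀, t) - k (x, t)‖| := by
      refine (intervalIntegral.continuous_parametric_intervalIntegral_of_continuous'
        (f := fun x t => ‖k (x₀, t) - k (x, t)‖) ?_ 0 b).abs
      change Continuous fun y : K × ℝ => ‖k (x₀, y.2) - k (y.1, y.2)‖
      fun_prop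
    refine equicontinuousAt_of_continuity_modulus _ (by simpa using hc.tendsto x₀) _ ?_
    refine Eventually.of_forall fun x => ?_
    rintro ⟨_, f, hf, rfl⟩
    rw [mem_closedBall_zero_iff] at hf
    have hk : ∀ x, IntervalIntegrable (fun t => k (x, t) * f (θ t)) volume 0 b := fun x =>
      Continuous.intervalIntegrable (by fun_prop) _ _
    change dist (curveOperator θ k b f x₀) (curveOperator θ k b f x) ≤ _
    rw [dist_eq_norm, curveOperator_apply, curveOperator_apply,
      ← intervalIntegral.integral_sub (hk x₀) (hk x)]
    refine intervalIntegral.norm_integral_le_abs_of_norm_le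
      (Eventually.of_forall fun t => ?_) (Continuous.intervalIntegrable (by fun_prop) _ _)
    rw [← sub_mul, norm_mul]
    exact mul_le_of_le_one_right (norm_nonneg _) ((f.norm_coe_le_norm _).trans hf)

/-- The Fredholm alternative for integral equations of the second kind. -/
theorem exists_sub_curveOperator_eq (h : ∀ f, curveOperator θ k b f = f → f = 0)
    (u : BoundedContinuousFunction K ℂ) : ∃ f, f - curveOperator θ k b f = u := by
  obtain ⟨C, hC⟩ := exists_norm_curveOperator_le θ k b
  set T : BoundedContinuousFunction K ℂ →L[ℂ] BoundedContinuousFunction K ℂ :=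
    (curveOperator θ k b).mkContinuous C hC
  have hT : IsCompactOperator T := isCompactOperator_curveOperator θ k b
  rcases hT.hasEigenvalue_or_mem_resolventSet one_ne_zero with h1 | h1
  · obtain ⟨f, hf⟩ := h1.exists_hasEigenvector
    exact absurd (h f (by simpa using! hf.apply_eq_smul)) hf.2
  · rw [spectrum.mem_resolventSet_iff, map_one] at h1
    obtain ⟨S, hS⟩ := h1.exists_right_inv
    refine ⟨S u, ?_⟩
    have := congrArg (fun L : BoundedContinuousFunction K ℂ →L[ℂ] _ => L u) hS
    simpa using! this

end

end ConformalWelding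

/-! ### Cauchy transforms along images of circles. -/

namespace ConformalWelding

open Metric Complex Bornology MeasureTheory

variable {r R a b s : ℝ} {p q f : ℂ → ℂ}

theorem sphere_subset_annulus (h1 : r < s) (h2 : s < R) : sphere (0 : ℂ) s ⊆ annulus r R :=
  fun w hw => by
    have : ‖w‖ = s := by simpa using hw
    exact ⟨by rw [this]; exact h1, by rw [this]; exact h2⟩

/-- The slope of a conformal map does not vanish. -/
theorem _root_.IsConformalOn.dslope_ne_zero {U : Set ℂ} (hp : IsConformalOn p U) {w z : ℂ}
    (hw : w ∈ U) (hz : z ∈ U) : dslope p w z ≠ 0 := by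
  rcases eq_or_ne z w with rfl | hne
  · rw [dslope_same]
    exact hp.deriv_ne_zero hw
  · rw [dslope_of_ne _ hne, slope_def_field]
    exact div_ne_zero (sub_ne_zero.2 fun h => hne (hp.2.2 hz hw h)) (sub_ne_zero.2 hne)

theorem _root_.IsConformalOn.continuousOn_deriv {U : Set ℂ} (hp : IsConformalOn p U) :
    ContinuousOn (deriv p) U :=
  (hp.2.1.deriv hp.1).continuousOn

/-- The Cauchy integral over the image of a circle under the map `p`. -/
noncomputable def cauchyTransform (p : ℂ → ℂ) (s : ℝ) (f : ℂ → ℂ) (z : ℂ) : ℂ :=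
  (2 * Real.pi * I)⁻¹ * ∮ w in C(0, s), f w * deriv p w / (p w - z)

theorem cauchyTransform_congr {f' : ℂ → ℂ} (hs : 0 ≤ s) (h : EqOn f f' (sphere 0 s)) (z : ℂ) :
    cauchyTransform p s f z = cauchyTransform p s f' z := by
  unfold cauchyTransform
  rw [circleIntegral.integral_congr hs fun w hw => by rw [h hw]]

theorem differentiableOn_cauchyTransform (hp : IsConformalOn p (annulus r R)) (hs : 0 ≤ s)
    (h1 : r < s) (h2 : s < R) (hf : ContinuousOn f (sphere 0 s)) :
    DifferentiableOn ℂ (cauchyTransform p s f) (p '' sphere 0 s)ᶜ := by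
  have hsub := sphere_subset_annulus h1 h2
  have hpc : ContinuousOn p (sphere 0 s) := hp.2.1.continuousOn.mono hsub
  have hcl : IsClosed (p '' sphere 0 s) := ((isCompact_sphere _ _).image_of_continuousOn hpc).isClosed
  have hne : ∀ w ∈ sphere (0 : ℂ) s, ∀ z ∈ (p '' sphere 0 s)ᶜ, p w - z ≠ 0 :=
    fun w hw z hz h => hz ⟨w, hw, sub_eq_zero.1 h⟩
  refine (differentiableOn_circleIntegral hs (φ := fun w z => f w * deriv p w / (p w - z))
    hcl.isOpen_compl ?_ fun w hw => ?_).const_mul _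
  · have h3 : MapsTo Prod.fst (sphere (0 : ℂ) s ×ˢ (p '' sphere 0 s)ᶜ) (sphere (0 : ℂ) s) :=
      fun x hx => hx.1
    refine ContinuousOn.div ?_ ?_ fun x hx => hne _ hx.1 _ hx.2
    · exact (hf.comp continuousOn_fst h3).mul
        ((hp.continuousOn_deriv.mono hsub).comp continuousOn_fst h3)
    · exact (hpc.comp continuousOn_fst h3).sub continuousOn_snd
  · exact (differentiableOn_const _).div ((differentiableOn_const _).sub differentiableOn_id)
      fun z hz => hne w hw z hz

theorem tendsto_cauchyTransform (hp : IsConformalOn p (annulus r R)) (hs : 0 ≤ s)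
    (h1 : r < s) (h2 : s < R) (hf : ContinuousOn f (sphere 0 s)) :
    Tendsto (cauchyTransform p s f) (cobounded ℂ) (𝓝 0) := by
  have hsub := sphere_subset_annulus h1 h2
  obtain ⟨N, hN⟩ := (isCompact_sphere (0 : ℂ) s).exists_bound_of_continuousOn
    (hp.2.1.continuousOn.mono hsub)
  obtain ⟨M, hM⟩ := (isCompact_sphere (0 : ℂ) s).exists_bound_of_continuousOn
    (hf.mul (hp.continuousOn_deriv.mono hsub))
  have hlim : Tendsto (fun z : ℂ => s * (|M| / (‖z‖ - N))) (cobounded ℂ) (𝓝 0) := by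
    have h3 : Tendsto (fun z : ℂ => ‖z‖ - N) (cobounded ℂ) atTop := by
      simpa [sub_eq_add_neg] using tendsto_atTop_add_const_right _ (-N) tendsto_norm_cobounded_atTop
    simpa using (h3.const_div_atTop |M|).const_mul s
  refine squeeze_zero_norm' ?_ hlim
  filter_upwards [tendsto_norm_cobounded_atTop.eventually_gt_atTop N] with z hz
  have := circleIntegral.norm_two_pi_i_inv_smul_integral_le_of_norm_le_const
    (f := fun w => f w * deriv p w / (p w - z)) (c := 0) (C := |M| / (‖z‖ - N)) hs
    fun w hw => by
      rw [norm_div]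
      refine div_le_div₀ (abs_nonneg M) ((hM w hw).trans (le_abs_self M)) (by linarith) ?_
      have h3 := norm_sub_norm_le z (p w)
      rw [norm_sub_rev] at h3
      linarith [hN w hw]
  simpa [cauchyTransform] using this

/-- The Cauchy integral formula in an annulus. -/
theorem cauchy_formula_annulus {h : ℂ → ℂ} (hh : DifferentiableOn ℂ h (annulus r R)) (hr : 0 ≤ r)
    (ha : r < a) (hb : b < R) {w₀ : ℂ} (hw₀ : w₀ ∈ annulus a b) :
    h w₀ = (2 * Real.pi * I)⁻¹ *
      ((∮ ξ in C(0, b), h ξ / (ξ - w₀)) - ∮ ξ in C(0, a), h ξ / (ξ - w₀)) := by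
  have ha0 : 0 < a := hr.trans_lt ha
  have hab : a < b := hw₀.1.trans hw₀.2
  have hb0 : 0 < b := ha0.trans hab
  have hopen := isOpen_annulus r R
  have hw₀A : w₀ ∈ annulus r R := ⟨ha.trans hw₀.1, hw₀.2.trans hb⟩
  have hd : DifferentiableOn ℂ (dslope h w₀) (annulus r R) :=
    (differentiableOn_dslope (hopen.mem_nhds hw₀A)).2 hh
  -- The slope of `h` at `w₀` is holomorphic on the whole annulus, so its integrals over the two
  -- circles coincide. Expanding the slope gives the formula, since the integral of `(ξ - w₀)⁻¹` is
  -- `2πi` over the outer circle and `0` over the inner one.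
  have heq := circleIntegral_eq_of_differentiable_on_annulus_off_countable (c := 0) ha0 hab.le
    countable_empty (f := dslope h w₀) (hd.continuousOn.mono ?_) ?_
  rotate_left
  · intro z hz
    have h1 : ‖z‖ ≤ b := by simpa using hz.1
    have h2 : a ≤ ‖z‖ := by simpa using hz.2
    exact ⟨ha.trans_le h2, h1.trans_lt hb⟩
  · intro z hz
    have h1 : ‖z‖ < b := by simpa using hz.1.1
    have h2 : a < ‖z‖ := by simpa using hz.1.2
    exact hd.differentiableAt (hopen.mem_nhds ⟨ha.trans h2, h1.trans hb⟩)
  have hne : ∀ t : ℝ, t = a ∨ t = b → ∀ ξ ∈ sphere (0 : ℂ) t, ξ ≠ w₀ := by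
    rintro t ht ξ hξ rfl
    have : ‖ξ‖ = t := by simpa using hξ
    rcases ht with rfl | rfl
    · exact absurd hw₀.1 (by rw [this]; exact lt_irrefl _)
    · exact absurd hw₀.2 (by rw [this]; exact lt_irrefl _)
  have hint : ∀ t : ℝ, t = a ∨ t = b →
      (∮ ξ in C(0, t), dslope h w₀ ξ) =
        (∮ ξ in C(0, t), h ξ / (ξ - w₀)) - h w₀ * ∮ ξ in C(0, t), (ξ - w₀)⁻¹ := by
    intro t ht
    have ht0 : 0 ≤ t := by rcases ht with rfl | rfl <;> linarith
    have htA : sphere (0 : ℂ) t ⊆ annulus r R := by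
      rcases ht with rfl | rfl <;> apply sphere_subset_annulus <;> linarith
    have hc1 : ContinuousOn (fun ξ => ξ - w₀) (sphere (0 : ℂ) t) := by fun_prop
    have hc2 : ContinuousOn (fun ξ => h ξ / (ξ - w₀)) (sphere (0 : ℂ) t) :=
      (hh.continuousOn.mono htA).div hc1 fun ξ hξ => sub_ne_zero.2 (hne t ht ξ hξ)
    have hc3 : ContinuousOn (fun ξ => h w₀ * (ξ - w₀)⁻¹) (sphere (0 : ℂ) t) :=
      continuousOn_const.mul (hc1.inv₀ fun ξ hξ => sub_ne_zero.2 (hne t ht ξ hξ))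
    rw [← circleIntegral.integral_const_mul, ← circleIntegral.integral_sub
      (hc2.circleIntegrable ht0) (hc3.circleIntegrable ht0)]
    refine circleIntegral.integral_congr ht0 fun ξ hξ => ?_
    rw [dslope_of_ne _ (hne t ht ξ hξ), slope_def_field, sub_div, div_eq_mul_inv (h w₀)]
  have hIb : (∮ ξ in C(0, b), (ξ - w₀)⁻¹) = 2 * Real.pi * I :=
    circleIntegral.integral_sub_inv_of_mem_ball (by simpa using hw₀.2)
  have hIa : (∮ ξ in C(0, a), (ξ - w₀)⁻¹) = 0 := by
    refine circleIntegral_eq_zero_of_differentiable_on_off_countable ha0.le countable_empty ?_ ?_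
    · refine ContinuousOn.inv₀ (by fun_prop) fun ξ hξ => sub_ne_zero.2 ?_
      rintro rfl
      have : ‖ξ‖ ≤ a := by simpa using hξ
      exact absurd hw₀.1 (not_lt.2 this)
    · intro ξ hξ
      refine DifferentiableAt.inv (by fun_prop) (sub_ne_zero.2 ?_)
      rintro rfl
      have : ‖ξ‖ < a := by simpa using hξ.1
      exact absurd hw₀.1 (not_lt.2 this.le)
  rw [hint b (Or.inr rfl), hint a (Or.inl rfl), hIb, hIa, mul_zero, sub_zero] at heq
  rw [← heq, sub_sub_cancel, mul_comm (h w₀), inv_mul_cancel_left₀ two_pi_I_ne_zero]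

/-- The jump formula for the Cauchy transform. -/
theorem cauchyTransform_sub (hp : IsConformalOn p (annulus r R)) (hr : 0 ≤ r) (ha : r < a)
    (hb : b < R) (hf : DifferentiableOn ℂ f (annulus r R)) {w₀ : ℂ} (hw₀ : w₀ ∈ annulus a b) :
    cauchyTransform p b f (p w₀) - cauchyTransform p a f (p w₀) = f w₀ := by
  have hopen := isOpen_annulus r R
  have hw₀A : w₀ ∈ annulus r R := ⟨ha.trans hw₀.1, hw₀.2.trans hb⟩
  have hd : DifferentiableOn ℂ (dslope p w₀) (annulus r R) :=
    (differentiableOn_dslope (hopen.mem_nhds hw₀A)).2 hp.2.1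
  have hab : a < b := hw₀.1.trans hw₀.2
  -- The chosen function takes the value `f w₀` at `w₀`. Divided by `ξ - w₀` it is the integrand of
  -- the Cauchy transform along `p`.
  have key := cauchy_formula_annulus (h := fun w => f w * deriv p w / dslope p w₀ w)
    ((hf.mul (hp.2.1.deriv hopen)).div hd fun w hw => hp.dslope_ne_zero hw₀A hw) hr ha hb hw₀
  have hint : ∀ t : ℝ, t = a ∨ t = b →
      (∮ ξ in C(0, t), f ξ * deriv p ξ / dslope p w₀ ξ / (ξ - w₀)) =
        ∮ ξ in C(0, t), f ξ * deriv p ξ / (p ξ - p w₀) := by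
    intro t ht
    have ht0 : 0 ≤ t := by rcases ht with rfl | rfl <;> linarith
    refine circleIntegral.integral_congr ht0 fun ξ hξ => ?_
    have hne : ξ ≠ w₀ := by
      rintro rfl
      have : ‖ξ‖ = t := by simpa using hξ
      rcases ht with rfl | rfl
      · exact absurd hw₀.1 (by rw [this]; exact lt_irrefl _)
      · exact absurd hw₀.2 (by rw [this]; exact lt_irrefl _)
    rw [dslope_of_ne _ hne, slope_def_field, div_div, div_mul_cancel₀ _ (sub_ne_zero.2 hne)]
  rw [hint b (Or.inr rfl), hint a (Or.inl rfl), dslope_same,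
    mul_div_cancel_right₀ _ (hp.deriv_ne_zero hw₀A), mul_sub] at key
  rw [key]
  rfl

end ConformalWelding

/-! ### The smooth difference of two Cauchy kernels. -/

namespace ConformalWelding

open Metric Complex Bornology MeasureTheory

variable {r R a b ρ : ℝ} {p q f : ℂ → ℂ}

/-- The difference of the Cauchy kernels of two conformal maps. -/
noncomputable def kernelDiff (p q : ℂ → ℂ) (w ξ : ℂ) : ℂ :=
  deriv q w / (q w - q ξ) - deriv p w / (p w - p ξ)

/-- The difference of the Cauchy kernels, continued over the diagonal by the Cauchy formula. -/
noncomputable def smoothKernel (p q : ℂ → ℂ) (a b : ℝ) (w w₀ : ℂ) : ℂ :=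
  (2 * Real.pi * I)⁻¹ *
    ((∮ ξ in C(0, b), kernelDiff p q w ξ / (ξ - w₀)) - ∮ ξ in C(0, a), kernelDiff p q w ξ / (ξ - w₀))

theorem ne_of_mem_annulus_of_mem_sphere {w ξ : ℂ} {t : ℝ} (hw : w ∈ annulus a b)
    (ht : t = a ∨ t = b) (hξ : ξ ∈ sphere (0 : ℂ) t) : ξ ≠ w := by
  rintro rfl
  have : ‖ξ‖ = t := by simpa using hξ
  rcases ht with rfl | rfl
  · exact absurd hw.1 (by rw [this]; exact lt_irrefl _)
  · exact absurd hw.2 (by rw [this]; exact lt_irrefl _)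

/-- As functions of `ξ`, both Cauchy kernels have the principal part `1 / (w - ξ)` at `ξ = w`. Their
difference extends holomorphically over the diagonal, and the Cauchy formula in the annulus
reproduces it. -/
theorem smoothKernel_eq (hp : IsConformalOn p (annulus r R)) (hq : IsConformalOn q (annulus r R))
    (hr : 0 ≤ r) (ha : r < a) (hb : b < R) {w w₀ : ℂ} (hw : w ∈ annulus a b)
    (hw₀ : w₀ ∈ annulus a b) (hne : w₀ ≠ w) :
    smoothKernel p q a b w w₀ = kernelDiff p q w w₀ := by
  have hopen := isOpen_annulus r R
  have hwA : w ∈ annulus r R := ⟨ha.trans hw.1, hw.2.trans hb⟩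
  have hab : a < b := hw₀.1.trans hw₀.2
  have hnhds := hopen.mem_nhds hwA
  set n := fun ξ => deriv q w / dslope q w ξ - deriv p w / dslope p w ξ with hn
  have hnd : DifferentiableOn ℂ n (annulus r R) :=
    ((differentiableOn_const _).div ((differentiableOn_dslope hnhds).2 hq.2.1)
      fun ξ hξ => hq.dslope_ne_zero hwA hξ).sub
    ((differentiableOn_const _).div ((differentiableOn_dslope hnhds).2 hp.2.1)
      fun ξ hξ => hp.dslope_ne_zero hwA hξ)
  have hnw : n w = 0 := by
    simp only [hn, dslope_same]
    rw [div_self (hq.deriv_ne_zero hwA), div_self (hp.deriv_ne_zero hwA), sub_self]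
  have hval : ∀ ξ ∈ annulus r R, ξ ≠ w → -dslope n w ξ = kernelDiff p q w ξ := by
    intro ξ hξ hξw
    have h0 : ξ - w ≠ 0 := sub_ne_zero.2 hξw
    have h1 : q ξ - q w ≠ 0 := sub_ne_zero.2 fun h => hξw (hq.2.2 hξ hwA h)
    have h2 : p ξ - p w ≠ 0 := sub_ne_zero.2 fun h => hξw (hp.2.2 hξ hwA h)
    have h1' : q w - q ξ ≠ 0 := by rw [← neg_sub]; exact neg_ne_zero.2 h1
    have h2' : p w - p ξ ≠ 0 := by rw [← neg_sub]; exact neg_ne_zero.2 h2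
    rw [dslope_of_ne _ hξw, slope_def_field, hnw]
    simp only [hn]
    rw [dslope_of_ne _ hξw, dslope_of_ne _ hξw, slope_def_field, slope_def_field, kernelDiff,
      ← neg_sub (q ξ), ← neg_sub (p ξ)]
    field_simp
    ring
  have key := cauchy_formula_annulus (h := fun ξ => -dslope n w ξ)
    ((differentiableOn_dslope hnhds).2 hnd).neg hr ha hb hw₀
  rw [hval w₀ ⟨ha.trans hw₀.1, hw₀.2.trans hb⟩ hne] at key
  have hint : ∀ t : ℝ, t = a ∨ t = b →
      (∮ ξ in C(0, t), -dslope n w ξ / (ξ - w₀)) =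
        ∮ ξ in C(0, t), kernelDiff p q w ξ / (ξ - w₀) := by
    intro t ht
    refine circleIntegral.integral_congr ?_ fun ξ hξ => ?_
    · rcases ht with rfl | rfl <;> linarith
    · have htA : sphere (0 : ℂ) t ⊆ annulus r R := by
        rcases ht with rfl | rfl <;> apply sphere_subset_annulus <;> linarith
      simp only [hval ξ (htA hξ) (ne_of_mem_annulus_of_mem_sphere hw ht hξ)]
  rw [hint b (Or.inr rfl), hint a (Or.inl rfl)] at key
  rw [key, smoothKernel]

theorem continuousOn_kernelDiff {U : Set ℂ} (hp : IsConformalOn p U) (hq : IsConformalOn q U) :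
    ContinuousOn (fun x : ℂ × ℂ => kernelDiff p q x.1 x.2) {x | x.1 ∈ U ∧ x.2 ∈ U ∧ x.2 ≠ x.1} := by
  have main : ∀ g : ℂ → ℂ, IsConformalOn g U → ContinuousOn (fun x : ℂ × ℂ =>
      deriv g x.1 / (g x.1 - g x.2)) {x | x.1 ∈ U ∧ x.2 ∈ U ∧ x.2 ≠ x.1} := by
    intro g hg
    have h1 : MapsTo Prod.fst {x : ℂ × ℂ | x.1 ∈ U ∧ x.2 ∈ U ∧ x.2 ≠ x.1} U := fun x hx => hx.1
    have h2 : MapsTo Prod.snd {x : ℂ × ℂ | x.1 ∈ U ∧ x.2 ∈ U ∧ x.2 ≠ x.1} U := fun x hx => hx.2.1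
    exact (hg.continuousOn_deriv.comp continuousOn_fst h1).div
      ((hg.2.1.continuousOn.comp continuousOn_fst h1).sub
        (hg.2.1.continuousOn.comp continuousOn_snd h2))
      fun x hx => sub_ne_zero.2 fun h => hx.2.2 (hg.2.2 hx.1 hx.2.1 h).symm
  exact (main q hq).sub (main p hp)

/-- The circles of integration `|ξ| = a` and `|ξ| = b` avoid `w` and `w₀`, so nothing is singular at
`w = w₀`. This joint continuity makes the integral operator compact. -/
theorem continuousOn_smoothKernel (hp : IsConformalOn p (annulus r R))
    (hq : IsConformalOn q (annulus r R)) (hr : 0 ≤ r) (ha : r < a) (hab : a < b) (hb : b < R) :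
    ContinuousOn (fun x : ℂ × ℂ => smoothKernel p q a b x.1 x.2)
      (annulus a b ×ˢ annulus a b) := by
  have main : ∀ t : ℝ, t = a ∨ t = b → ContinuousOn (fun x : ℂ × ℂ =>
      ∮ ξ in C(0, t), kernelDiff p q x.1 ξ / (ξ - x.2)) (annulus a b ×ˢ annulus a b) := by
    intro t ht
    have htA : sphere (0 : ℂ) t ⊆ annulus r R := by
      rcases ht with rfl | rfl <;> apply sphere_subset_annulus <;> linarith
    refine continuousOn_circleIntegral (X := ℂ × ℂ)
      (φ := fun ξ x => kernelDiff p q x.1 ξ / (ξ - x.2)) ?_ ?_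
    · rcases ht with rfl | rfl <;> linarith
    · refine ContinuousOn.div ?_ (by fun_prop) ?_
      · refine (continuousOn_kernelDiff hp hq).comp
          (f := fun y : ℂ × ℂ × ℂ => (y.2.1, y.1)) (by fun_prop) ?_
        rintro ⟨ξ, w, w₀⟩ ⟨hξ, hw, hw₀⟩
        exact ⟨annulus_subset_annulus ha.le hb.le hw, htA hξ,
          ne_of_mem_annulus_of_mem_sphere hw ht hξ⟩
      · rintro ⟨ξ, w, w₀⟩ ⟨hξ, hw, hw₀⟩
        exact sub_ne_zero.2 (ne_of_mem_annulus_of_mem_sphere hw₀ ht hξ)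
  exact ((main b (Or.inr rfl)).sub (main a (Or.inl rfl))).const_smul (2 * Real.pi * I : ℂ)⁻¹

theorem differentiableOn_smoothKernel (hp : IsConformalOn p (annulus r R))
    (hq : IsConformalOn q (annulus r R)) (hr : 0 ≤ r) (ha : r < a) (hab : a < b) (hb : b < R)
    {w : ℂ} (hw : w ∈ annulus a b) :
    DifferentiableOn ℂ (smoothKernel p q a b w) (annulus a b) := by
  have main : ∀ t : ℝ, t = a ∨ t = b → DifferentiableOn ℂ (fun w₀ : ℂ =>
      ∮ ξ in C(0, t), kernelDiff p q w ξ / (ξ - w₀)) (annulus a b) := by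
    intro t ht
    have htA : sphere (0 : ℂ) t ⊆ annulus r R := by
      rcases ht with rfl | rfl <;> apply sphere_subset_annulus <;> linarith
    refine differentiableOn_circleIntegral (φ := fun ξ w₀ => kernelDiff p q w ξ / (ξ - w₀)) ?_
      (isOpen_annulus a b) ?_ fun ξ hξ => ?_
    · rcases ht with rfl | rfl <;> linarith
    · refine ContinuousOn.div ?_ (by fun_prop) ?_
      · refine (continuousOn_kernelDiff hp hq).comp
          (f := fun y : ℂ × ℂ => (w, y.1)) (by fun_prop) ?_
        rintro ⟨ξ, w₀⟩ ⟨hξ, hw₀⟩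
        exact ⟨annulus_subset_annulus ha.le hb.le hw, htA hξ,
          ne_of_mem_annulus_of_mem_sphere hw ht hξ⟩
      · rintro ⟨ξ, w₀⟩ ⟨hξ, hw₀⟩
        exact sub_ne_zero.2 (ne_of_mem_annulus_of_mem_sphere hw₀ ht hξ)
    · exact (differentiableOn_const _).div ((differentiableOn_const _).sub differentiableOn_id)
        fun w₀ hw₀ => sub_ne_zero.2 (ne_of_mem_annulus_of_mem_sphere hw₀ ht hξ)
  exact ((main b (Or.inr rfl)).sub (main a (Or.inl rfl))).const_mul _

/-- The integral operator whose kernel is the difference of two Cauchy kernels. -/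
noncomputable def diffTransform (p q : ℂ → ℂ) (a b ρ : ℝ) (f : ℂ → ℂ) (w₀ : ℂ) : ℂ :=
  (2 * Real.pi * I)⁻¹ * ∮ w in C(0, ρ), f w * smoothKernel p q a b w w₀

theorem differentiableOn_diffTransform (hp : IsConformalOn p (annulus r R))
    (hq : IsConformalOn q (annulus r R)) (hr : 0 ≤ r) (ha : r < a) (haρ : a < ρ) (hρb : ρ < b)
    (hb : b < R) (hf : ContinuousOn f (sphere 0 ρ)) :
    DifferentiableOn ℂ (diffTransform p q a b ρ f) (annulus a b) := by
  have hab := haρ.trans hρb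
  have hsub : sphere (0 : ℂ) ρ ⊆ annulus a b := sphere_subset_annulus haρ hρb
  refine (differentiableOn_circleIntegral (φ := fun w w₀ => f w * smoothKernel p q a b w w₀)
    (by linarith) (isOpen_annulus a b) ?_ fun w hw => ?_).const_mul _
  · exact (hf.comp continuousOn_fst fun x hx => hx.1).mul
      ((continuousOn_smoothKernel hp hq hr ha hab hb).mono (prod_mono_left hsub))
  · exact (differentiableOn_smoothKernel hp hq hr ha hab hb (hsub hw)).const_mul _

/-- The left side is holomorphic across the circle `|w₀| = ρ`, whereas each Cauchy transform on the
right jumps there. The jumps cancel. -/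
theorem diffTransform_eq (hp : IsConformalOn p (annulus r R))
    (hq : IsConformalOn q (annulus r R)) (hr : 0 ≤ r) (ha : r < a) (haρ : a < ρ) (hρb : ρ < b)
    (hb : b < R) (hf : ContinuousOn f (sphere 0 ρ)) {w₀ : ℂ} (hw₀ : w₀ ∈ annulus a b)
    (hne : ‖w₀‖ ≠ ρ) :
    diffTransform p q a b ρ f w₀ = cauchyTransform q ρ f (q w₀) - cauchyTransform p ρ f (p w₀) := by
  have hρ : 0 ≤ ρ := by linarith
  have hsub : sphere (0 : ℂ) ρ ⊆ annulus a b := sphere_subset_annulus haρ hρb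
  have hsub' : sphere (0 : ℂ) ρ ⊆ annulus r R := hsub.trans (annulus_subset_annulus ha.le hb.le)
  have hw₀A : w₀ ∈ annulus r R := annulus_subset_annulus ha.le hb.le hw₀
  have hnew : ∀ w ∈ sphere (0 : ℂ) ρ, w₀ ≠ w := by
    rintro w hw rfl
    exact hne (by simpa using hw)
  have hint : ∀ g : ℂ → ℂ, IsConformalOn g (annulus r R) →
      CircleIntegrable (fun w => f w * deriv g w / (g w - g w₀)) 0 ρ := by
    intro g hg
    refine ContinuousOn.circleIntegrable hρ ?_
    exact (hf.mul (hg.continuousOn_deriv.mono hsub')).div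
      ((hg.2.1.continuousOn.mono hsub').sub continuousOn_const)
      fun w hw => sub_ne_zero.2 fun h => hnew w hw (hg.2.2 (hsub' hw) hw₀A h).symm
  rw [diffTransform, cauchyTransform, cauchyTransform, ← mul_sub,
    ← circleIntegral.integral_sub (hint q hq) (hint p hp)]
  congr 1
  refine circleIntegral.integral_congr hρ fun w hw => ?_
  rw [smoothKernel_eq hp hq hr ha hb (hsub hw) hw₀ (hnew w hw), kernelDiff]
  ring

/-- The Fredholm alternative for the operator `diffTransform`. -/
theorem exists_sub_diffTransform_eq (hp : IsConformalOn p (annulus r R))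
    (hq : IsConformalOn q (annulus r R)) (hr : 0 ≤ r) (ha : r < a) (haρ : a < ρ) (hρb : ρ < b)
    (hb : b < R)
    (hinj : ∀ f : ℂ → ℂ, ContinuousOn f (sphere 0 ρ) →
      EqOn (diffTransform p q a b ρ f) f (sphere 0 ρ) → EqOn f 0 (sphere 0 ρ))
    {u : ℂ → ℂ} (hu : ContinuousOn u (sphere 0 ρ)) :
    ∃ f, ContinuousOn f (sphere 0 ρ) ∧
      ∀ w ∈ sphere (0 : ℂ) ρ, f w - diffTransform p q a b ρ f w = u w := by
  have hρ : 0 ≤ ρ := by linarith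
  have hsub : sphere (0 : ℂ) ρ ⊆ annulus a b := sphere_subset_annulus haρ hρb
  let θ : C(ℝ, sphere (0 : ℂ) ρ) :=
    ⟨fun t => ⟨circleMap 0 ρ t, circleMap_mem_sphere 0 hρ t⟩, by fun_prop⟩
  let k : C(sphere (0 : ℂ) ρ × ℝ, ℂ) :=
    ⟨fun x => (2 * Real.pi * I)⁻¹ *
      (deriv (circleMap 0 ρ) x.2 * smoothKernel p q a b (circleMap 0 ρ x.2) x.1), by
      refine continuous_const.mul (Continuous.mul ?_ ?_)
      · simp only [deriv_circleMap]
        fun_prop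
      · refine (continuousOn_smoothKernel hp hq hr ha (haρ.trans hρb) hb).comp_continuous
          (f := fun x : sphere (0 : ℂ) ρ × ℝ => (circleMap 0 ρ x.2, (x.1 : ℂ))) (by fun_prop) ?_
        exact fun x => ⟨hsub (circleMap_mem_sphere 0 hρ _), hsub x.1.2⟩⟩
  have hop : ∀ (F : BoundedContinuousFunction (sphere (0 : ℂ) ρ) ℂ) (f : ℂ → ℂ),
      (∀ w : sphere (0 : ℂ) ρ, f w = F w) → ∀ w : sphere (0 : ℂ) ρ,
      curveOperator θ k (2 * Real.pi) F w = diffTransform p q a b ρ f w := by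
    intro F f hfF w
    rw [curveOperator_apply, diffTransform, circleIntegral, ← intervalIntegral.integral_const_mul]
    refine intervalIntegral.integral_congr fun t _ => ?_
    change (2 * Real.pi * I)⁻¹ * (deriv (circleMap 0 ρ) t *
      smoothKernel p q a b (circleMap 0 ρ t) w) * F (θ t) = _
    rw [← hfF (θ t)]
    change _ = (2 * Real.pi * I)⁻¹ * (deriv (circleMap 0 ρ) t * (f (circleMap 0 ρ t) *
      smoothKernel p q a b (circleMap 0 ρ t) w))
    change _ * f (circleMap 0 ρ t) = _
    ring
  have hext : ∀ F : BoundedContinuousFunction (sphere (0 : ℂ) ρ) ℂ, ∃ f : ℂ → ℂ,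
      (∀ w : sphere (0 : ℂ) ρ, f w = F w) ∧ ContinuousOn f (sphere 0 ρ) := by
    intro F
    have h1 : ∀ w : sphere (0 : ℂ) ρ, Function.extend Subtype.val F 0 (w : ℂ) = F w :=
      fun w => Subtype.val_injective.extend_apply _ _ w
    refine ⟨_, h1, ?_⟩
    rw [continuousOn_iff_continuous_domRestrict]
    exact F.continuous.congr fun w => (h1 w).symm
  obtain ⟨F, hF⟩ := exists_sub_curveOperator_eq θ k (2 * Real.pi) (fun F hF => by
    obtain ⟨f, hf, hfc⟩ := hext F
    have h0 := hinj f hfc fun w hw => by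
      rw [← hop F f hf ⟨w, hw⟩, hF]
      exact (hf ⟨w, hw⟩).symm
    ext w
    rw [← hf w, h0 w.2]
    rfl) (BoundedContinuousFunction.mkOfCompact ⟨fun w => u w,
      (continuousOn_iff_continuous_domRestrict.1 hu)⟩)
  obtain ⟨f, hf, hfc⟩ := hext F
  refine ⟨f, hfc, fun w hw => ?_⟩
  have := congrArg (fun G : BoundedContinuousFunction (sphere (0 : ℂ) ρ) ℂ => G ⟨w, hw⟩) hF
  rw [← hop F f hf ⟨w, hw⟩, hf ⟨w, hw⟩]
  simpa using! this

end ConformalWelding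

/-! ### Splitting a function on the annulus between the two sides. -/

namespace ConformalWelding

open Metric Complex Bornology MeasureTheory

namespace Collar

variable {Hp Hq H : Set ℂ} {p q : ℂ → ℂ} {r R : ℝ}

theorem restrict_union (r : ℝ) {r' R' : ℝ} (h1 : r ≤ r') (h2 : r' < R') :
    (H ∪ p '' annulusIoc r r') ∪ p '' annulus r' R' = H ∪ p '' annulus r R' := by
  rw [union_assoc, ← image_union, annulusIoc_union_annulus h1 h2]

theorem differentiableOn_cauchyTransform_inside (h : Collar H p r R) {ρ : ℝ} (h1 : r < ρ)
    (h2 : ρ < R) {f : ℂ → ℂ} (hf : ContinuousOn f (sphere 0 ρ)) :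
    DifferentiableOn ℂ (cauchyTransform p ρ f) (H ∪ p '' annulus r ρ) := by
  refine (differentiableOn_cauchyTransform h.conf (h.pos.trans h1).le h1 h2 hf).mono ?_
  rintro z hz ⟨w, hw, rfl⟩
  have hwρ : ‖w‖ = ρ := by simpa using hw
  exact h.notMem_union_of_le (sphere_subset_annulus h1 h2 hw) hwρ.ge hz

theorem differentiableOn_cauchyTransform_outside (h : Collar H p r R) {ρ : ℝ} (h1 : r < ρ)
    (h2 : ρ < R) {f : ℂ → ℂ} (hf : ContinuousOn f (sphere 0 ρ)) :
    DifferentiableOn ℂ (cauchyTransform p ρ f) (H ∪ p '' annulusIoc r ρ)ᶜ := by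
  refine (differentiableOn_cauchyTransform h.conf (h.pos.trans h1).le h1 h2 hf).mono ?_
  rintro z hz ⟨w, hw, rfl⟩
  have hwρ : ‖w‖ = ρ := by simpa using hw
  exact hz (Or.inr (mem_image_of_mem p ⟨by rw [hwρ]; exact h1, hwρ.le⟩))

/-- A fixed point `f` extends to the holomorphic function `F`. Write `C` for Cauchy transforms of
`F`. For `ρ < |w| < ρ'` one has `F = C_{q,ρ} ∘ q - C_{p,ρ} ∘ p` and, by the jump formula, `F =
C_{p,ρ'} ∘ p - C_{p,ρ} ∘ p`. Thus `C_{p,ρ'}` on the inner side and `C_{q,ρ}` on the outer side glue,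
and both vanish by Liouville. The jump formula for `q` then glues `C_{q,ρ'}` to `-C_{p,ρ}` with the
roles of the collars exchanged, so these vanish too and `F = 0`. -/
theorem eqOn_zero_of_diffTransform_eq (hp : Collar Hp p r R) (hq : Collar Hq q r R)
    {a b ρ : ℝ} (ha : r < a) (haρ : a < ρ) (hρb : ρ < b) (hb : b < R) {f : ℂ → ℂ}
    (hf : ContinuousOn f (sphere 0 ρ)) (hE : EqOn (diffTransform p q a b ρ f) f (sphere 0 ρ)) :
    EqOn f 0 (sphere 0 ρ) := by
  have hr := hp.pos.le
  have hρ0 : 0 < ρ := by linarith [hp.pos]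
  have hrρ : r < ρ := ha.trans haρ
  have hρR : ρ < R := hρb.trans hb
  set F := diffTransform p q a b ρ f with hF
  have hFd : DifferentiableOn ℂ F (annulus a b) :=
    differentiableOn_diffTransform hp.conf hq.conf hr ha haρ hρb hb hf
  obtain ⟨ρ', h1, h2⟩ := exists_between hρb
  have hρ'R : ρ' < R := h2.trans hb
  have hFf : EqOn f F (sphere 0 ρ) := hE.symm
  have hFc : ContinuousOn F (sphere 0 ρ) :=
    hFd.continuousOn.mono (sphere_subset_annulus haρ hρb)
  have hFc' : ContinuousOn F (sphere 0 ρ') :=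
    hFd.continuousOn.mono (sphere_subset_annulus (haρ.trans h1) h2)
  have hsub : annulus a b ⊆ annulus r R := annulus_subset_annulus ha.le hb.le
  have hpab := hp.conf.mono (isOpen_annulus a b) hsub
  have hqab := hq.conf.mono (isOpen_annulus a b) hsub
  have hjump : ∀ g : ℂ → ℂ, IsConformalOn g (annulus a b) → ∀ w ∈ annulus ρ ρ',
      cauchyTransform g ρ' F (g w) - cauchyTransform g ρ F (g w) = F w := fun g hg w hw =>
    cauchyTransform_sub hg (hr.trans ha.le) haρ h2 hFd hw
  have hFeq : ∀ w ∈ annulus ρ ρ',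
      F w = cauchyTransform q ρ F (q w) - cauchyTransform p ρ F (p w) := by
    intro w hw
    rw [← cauchyTransform_congr hρ0.le hFf, ← cauchyTransform_congr hρ0.le hFf]
    exact diffTransform_eq hp.conf hq.conf hr ha haρ hρb hb hf ⟨haρ.trans hw.1, hw.2.trans h2⟩
      hw.1.ne'
  have hcp := hp.restrict hrρ.le h1 hρ'R.le
  have hcq := hq.restrict hrρ.le h1 hρ'R.le
  have hL := hcp.liouville hcq (V := cauchyTransform p ρ' F) (g := cauchyTransform q ρ F) (l := 0)
    (by
      rw [restrict_union r hrρ.le h1]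
      exact hp.differentiableOn_cauchyTransform_inside (hrρ.trans h1) hρ'R hFc')
    (hq.differentiableOn_cauchyTransform_outside hrρ hρR hFc)
    (fun w hw => by linear_combination hjump p hpab w hw + hFeq w hw)
    (tendsto_cauchyTransform hq.conf hρ0.le hrρ hρR hFc)
  have hL' := hcq.liouville hcp (V := cauchyTransform q ρ' F)
    (g := fun z => -cauchyTransform p ρ F z) (l := 0)
    (by
      rw [restrict_union r hrρ.le h1]
      exact hq.differentiableOn_cauchyTransform_inside (hrρ.trans h1) hρ'R hFc')
    (hp.differentiableOn_cauchyTransform_outside hrρ hρR hFc).neg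
    (fun w hw => by
      have h3 := hL.2 _ (hcq.mapsTo_compl hw)
      linear_combination hjump q hqab w hw + hFeq w hw + 2 * h3)
    (by simpa using (tendsto_cauchyTransform hp.conf hρ0.le hrρ hρR hFc).neg)
  have hzero : ∀ w ∈ annulus ρ ρ', F w = 0 := by
    intro w hw
    have h3 := hL.2 _ (hcq.mapsTo_compl hw)
    have h4 := hL'.2 _ (hcp.mapsTo_compl hw)
    linear_combination hFeq w hw + h3 + h4
  obtain ⟨w₁, hw₁⟩ := exists_mem_annulus hρ0 h1
  have hid : EqOn F (fun _ => 0) (annulus a b) := by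
    refine (hFd.analyticOnNhd (isOpen_annulus a b)).eqOn_of_preconnected_of_eventuallyEq
      (fun z _ => analyticAt_const) (isPreconnected_annulus (hp.pos.trans ha))
      (annulus_subset_annulus haρ.le h2.le hw₁) ?_
    filter_upwards [(isOpen_annulus ρ ρ').mem_nhds hw₁] with w hw using hzero w hw
  intro w hw
  rw [hFf hw]
  exact hid (sphere_subset_annulus haρ hρb hw)

/-- Every holomorphic function on the annulus is the difference of a function on the inner side of
one collar and a function on the outer side of another one. -/
theorem exists_decomposition (hp : Collar Hp p r R) (hq : Collar Hq q r R) {ρ ρ' : ℝ}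
    (h1 : r < ρ) (h2 : ρ < ρ') (h3 : ρ' < R) {u : ℂ → ℂ}
    (hu : DifferentiableOn ℂ u (annulus r R)) :
    ∃ V g : ℂ → ℂ, DifferentiableOn ℂ V (Hp ∪ p '' annulus r ρ') ∧
      DifferentiableOn ℂ g (Hq ∪ q '' annulusIoc r ρ)ᶜ ∧ Tendsto g (cobounded ℂ) (𝓝 0) ∧
      ∀ w ∈ annulus ρ ρ', u w = V (p w) - g (q w) := by
  obtain ⟨a, ha, haρ⟩ := exists_between h1
  obtain ⟨b, hρb, hb⟩ := exists_between h3
  have hr := hp.pos.le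
  have hρ0 : 0 < ρ := hp.pos.trans h1
  have hsub : annulus a b ⊆ annulus r R := annulus_subset_annulus ha.le hb.le
  -- With `T` for `diffTransform`, solve `f - T f = u` on the circle `|w| = ρ`. Then `F = u + T f`
  -- is a holomorphic extension of `f`.
  obtain ⟨f, hfc, hf⟩ := exists_sub_diffTransform_eq hp.conf hq.conf hr ha haρ (h2.trans hρb) hb
    (fun f hf hE => hp.eqOn_zero_of_diffTransform_eq hq ha haρ (h2.trans hρb) hb hf hE)
    (hu.continuousOn.mono (sphere_subset_annulus h1 (h2.trans h3)))
  set F := fun w => u w + diffTransform p q a b ρ f w with hF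
  have hFd : DifferentiableOn ℂ F (annulus a b) :=
    (hu.mono hsub).add
      (differentiableOn_diffTransform hp.conf hq.conf hr ha haρ (h2.trans hρb) hb hfc)
  have hFf : EqOn f F (sphere 0 ρ) := fun w hw => by simp only [hF]; linear_combination hf w hw
  have hFc : ContinuousOn F (sphere 0 ρ) :=
    hFd.continuousOn.mono (sphere_subset_annulus haρ (h2.trans hρb))
  have hFc' : ContinuousOn F (sphere 0 ρ') :=
    hFd.continuousOn.mono (sphere_subset_annulus (haρ.trans h2) hρb)
  -- The jump formula turns `V ∘ p` into `F + C_{p,ρ} ∘ p`. Subtracting `C_{q,ρ} ∘ q` leaves `F - T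
  -- f = u`.
  refine ⟨cauchyTransform p ρ' F, cauchyTransform q ρ F,
    hp.differentiableOn_cauchyTransform_inside (h1.trans h2) h3 hFc',
    hq.differentiableOn_cauchyTransform_outside h1 (h2.trans h3) hFc,
    tendsto_cauchyTransform hq.conf hρ0.le h1 (h2.trans h3) hFc, fun w hw => ?_⟩
  have h4 := cauchyTransform_sub (hp.conf.mono (isOpen_annulus a b) hsub) (hr.trans ha.le) haρ hρb
    hFd hw
  have h5 := diffTransform_eq hp.conf hq.conf hr ha haρ (h2.trans hρb) hb hfc
    ⟨haρ.trans hw.1, hw.2.trans hρb⟩ hw.1.ne'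
  rw [cauchyTransform_congr hρ0.le hFf, cauchyTransform_congr hρ0.le hFf] at h5
  have h6 : F w = u w + diffTransform p q a b ρ f w := rfl
  linear_combination -h5 - h4 - h6

end Collar

end ConformalWelding

/-! ### The glued map is a bijection of the glued sphere. -/

namespace ConformalWelding

open Metric Complex Bornology

/-- The function `w ↦ g (1 / w)` has a removable singularity at `0` with value `0`, and the limit is
its derivative there. -/
theorem exists_tendsto_mul {K : Set ℂ} (hK : IsClosed K) (hKb : IsBounded K) {g : ℂ → ℂ}
    (hg : DifferentiableOn ℂ g Kᶜ) (hlim : Tendsto g (cobounded ℂ) (𝓝 0)) :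
    ∃ l, Tendsto (fun z => z * g z) (cobounded ℂ) (𝓝 l) := by
  set k := Function.update (fun w : ℂ => g w⁻¹) 0 0 with hk
  have hk0 : k 0 = 0 := Function.update_self _ _ _
  have hkne : ∀ w ≠ 0, k w = g w⁻¹ := fun w hw => Function.update_of_ne hw _ _
  have hcont : ContinuousAt k 0 := by
    rw [continuousAt_update_same]
    exact hlim.comp tendsto_inv_nhdsNE_cobounded
  have hdiff : ∀ᶠ w in 𝓝[≠] (0 : ℂ), DifferentiableAt ℂ k w := by
    have h1 : ∀ᶠ z in cobounded ℂ, z ∈ Kᶜ := isBounded_def.1 hKb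
    filter_upwards [tendsto_inv_nhdsNE_cobounded.eventually h1, self_mem_nhdsWithin] with w hw hw0
    have h2 : DifferentiableAt ℂ (fun w : ℂ => g w⁻¹) w :=
      (hg.differentiableAt (hK.isOpen_compl.mem_nhds hw)).comp w (differentiableAt_inv hw0)
    refine h2.congr_of_eventuallyEq ?_
    filter_upwards [eventually_ne_nhds hw0] with y hy using hkne y hy
  have hd := (analyticAt_of_differentiable_on_punctured_nhds_of_continuousAt hdiff
    hcont).differentiableAt.hasDerivAt
  rw [hasDerivAt_iff_tendsto_slope] at hd
  refine ⟨_, (hd.comp tendsto_inv_cobounded_nhdsNE).congr fun z => ?_⟩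
  simp only [Function.comp_apply, slope_def_field, hk0, sub_zero, div_inv_eq_mul]
  rcases eq_or_ne z 0 with rfl | hz
  · simp
  · rw [hkne _ (inv_ne_zero hz), inv_inv, mul_comm]

/-- A pair of holomorphic functions on the inner side of the first collar and on the outer side of
the second one that agree on the annulus and are normalized at infinity. -/
structure GluedMap (Hp Hq : Set ℂ) (p q : ℂ → ℂ) (r R : ℝ) (V ψ : ℂ → ℂ) : Prop where
  inner : Collar Hp p r R
  outer : Collar Hq q r R
  diff_inner : DifferentiableOn ℂ V (Hp ∪ p '' annulus r R)
  diff_outer : DifferentiableOn ℂ ψ Hqᶜ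
  glue : ∀ w ∈ annulus r R, V (p w) = ψ (q w)
  lim : Tendsto (fun z => ψ z - z) (cobounded ℂ) (𝓝 0)

namespace GluedMap

variable {Hp Hq : Set ℂ} {p q V ψ : ℂ → ℂ} {r R : ℝ}

theorem restrict (h : GluedMap Hp Hq p q r R V ψ) {r' R' : ℝ} (h1 : r ≤ r') (h2 : r' < R')
    (h3 : R' ≤ R) :
    GluedMap (Hp ∪ p '' annulusIoc r r') (Hq ∪ q '' annulusIoc r r') p q r' R' V ψ where
  inner := h.inner.restrict h1 h2 h3
  outer := h.outer.restrict h1 h2 h3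
  diff_inner := h.diff_inner.mono (by
    rw [Collar.restrict_union r h1 h2]
    exact union_subset_union_right _ (image_mono (annulus_subset_annulus le_rfl h3)))
  diff_outer := h.diff_outer.mono (compl_subset_compl.2 subset_union_left)
  glue := fun w hw => h.glue w (annulus_subset_annulus h1 h3 hw)
  lim := h.lim

theorem tendsto_div (h : GluedMap Hp Hq p q r R V ψ) (c d : ℂ) :
    Tendsto (fun z => (ψ z - c) / (z - d)) (cobounded ℂ) (𝓝 1) := by
  have h1 : Tendsto (fun z : ℂ => (z - d)⁻¹) (cobounded ℂ) (𝓝 0) :=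
    tendsto_inv₀_cobounded.comp (tendsto_sub_const_cobounded d)
  have h2 : Tendsto (fun z => 1 + ((ψ z - z) + (d - c)) * (z - d)⁻¹) (cobounded ℂ) (𝓝 1) := by
    simpa using ((h.lim.add_const (d - c)).mul h1).const_add 1
  refine h2.congr' ?_
  filter_upwards [eventually_ne_cobounded d] with z hz
  have := sub_ne_zero.2 hz
  field_simp
  ring

theorem eventually_ne (h : GluedMap Hp Hq p q r R V ψ) (c : ℂ) : ∀ᶠ z in cobounded ℂ, ψ z ≠ c := by
  filter_upwards [(h.tendsto_div c 0).eventually_ne one_ne_zero] with z hz hc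
  rw [hc, sub_self, zero_div] at hz
  exact hz rfl

theorem isBounded_outer (h : GluedMap Hp Hq p q r R V ψ) : IsBounded Hq := by
  obtain ⟨s, h1, h2⟩ := exists_between h.inner.lt
  exact (h.outer.isCompact_union s h1 h2).isBounded.subset subset_union_left

theorem exists_tendsto (h : GluedMap Hp Hq p q r R V ψ) {g : ℂ → ℂ} (hg : DifferentiableOn ℂ g Hqᶜ)
    (hlim : Tendsto g (cobounded ℂ) (𝓝 0)) (c : ℂ) :
    ∃ l, Tendsto (fun z => (ψ z - c) * g z) (cobounded ℂ) (𝓝 l) := by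
  obtain ⟨l, hl⟩ := exists_tendsto_mul h.outer.isClosed h.isBounded_outer hg hlim
  refine ⟨l, ?_⟩
  have := hl.add ((h.lim.sub_const c).mul hlim)
  rw [mul_zero, add_zero] at this
  exact this.congr fun z => by ring

theorem eq_zero_of_eventually (h : GluedMap Hp Hq p q r R V ψ) {g : ℂ → ℂ}
    (hg : DifferentiableOn ℂ g Hqᶜ) (h0 : ∀ᶠ z in cobounded ℂ, g z = 0) :
    ∀ z ∈ Hqᶜ, g z = 0 := by
  have hopen : IsOpen Hqᶜ := h.outer.isClosed.isOpen_compl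
  have hb : ∀ᶠ z in cobounded ℂ, z ∈ Hqᶜ := isBounded_def.1 h.isBounded_outer
  obtain ⟨N, -, hN⟩ := hasBasis_cobounded_norm.mem_iff.1 (h0.and hb)
  obtain ⟨z₁, hz₁⟩ : ∃ z₁ : ℂ, N < ‖z₁‖ := ⟨((|N| + 1 : ℝ) : ℂ), by
    rw [Complex.norm_real, Real.norm_of_nonneg (by positivity)]
    linarith [le_abs_self N]⟩
  refine (hg.analyticOnNhd hopen).eqOn_of_preconnected_of_eventuallyEq
    (fun z _ => analyticAt_const) h.outer.isPreconnected_compl (hN hz₁.le).2 ?_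
  filter_upwards [(isOpen_lt continuous_const continuous_norm).mem_nhds hz₁] with z hz
  exact (hN (le_of_lt hz)).1

/-- By hypothesis `V₀ - 1 / (z - z₀)` and `g₀` glue to a function whose only pole is simple and at
`z₀`. Multiplied by the glued map minus `V z₀`, it becomes holomorphic with a finite limit at `∞`,
hence a constant `l`. If `l = 0`, then `g₀ = 0` and `(z - z₀) * V₀ z = 1` throughout, absurd at
`z₀`. A second point with value `V z₀` would force `l = 0`. -/
theorem ne_of_mem_inner_aux (h : GluedMap Hp Hq p q r R V ψ) {z₀ : ℂ} (hz₀ : z₀ ∈ Hp)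
    {V₀ g₀ : ℂ → ℂ} (hV₀ : DifferentiableOn ℂ V₀ (Hp ∪ p '' annulus r R))
    (hg₀ : DifferentiableOn ℂ g₀ Hqᶜ) (hlim : Tendsto g₀ (cobounded ℂ) (𝓝 0))
    (hdec : ∀ w ∈ annulus r R, (p w - z₀)⁻¹ = V₀ (p w) - g₀ (q w)) :
    (∀ z ∈ Hp ∪ p '' annulus r R, z ≠ z₀ → V z ≠ V z₀) ∧ ∀ z ∈ Hqᶜ, ψ z ≠ V z₀ := by
  have hz₀U : z₀ ∈ Hp ∪ p '' annulus r R := Or.inl hz₀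
  have hne : ∀ w ∈ annulus r R, p w ≠ z₀ := fun w hw hpw => h.inner.notMem w hw (hpw ▸ hz₀)
  obtain ⟨l, hl⟩ := h.exists_tendsto hg₀ hlim (V z₀)
  have hconst := h.inner.liouville h.outer (V := fun z => (V z - V z₀) * V₀ z - dslope V z₀ z)
    (g := fun z => (ψ z - V z₀) * g₀ z) (l := l)
    (((h.diff_inner.sub_const _).mul hV₀).sub
      ((differentiableOn_dslope (h.inner.isOpen_union.mem_nhds hz₀U)).2 h.diff_inner))
    ((h.diff_outer.sub_const _).mul hg₀) (fun w hw => by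
      have h1 := hdec w hw
      rw [dslope_of_ne _ (hne w hw), slope_def_field, div_eq_mul_inv, h1, ← h.glue w hw]
      ring) hl
  have hl0 : l ≠ 0 := by
    rintro rfl
    have hg0 := h.eq_zero_of_eventually hg₀ (by
      filter_upwards [h.eventually_ne (V z₀), isBounded_def.1 h.isBounded_outer] with z hz hzH
      exact (mul_eq_zero.1 (hconst.2 z hzH)).resolve_left (sub_ne_zero.2 hz))
    have := (h.inner.liouville h.outer (V := fun z => (z - z₀) * V₀ z - 1) (g := fun _ => 0) (l := 0)
      (((differentiableOn_id.sub_const _).mul hV₀).sub_const _) (differentiableOn_const _)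
      (fun w hw => by
        have h1 := hdec w hw
        rw [hg0 _ (h.outer.mapsTo_compl hw), sub_zero] at h1
        rw [← h1, mul_inv_cancel₀ (sub_ne_zero.2 (hne w hw)), sub_self])
      tendsto_const_nhds).1 z₀ hz₀U
    simp at this
  refine ⟨fun z hz hzz hVz => hl0 ?_, fun z hz hψz => hl0 ?_⟩
  · have := hconst.1 z hz
    simp only [dslope_of_ne _ hzz, slope_def_field, hVz, sub_self, zero_mul, zero_div] at this
    exact this.symm
  · have := hconst.2 z hz
    simp only [hψz, sub_self, zero_mul] at this
    exact this.symm

theorem ne_of_mem_inner (h : GluedMap Hp Hq p q r R V ψ) {z₀ : ℂ} (hz₀ : z₀ ∈ Hp) :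
    (∀ z ∈ Hp ∪ p '' annulus r R, z ≠ z₀ → V z ≠ V z₀) ∧ ∀ z ∈ Hqᶜ, ψ z ≠ V z₀ := by
  have hne : ∀ w ∈ annulus r R, p w ≠ z₀ := fun w hw hpw => h.inner.notMem w hw (hpw ▸ hz₀)
  obtain ⟨ρ, h1, h1'⟩ := exists_between h.inner.lt
  obtain ⟨ρ', h2, h3⟩ := exists_between h1'
  obtain ⟨V₀, g₀, hV₀, hg₀, hlim, hdec⟩ := h.inner.exists_decomposition h.outer h1 h2 h3
    (u := fun w => (p w - z₀)⁻¹)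
    ((h.inner.conf.2.1.sub_const _).inv fun w hw => sub_ne_zero.2 (hne w hw))
  -- The decomposition lives only on the thinner ring `ρ < |w| < ρ'`. Points of the remaining rings
  -- are reached from the other side through the gluing relation.
  have key := (h.restrict h1.le h2 h3.le).ne_of_mem_inner_aux (Or.inl hz₀)
    (by rwa [Collar.restrict_union r h1.le h2]) hg₀ hlim hdec
  rw [Collar.restrict_union r h1.le h2] at key
  constructor
  · rintro z (hz | ⟨w, hw, rfl⟩) hzz
    · exact key.1 z (Or.inl hz) hzz
    · rcases lt_or_ge ‖w‖ ρ' with h4 | h4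
      · exact key.1 _ (Or.inr (mem_image_of_mem p ⟨hw.1, h4⟩)) hzz
      · rw [h.glue w hw]
        refine key.2 _ ?_
        rintro (h5 | ⟨w', hw', h5⟩)
        · exact h.outer.notMem w hw h5
        · rw [h.outer.conf.2.2 (annulusIoc_subset_annulus h1' hw') hw h5] at hw'
          linarith [hw'.2]
  · intro z hz
    by_cases hz' : z ∈ q '' annulusIoc r ρ
    · obtain ⟨w, hw, rfl⟩ := hz'
      have hwA := annulusIoc_subset_annulus h1' hw
      rw [← h.glue w hwA]
      exact key.1 _ (Or.inr (mem_image_of_mem p ⟨hw.1, hw.2.trans_lt h2⟩)) (hne w hwA)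
    · exact key.2 z (by rintro (h5 | h5); exacts [hz h5, hz' h5])

/-- A ring point `p w` becomes a point of the hull once the annulus is absorbed up to some radius `s
> |w|`. -/
theorem injOn_inner (h : GluedMap Hp Hq p q r R V ψ) : InjOn V (Hp ∪ p '' annulus r R) := by
  intro z hz z₀ hz₀ hVz
  by_contra hzz
  rcases hz₀ with hz₀ | ⟨w, hw, rfl⟩
  · exact (h.ne_of_mem_inner hz₀).1 z hz hzz hVz
  · obtain ⟨s, h1, h2⟩ := exists_between hw.2
    refine ((h.restrict (hw.1.trans h1).le h2 le_rfl).ne_of_mem_inner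
      (Or.inr (mem_image_of_mem p ⟨hw.1, h1.le⟩))).1 z ?_ hzz hVz
    rwa [Collar.restrict_union r (hw.1.trans h1).le h2]

/-- The pole is now on the outer side, so the constant is `l + 1`, the slope of `ψ` tending to `1`
at `∞`. If `ψ z = ψ z₀`, the constant is `0` and `(y - z₀) * g₀ y = -1` on the outer side, absurd at
`y = z₀`. -/
theorem ne_of_notMem_outer (h : GluedMap Hp Hq p q r R V ψ) {z₀ : ℂ} (hz₀ : z₀ ∉ Hq)
    (hz₀' : z₀ ∉ q '' annulus r R) {z : ℂ} (hz : z ∉ Hq) (hz' : z ∉ q '' annulus r R)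
    (hzz : z ≠ z₀) : ψ z ≠ ψ z₀ := by
  intro hψz
  have hne : ∀ w ∈ annulus r R, q w ≠ z₀ := fun w hw hqw => hz₀' ⟨w, hw, hqw⟩
  obtain ⟨ρ, h1, h1'⟩ := exists_between h.inner.lt
  obtain ⟨ρ', h2, h3⟩ := exists_between h1'
  obtain ⟨V₀, g₀, hV₀, hg₀, hlim, hdec⟩ := h.inner.exists_decomposition h.outer h1 h2 h3
    (u := fun w => (q w - z₀)⁻¹)
    ((h.outer.conf.2.1.sub_const _).inv fun w hw => sub_ne_zero.2 (hne w hw))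
  have h' := h.restrict h1.le h2 h3.le
  have hout : ∀ y, y ∉ Hq → y ∉ q '' annulus r R → y ∈ (Hq ∪ q '' annulusIoc r ρ)ᶜ := by
    rintro y hy hy' (h5 | h5)
    exacts [hy h5, hy' (image_mono (annulusIoc_subset_annulus h1') h5)]
  obtain ⟨l, hl⟩ := h'.exists_tendsto hg₀ hlim (ψ z₀)
  have hopen := h'.outer.isClosed.isOpen_compl
  have hconst := h'.inner.liouville h'.outer (V := fun z => (V z - ψ z₀) * V₀ z)
    (g := fun z => (ψ z - ψ z₀) * g₀ z + dslope ψ z₀ z) (l := l + 1)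
    ((h'.diff_inner.sub_const _).mul (by rwa [Collar.restrict_union r h1.le h2]))
    (((h'.diff_outer.sub_const _).mul hg₀).add
      ((differentiableOn_dslope (hopen.mem_nhds (hout z₀ hz₀ hz₀'))).2 h'.diff_outer))
    (fun w hw => by
      have h4 := hdec w hw
      rw [dslope_of_ne _ (hne w (annulus_subset_annulus h1.le h3.le hw)), slope_def_field,
        div_eq_mul_inv, h4, ← h'.glue w hw]
      ring)
    (hl.add ((h'.tendsto_div (ψ z₀) z₀).congr' (by
      filter_upwards [eventually_ne_cobounded z₀] with y hy
      rw [dslope_of_ne _ hy, slope_def_field])))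
  have hl0 : l + 1 = 0 := by
    have := hconst.2 z (hout z hz hz')
    simp only [dslope_of_ne _ hzz, slope_def_field, hψz, sub_self, zero_mul, zero_div,
      add_zero] at this
    exact this.symm
  have hzero := h'.eq_zero_of_eventually (g := fun y => (y - z₀) * g₀ y + 1)
    (((differentiableOn_id.sub_const _).mul hg₀).add_const _) (by
      filter_upwards [h'.eventually_ne (ψ z₀), isBounded_def.1 h'.isBounded_outer,
        eventually_ne_cobounded z₀] with y hy hyH hyz
      have h4 := hconst.2 y hyH
      rw [hl0] at h4
      simp only [dslope_of_ne _ hyz, slope_def_field] at h4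
      have h5 := sub_ne_zero.2 hy
      have h6 := sub_ne_zero.2 hyz
      field_simp at h4
      rw [mul_zero] at h4
      linear_combination (mul_eq_zero.1 h4).resolve_left h5) z₀ (hout z₀ hz₀ hz₀')
  simp at hzero

theorem injOn_outer (h : GluedMap Hp Hq p q r R V ψ) : InjOn ψ Hqᶜ := by
  have key : ∀ w ∈ annulus r R, ∀ z ∈ Hqᶜ, ψ z = ψ (q w) → z = q w := by
    intro w hw z hz hψ
    rw [← h.glue w hw] at hψ
    obtain ⟨s, h1, h2⟩ := exists_between hw.2
    have h3 := (h.restrict (hw.1.trans h1).le h2 le_rfl).ne_of_mem_inner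
      (Or.inr (mem_image_of_mem p ⟨hw.1, h1.le⟩))
    by_cases hz' : z ∈ q '' annulusIoc r s
    · obtain ⟨w', hw', rfl⟩ := hz'
      have hw'A := annulusIoc_subset_annulus h2 hw'
      rw [← h.glue w' hw'A] at hψ
      have h4 := h.injOn_inner (Or.inr (mem_image_of_mem p hw'A))
        (Or.inr (mem_image_of_mem p hw)) hψ
      rw [h.inner.conf.2.2 hw'A hw h4]
    · exact absurd hψ (h3.2 z (by rintro (h5 | h5); exacts [hz h5, hz' h5]))
  intro z hz z₀ hz₀ hψ
  by_cases h1 : z₀ ∈ q '' annulus r R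
  · obtain ⟨w, hw, rfl⟩ := h1
    exact key w hw z hz hψ
  by_cases h2 : z ∈ q '' annulus r R
  · obtain ⟨w, hw, rfl⟩ := h2
    exact (key w hw z₀ hz₀ hψ.symm).symm
  by_contra hzz
  exact h.ne_of_notMem_outer hz₀ h1 hz h2 hzz hψ

/-- If neither `V` on `Hp` nor `ψ` took the value `c`, the reciprocal of the glued map minus `c`
would be holomorphic everywhere and zero at `∞`, hence zero by Liouville. -/
theorem image_inner (h : GluedMap Hp Hq p q r R V ψ) : V '' Hp = (ψ '' Hqᶜ)ᶜ := by
  ext c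
  constructor
  · rintro ⟨z₀, hz₀, rfl⟩ ⟨z, hz, hψ⟩
    exact (h.ne_of_mem_inner hz₀).2 z hz hψ
  · intro hc
    by_contra hc'
    have h1 : ∀ z ∈ Hqᶜ, ψ z - c ≠ 0 := fun z hz h0 => hc ⟨z, hz, sub_eq_zero.1 h0⟩
    have h2 : ∀ z ∈ Hp ∪ p '' annulus r R, V z - c ≠ 0 := by
      rintro z (hz | ⟨w, hw, rfl⟩) h0
      · exact hc' ⟨z, hz, sub_eq_zero.1 h0⟩
      · rw [h.glue w hw] at h0
        exact h1 _ (h.outer.mapsTo_compl hw) h0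
    obtain ⟨w, hw⟩ := exists_mem_annulus h.inner.pos h.inner.lt
    have hlim : Tendsto (fun z => (ψ z - c)⁻¹) (cobounded ℂ) (𝓝 0) := by
      have h3 := ((h.tendsto_div c 0).inv₀ one_ne_zero).mul (tendsto_inv₀_cobounded (α := ℂ))
      rw [mul_zero] at h3
      refine h3.congr' ?_
      filter_upwards [eventually_ne_cobounded (0 : ℂ)] with z hz
      rw [sub_zero, inv_div, div_mul_eq_mul_div, mul_inv_cancel₀ hz, one_div]
    have := (h.inner.liouville h.outer (V := fun z => (V z - c)⁻¹) (g := fun z => (ψ z - c)⁻¹)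
      ((h.diff_inner.sub_const _).inv h2) ((h.diff_outer.sub_const _).inv h1)
      (fun w hw => by rw [h.glue w hw]) hlim).2 _ (h.outer.mapsTo_compl hw)
    exact inv_ne_zero (h1 _ (h.outer.mapsTo_compl hw)) this

end GluedMap

/-- **Conformal welding** of the inner side of a collar and the outer side of another one. -/
theorem Collar.exists_gluedMap {Hp Hq : Set ℂ} {p q : ℂ → ℂ} {r R : ℝ} (hp : Collar Hp p r R)
    (hq : Collar Hq q r R) {ρ ρ' : ℝ} (h1 : r < ρ) (h2 : ρ < ρ') (h3 : ρ' < R) :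
    ∃ V ψ : ℂ → ℂ, GluedMap (Hp ∪ p '' annulusIoc r ρ) (Hq ∪ q '' annulusIoc r ρ) p q ρ ρ' V ψ := by
  -- Splitting `u = q` gives `V ∘ p = q + g ∘ q`, so the outer function is `z + g z`, with its
  -- simple pole at `∞`.
  obtain ⟨V, g, hV, hg, hlim, hdec⟩ := hp.exists_decomposition hq h1 h2 h3 hq.conf.2.1
  refine ⟨V, fun z => z + g z, hp.restrict h1.le h2 h3.le, hq.restrict h1.le h2 h3.le, ?_,
    differentiableOn_id.add hg, fun w hw => by linear_combination -hdec w hw, ?_⟩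
  · rwa [Collar.restrict_union r h1.le h2]
  · simpa using hlim

end ConformalWelding

/-! ### The two collars: the exterior map of `H` and the circle map `W`. -/

namespace ConformalWelding

open Metric Complex Bornology

theorem exteriorDisc_eq : exteriorDisc = (closedBall (0 : ℂ) 1)ᶜ := by
  ext z
  change 1 < ‖z‖ ↔ _
  simp

theorem unitCircle_eq : unitCircle = sphere (0 : ℂ) 1 := by
  ext z
  change ‖z‖ = 1 ↔ _
  simp

/-- The exterior map of a hull defines a collar of the hull. -/
theorem _root_.IsExteriorMap.collar {K : Set ℂ} {ψ : ℂ → ℂ} (h : IsExteriorMap K ψ)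
    (hK : IsInteriorHull K) {R : ℝ} (hR : 1 < R) : Collar K ψ 1 R := by
  have hconf := h.isConformalOn
  have hcont : ContinuousOn ψ exteriorDisc := h.1.continuousOn
  have hsub : ∀ s, annulus 1 s ⊆ exteriorDisc := fun s w hw => hw.1
  refine ⟨one_pos, hR, hconf.mono (isOpen_annulus _ _) (hsub R),
    fun w hw => h.2.1.mapsTo (hsub R hw), fun s hs _ => ?_, fun s hs _ => ?_, hK.2.2.2⟩
  · have hcompl : K ∪ ψ '' annulus 1 s = (ψ '' {w | s ≤ ‖w‖})ᶜ := by
      ext z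
      constructor
      · rintro (hz | ⟨w, hw, rfl⟩) ⟨w', hw', h1⟩
        · exact h.2.1.mapsTo (show w' ∈ exteriorDisc from hs.trans_le hw') (h1 ▸ hz)
        · rw [h.2.1.injOn (show w' ∈ exteriorDisc from hs.trans_le hw') (hsub s hw) h1] at hw'
          exact absurd hw.2 (not_lt.2 hw')
      · intro hz
        by_cases hzK : z ∈ K
        · exact Or.inl hzK
        · obtain ⟨w, hw, rfl⟩ := h.2.1.surjOn hzK
          exact Or.inr ⟨w, ⟨hw, not_le.1 fun hle => hz ⟨w, hle, rfl⟩⟩, rfl⟩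
    -- Since `ψ → ∞` at `∞`, only a compact part of `{|w| ≥ s}` has image near `z`.
    rw [hcompl, isOpen_iff_mem_nhds]
    intro z hz
    obtain ⟨N, -, hN⟩ := hasBasis_cobounded_norm.mem_iff.1
      (tendsto_norm_atTop_iff_cobounded.2 h.tendsto_cobounded |>.eventually_gt_atTop (‖z‖ + 1))
    have hcpt : IsCompact (ψ '' (closedBall 0 N ∩ {w | s ≤ ‖w‖})) := by
      refine ((isCompact_closedBall 0 N).inter_right
        (isClosed_le continuous_const continuous_norm)).image_of_continuousOn (hcont.mono ?_)
      exact fun w hw => hs.trans_le hw.2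
    filter_upwards [hcpt.isClosed.isOpen_compl.mem_nhds fun ⟨w, hw, hwz⟩ => hz ⟨w, hw.2, hwz⟩,
      ball_mem_nhds z one_pos] with y hy hyz
    rintro ⟨w, hw, rfl⟩
    refine hy ⟨w, ⟨?_, hw⟩, rfl⟩
    rw [mem_closedBall_zero_iff]
    by_contra hlt
    have h1 : ‖z‖ + 1 < ‖ψ w‖ := hN (not_le.1 hlt).le
    have h2 := norm_sub_norm_le (ψ w) z
    have h3 := mem_ball_iff_norm.1 hyz
    linarith
  · refine isCompact_of_isClosed_isBounded ?_ ?_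
    · have hcompl : K ∪ ψ '' annulusIoc 1 s = (ψ '' {w | s < ‖w‖})ᶜ := by
        ext z
        constructor
        · rintro (hz | ⟨w, hw, rfl⟩) ⟨w', hw', h1⟩
          · exact h.2.1.mapsTo (show w' ∈ exteriorDisc from hs.trans hw') (h1 ▸ hz)
          · rw [h.2.1.injOn (show w' ∈ exteriorDisc from hs.trans hw') hw.1 h1] at hw'
            exact absurd hw.2 (not_le.2 hw')
        · intro hz
          by_cases hzK : z ∈ K
          · exact Or.inl hzK
          · obtain ⟨w, hw, rfl⟩ := h.2.1.surjOn hzK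
            exact Or.inr ⟨w, ⟨hw, not_lt.1 fun hle => hz ⟨w, hle, rfl⟩⟩, rfl⟩
      rw [hcompl]
      exact (hconf.isOpen_image (isOpen_lt continuous_const continuous_norm)
        fun w hw => hs.trans hw).isClosed_compl
    · refine hK.1.isBounded.union ?_
      obtain ⟨N, hN⟩ := exists_norm_le_of_injOn hconf h.tendsto_cobounded s
      refine (isBounded_closedBall (x := (0 : ℂ)) (r := N)).subset ?_
      rintro _ ⟨w, hw, rfl⟩
      exact mem_closedBall_zero_iff.2 (hN w hw.1 hw.2)

section CircleMap

variable {W : ℂ → ℂ} {Ω : Set ℂ}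

/-- A conformal map that preserves the unit circle and its orientation has a positive logarithmic
derivative on the circle. -/
theorem re_pos_of_preservesCircleOrientation (hW : IsConformalOn W Ω) (hΩ : unitCircle ⊆ Ω)
    (hor : PreservesCircleOrientation W) {z : ℂ} (hz : ‖z‖ = 1) :
    0 < (starRingEnd ℂ (W z) * (deriv W z * z)).re := by
  obtain ⟨θ, hθc, hθm, hθ⟩ := hor
  obtain ⟨t₀, rfl⟩ : ∃ t₀ : ℝ, exp (t₀ * I) = z :=
    ⟨arg z, by have := norm_mul_exp_arg_mul_I z; rwa [hz, ofReal_one, one_mul] at this⟩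
  set z := exp (t₀ * I) with hz0
  have hzΩ : z ∈ Ω := hΩ hz
  have hWz : W z = exp (θ t₀ * I) := hθ t₀
  have hWz0 : W z ≠ 0 := by rw [hWz]; exact exp_ne_zero _
  have hd1 : HasDerivAt (fun t : ℝ => exp (t * I)) (z * I) t₀ := by
    have : HasDerivAt (fun t : ℂ => exp (t * I)) (exp (t₀ * I) * (1 * I)) (t₀ : ℂ) :=
      ((hasDerivAt_id _).mul_const I).cexp
    simpa using this.comp_ofReal
  have hd2 : HasDerivAt (fun t : ℝ => W (exp (t * I)) / W z) (deriv W z * (z * I) / W z) t₀ := by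
    have hWd : HasDerivAt W (deriv W z) (exp (t₀ * I)) :=
      (hW.2.1.differentiableAt (hW.1.mem_nhds hzΩ)).hasDerivAt
    exact (hWd.comp t₀ hd1).div_const _
  have hd3 : HasDerivAt (fun t : ℝ => log (W (exp (t * I)) / W z))
      (deriv W z * (z * I) / W z) t₀ := by
    have h1 : W (exp (t₀ * I)) / W z = 1 := div_self hWz0
    have := hd2.clog_real (by rw [h1]; exact one_mem_slitPlane)
    rwa [h1, div_one] at this
  -- Near `t₀` the lift differs from `θ t₀` by less than `π`, so it is recovered from the principal
  -- logarithm of `W / W z` and is differentiable. Its derivative `l` is therefore real, nonnegative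
  -- by monotonicity, and nonzero because `W'` is.
  have hd4 : HasDerivAt (fun t : ℝ => ((θ t - θ t₀ : ℝ) : ℂ)) (deriv W z * z / W z) t₀ := by
    have h1 := hd3.mul_const (-I)
    have h2 : deriv W z * (z * I) / W z * -I = deriv W z * z / W z := by
      linear_combination (-(deriv W z * z / W z)) * I_mul_I
    rw [h2] at h1
    refine h1.congr_of_eventuallyEq ?_
    have hc : Tendsto (fun t => θ t - θ t₀) (𝓝 t₀) (𝓝 0) := by
      simpa using (hθc.tendsto t₀).sub_const (θ t₀)
    filter_upwards [hc.eventually (Ioo_mem_nhds (neg_lt_zero.2 Real.pi_pos) Real.pi_pos)] with t ht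
    have h3 : W (exp (t * I)) / W z = exp ((θ t - θ t₀ : ℝ) * I) := by
      rw [hθ, hWz, ← exp_sub]
      push_cast
      ring_nf
    rw [h3, log_exp (by simpa using ht.1) (by simpa using ht.2.le), mul_assoc]
    simp
  set l := deriv W z * z / W z with hl
  have hd5 : HasDerivAt (fun t : ℝ => θ t - θ t₀) l.re t₀ :=
    reCLM.hasFDerivAt.comp_hasDerivAt t₀ hd4
  have him : l.im = 0 := by
    have h1 : HasDerivAt (fun _ : ℝ => (0 : ℝ)) l.im t₀ := by
      refine (imCLM.hasFDerivAt.comp_hasDerivAt t₀ hd4).congr_of_eventuallyEq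
        (Eventually.of_forall fun t => ?_)
      simp only [Function.comp_apply, imCLM_apply, ofReal_im]
    exact h1.unique (hasDerivAt_const _ _)
  have hre : 0 ≤ l.re := by
    rw [← hd5.deriv]
    exact (hθm.monotone.add_const (-θ t₀)).deriv_nonneg
  have hl0 : l ≠ 0 := div_ne_zero (mul_ne_zero (hW.deriv_ne_zero hzΩ) (exp_ne_zero _)) hWz0
  have hWn : ‖W z‖ = 1 := by rw [hWz, norm_exp_ofReal_mul_I]
  have h6 : starRingEnd ℂ (W z) * (deriv W z * z) = l := by
    have h7 : starRingEnd ℂ (W z) * W z = 1 := by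
      rw [← normSq_eq_conj_mul_self, normSq_eq_norm_sq, hWn]
      simp
    have h8 : deriv W z * z = l * W z := (div_mul_cancel₀ _ hWz0).symm
    rw [h8]
    linear_combination l * h7
  rw [h6]
  exact lt_of_le_of_ne hre fun h => hl0 (Complex.ext h.symm him)

/-- A conformal map that preserves the unit circle and its orientation respects the two sides of
the circle near it. -/
theorem exists_radial_bounds (hW : IsConformalOn W Ω) (hΩ : unitCircle ⊆ Ω)
    (hWT : W '' unitCircle = unitCircle) (hor : PreservesCircleOrientation W) :
    ∃ δ, 0 < δ ∧ δ < 1 ∧ annulus (1 - δ) (1 + δ) ⊆ Ω ∧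
      (∀ w ∈ annulus (1 - δ) 1, ‖W w‖ < 1) ∧ ∀ w ∈ annulus 1 (1 + δ), 1 < ‖W w‖ := by
  -- At `t z` with `|z| = 1`, `G` is `t / 2` times the radial derivative of `|W|²`. It is positive
  -- on the circle, hence on a neighbourhood of it, and `|W|` increases along radii through the
  -- value `1`.
  set G : ℂ → ℝ := fun w => (starRingEnd ℂ (W w) * (deriv W w * w)).re with hG
  have hGc : ContinuousOn G Ω := by
    refine continuous_re.comp_continuousOn (ContinuousOn.mul ?_ ?_)
    · exact continuous_conj.comp_continuousOn hW.2.1.continuousOn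
    · exact hW.continuousOn_deriv.mul continuousOn_id
  have hcpt : IsCompact unitCircle := by
    rw [unitCircle_eq]
    exact isCompact_sphere 0 1
  have hopen : IsOpen (Ω ∩ G ⁻¹' Ioi 0) := hGc.isOpen_inter_preimage hW.1 isOpen_Ioi
  obtain ⟨δ', hδ', hsub⟩ := hcpt.exists_thickening_subset_open hopen fun z hz =>
    ⟨hΩ hz, re_pos_of_preservesCircleOrientation hW hΩ hor hz⟩
  set δ := min δ' (1 / 2) with hδ
  have hδ0 : 0 < δ := lt_min hδ' (by norm_num)
  have hδ1 : δ < 1 := (min_le_right _ _).trans_lt (by norm_num)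
  have hmem : ∀ t : ℝ, ∀ z : ℂ, ‖z‖ = 1 → 1 - δ < t → t < 1 + δ → (t : ℂ) * z ∈ Ω ∩ G ⁻¹' Ioi 0 := by
    intro t z hz h1 h2
    refine hsub (mem_thickening_iff.2 ⟨z, hz, ?_⟩)
    rw [dist_eq_norm, ← sub_one_mul, norm_mul, hz, mul_one, ← ofReal_one, ← ofReal_sub,
      Complex.norm_real]
    exact (abs_lt.2 ⟨by linarith, by linarith⟩ : |t - 1| < δ).trans_le (min_le_left _ _)
  have hpolar : ∀ w ∈ annulus (1 - δ) (1 + δ), ∃ z : ℂ, ‖z‖ = 1 ∧ (‖w‖ : ℂ) * z = w := by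
    intro w hw
    have h0 : (0 : ℝ) < ‖w‖ := lt_trans (by linarith) hw.1
    have h0' : (‖w‖ : ℂ) ≠ 0 := by exact_mod_cast h0.ne'
    refine ⟨w / ‖w‖, ?_, mul_div_cancel₀ _ h0'⟩
    rw [norm_div, Complex.norm_real, norm_norm, div_self h0.ne']
  have hmono : ∀ z : ℂ, ‖z‖ = 1 →
      StrictMonoOn (fun t : ℝ => ‖W (t * z)‖ ^ 2) (Ioo (1 - δ) (1 + δ)) := by
    intro z hz
    have hder : ∀ t ∈ Ioo (1 - δ) (1 + δ), HasDerivAt (fun t : ℝ => ‖W (t * z)‖ ^ 2)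
        (2 * inner ℝ (W (t * z)) (deriv W (t * z) * z)) t := by
      intro t ht
      have h1 : HasDerivAt (fun t : ℝ => (t : ℂ) * z) z t := by
        simpa using (hasDerivAt_id t).ofReal_comp.mul_const z
      have h2 : HasDerivAt W (deriv W (t * z)) (t * z) :=
        (hW.2.1.differentiableAt (hW.1.mem_nhds (hmem t z hz ht.1 ht.2).1)).hasDerivAt
      exact (h2.comp t h1).norm_sq
    refine strictMonoOn_of_deriv_pos (convex_Ioo _ _)
      (fun t ht => (hder t ht).continuousAt.continuousWithinAt) fun t ht => ?_
    rw [interior_Ioo] at ht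
    rw [(hder t ht).deriv]
    have h3 : 0 < G (t * z) := (hmem t z hz ht.1 ht.2).2
    have ht0 : 0 < t := by linarith [ht.1]
    have h4 : G (t * z) = t * inner ℝ (W (t * z)) (deriv W (t * z) * z) := by
      simp only [hG]
      rw [Complex.inner, ← re_ofReal_mul]
      congr 1
      ring
    rw [h4] at h3
    exact mul_pos two_pos (pos_of_mul_pos_right h3 ht0.le)
  have hone : ∀ z : ℂ, ‖z‖ = 1 → ‖W ((1 : ℝ) * z)‖ ^ 2 = 1 := by
    intro z hz
    have : W z ∈ unitCircle := hWT ▸ mem_image_of_mem W hz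
    rw [ofReal_one, one_mul, show ‖W z‖ = 1 from this, one_pow]
  have h1mem : (1 : ℝ) ∈ Ioo (1 - δ) (1 + δ) := ⟨by linarith, by linarith⟩
  refine ⟨δ, hδ0, hδ1, fun w hw => ?_, fun w hw => ?_, fun w hw => ?_⟩
  · obtain ⟨z, hz, hzw⟩ := hpolar w hw
    rw [← hzw]
    exact (hmem _ z hz hw.1 hw.2).1
  · have hw' : w ∈ annulus (1 - δ) (1 + δ) := ⟨hw.1, by linarith [hw.2]⟩
    obtain ⟨z, hz, hzw⟩ := hpolar w hw'
    have := hmono z hz hw' h1mem hw.2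
    simp only [hzw, hone z hz] at this
    exact (sq_lt_one_iff₀ (norm_nonneg _)).1 this
  · have hw' : w ∈ annulus (1 - δ) (1 + δ) := ⟨by linarith [hw.1], hw.2⟩
    obtain ⟨z, hz, hzw⟩ := hpolar w hw'
    have := hmono z hz h1mem hw' hw.1
    simp only [hzw, hone z hz] at this
    exact (one_lt_sq_iff₀ (norm_nonneg _)).1 this

/-- By injectivity only points of the circle map to the circle. Elsewhere `W` either keeps or
exchanges the two sides, and both conditions are open. Near the circle the sides are kept, so
connectedness excludes an exchange. -/
theorem mapsTo_exteriorDisc (hW : IsConformalOn W Ω) (hΩ : unitCircle ⊆ Ω)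
    (hWT : W '' unitCircle = unitCircle) (hor : PreservesCircleOrientation W)
    (hconn : IsConnected Ω) : MapsTo W (Ω ∩ exteriorDisc) exteriorDisc := by
  obtain ⟨δ, hδ, hδ1, hsub, hin, hout⟩ := exists_radial_bounds hW hΩ hWT hor
  have hcirc : ∀ w ∈ Ω, ‖W w‖ = 1 → ‖w‖ = 1 := by
    intro w hw h1
    obtain ⟨z, hz, hzw⟩ : W w ∈ W '' unitCircle := hWT.symm ▸ h1
    rw [← hW.2.2 (hΩ hz) hw hzw]
    exact hz
  have hWn := hW.2.1.continuousOn.norm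
  have hlt : IsOpen (Ω ∩ (fun w => ‖W w‖) ⁻¹' Iio 1) := hWn.isOpen_inter_preimage hW.1 isOpen_Iio
  have hgt : IsOpen (Ω ∩ (fun w => ‖W w‖) ⁻¹' Ioi 1) := hWn.isOpen_inter_preimage hW.1 isOpen_Ioi
  have hball : IsOpen {w : ℂ | ‖w‖ < 1} := isOpen_lt continuous_norm continuous_const
  set A := annulus (1 - δ) (1 + δ) ∪ (((Ω ∩ (fun w => ‖W w‖) ⁻¹' Iio 1) ∩ {w : ℂ | ‖w‖ < 1}) ∪
    ((Ω ∩ (fun w => ‖W w‖) ⁻¹' Ioi 1) ∩ exteriorDisc)) with hA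
  set B := ((Ω ∩ (fun w => ‖W w‖) ⁻¹' Iio 1) ∩ exteriorDisc) ∪
    ((Ω ∩ (fun w => ‖W w‖) ⁻¹' Ioi 1) ∩ {w : ℂ | ‖w‖ < 1}) with hB
  have hAo : IsOpen A := (isOpen_annulus _ _).union
    ((hlt.inter hball).union (hgt.inter isOpen_exteriorDisc))
  have hBo : IsOpen B := (hlt.inter isOpen_exteriorDisc).union (hgt.inter hball)
  have hcov : Ω ⊆ A ∪ B := by
    intro w hw
    rcases lt_trichotomy ‖w‖ 1 with h1 | h1 | h1
    · rcases lt_trichotomy ‖W w‖ 1 with h2 | h2 | h2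
      · exact Or.inl (Or.inr (Or.inl ⟨⟨hw, h2⟩, h1⟩))
      · exact absurd (hcirc w hw h2) h1.ne
      · exact Or.inr (Or.inr ⟨⟨hw, h2⟩, h1⟩)
    · exact Or.inl (Or.inl ⟨by rw [h1]; linarith, by rw [h1]; linarith⟩)
    · rcases lt_trichotomy ‖W w‖ 1 with h2 | h2 | h2
      · exact Or.inr (Or.inl ⟨⟨hw, h2⟩, h1⟩)
      · exact absurd (hcirc w hw h2) h1.ne'
      · exact Or.inl (Or.inr (Or.inr ⟨⟨hw, h2⟩, h1⟩))
  have hdisj : Disjoint A B := by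
    rw [disjoint_left]
    rintro w (h1 | ⟨⟨-, h1⟩, h2⟩ | ⟨⟨-, h1⟩, h2⟩) (⟨⟨-, h3⟩, h4⟩ | ⟨⟨-, h3⟩, h4⟩)
    · exact lt_asymm h3 (hout w ⟨h4, h1.2⟩)
    · exact lt_asymm h3 (hin w ⟨h1.1, h4⟩)
    · exact lt_asymm (show ‖w‖ < 1 from h2) h4
    · exact lt_asymm (show ‖W w‖ < 1 from h1) h3
    · exact lt_asymm (show 1 < ‖W w‖ from h1) h3
    · exact lt_asymm (show 1 < ‖w‖ from h2) h4
  have hone : (1 : ℂ) ∈ unitCircle := by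
    change ‖(1 : ℂ)‖ = 1
    exact norm_one
  have hsubA := hconn.isPreconnected.subset_left_of_subset_union hAo hBo hdisj hcov
    ⟨1, hΩ hone, Or.inl ⟨by rw [norm_one]; linarith, by rw [norm_one]; linarith⟩⟩
  rintro w ⟨hw, hw1⟩
  rcases hsubA hw with h1 | ⟨-, h2⟩ | ⟨⟨-, h1⟩, -⟩
  · exact hout w ⟨hw1, h1.2⟩
  · exact absurd (show 1 < ‖w‖ from hw1) (lt_asymm h2)
  · exact h1

/-- A conformal map that preserves the unit circle and its orientation defines a collar of the
closed unit disc. -/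
theorem exists_collar_closedBall (hW : IsConformalOn W Ω) (hΩ : unitCircle ⊆ Ω)
    (hWT : W '' unitCircle = unitCircle) (hor : PreservesCircleOrientation W) :
    ∃ R, annulus 1 R ⊆ Ω ∧ Collar (closedBall 0 1) W 1 R := by
  obtain ⟨δ, hδ, hδ1, hsub, hin, hout⟩ := exists_radial_bounds hW hΩ hWT hor
  have hsub1 : annulus 1 (1 + δ) ⊆ Ω := (annulus_subset_annulus (by linarith) le_rfl).trans hsub
  have hcircle : ∀ w : ℂ, ‖w‖ = 1 → ‖W w‖ = 1 := fun w hw =>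
    show W w ∈ unitCircle from hWT ▸ mem_image_of_mem W hw
  have hclosed : ∀ y : ℂ, ‖y‖ = 1 → ∃ w : ℂ, ‖w‖ = 1 ∧ W w = y := fun y hy => by
    obtain ⟨w, hw, rfl⟩ : y ∈ W '' unitCircle := hWT.symm ▸ hy
    exact ⟨w, hw, rfl⟩
  refine ⟨1 + δ, hsub1, one_pos, by linarith, hW.mono (isOpen_annulus _ _) hsub1,
    fun w hw hmem => ?_, fun s hs hsR => ?_, fun s hs hsR => ?_, ?_⟩
  · exact absurd (mem_closedBall_zero_iff.1 hmem) (not_le.2 (hout w hw))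
  · have heq : closedBall 0 1 ∪ W '' annulus 1 s = ball 0 1 ∪ W '' annulus (1 - δ) s := by
      ext y
      constructor
      · rintro (hy | hy)
        · rcases (mem_closedBall_zero_iff.1 hy).eq_or_lt with h1 | h1
          · obtain ⟨w, hw, rfl⟩ := hclosed y h1
            exact Or.inr ⟨w, ⟨by rw [hw]; linarith, by rw [hw]; exact hs⟩, rfl⟩
          · exact Or.inl (mem_ball_zero_iff.2 h1)
        · exact Or.inr (image_mono (annulus_subset_annulus (by linarith) le_rfl) hy)
      · rintro (hy | ⟨w, hw, rfl⟩)
        · exact Or.inl (ball_subset_closedBall hy)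
        · rcases lt_trichotomy ‖w‖ 1 with h1 | h1 | h1
          · exact Or.inl (mem_closedBall_zero_iff.2 (hin w ⟨hw.1, h1⟩).le)
          · exact Or.inl (mem_closedBall_zero_iff.2 (hcircle w h1).le)
          · exact Or.inr ⟨w, ⟨h1, hw.2⟩, rfl⟩
    rw [heq]
    exact isOpen_ball.union (hW.isOpen_image (isOpen_annulus _ _)
      ((annulus_subset_annulus le_rfl hsR.le).trans hsub))
  · have heq : closedBall 0 1 ∪ W '' annulusIoc 1 s =
        closedBall 0 1 ∪ W '' (closedBall 0 s ∩ {w | 1 ≤ ‖w‖}) := by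
      ext y
      constructor
      · rintro (hy | ⟨w, hw, rfl⟩)
        · exact Or.inl hy
        · exact Or.inr ⟨w, ⟨mem_closedBall_zero_iff.2 hw.2, hw.1.le⟩, rfl⟩
      · rintro (hy | ⟨w, ⟨hw1, hw2⟩, rfl⟩)
        · exact Or.inl hy
        · rcases (show 1 ≤ ‖w‖ from hw2).eq_or_lt with h1 | h1
          · exact Or.inl (mem_closedBall_zero_iff.2 (hcircle w h1.symm).le)
          · exact Or.inr ⟨w, ⟨h1, mem_closedBall_zero_iff.1 hw1⟩, rfl⟩
    rw [heq]
    refine (isCompact_closedBall 0 1).union ?_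
    refine ((isCompact_closedBall 0 s).inter_right
      (isClosed_le continuous_const continuous_norm)).image_of_continuousOn
      (hW.2.1.continuousOn.mono fun w hw => hsub ⟨?_, ?_⟩)
    · linarith [show 1 ≤ ‖w‖ from hw.2]
    · exact (mem_closedBall_zero_iff.1 hw.1).trans_lt hsR
  · rw [← exteriorDisc_eq]
    exact isPreconnected_exteriorDisc

end CircleMap

end ConformalWelding

/-! ### Existence of the lift, and its uniqueness up to affine maps. -/

namespace ConformalWelding

open Metric Complex Bornology

/-- The outer function of a glued map extends over the whole annulus. -/
theorem GluedMap.exists_extension {Hp Hq : Set ℂ} {p q : ℂ → ℂ} {r R ρ ρ' : ℝ} {V ψ : ℂ → ℂ}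
    (hp : Collar Hp p r R) (hq : Collar Hq q r R) (h1 : r < ρ) (h2 : ρ < ρ') (h3 : ρ' < R)
    (h : GluedMap (Hp ∪ p '' annulusIoc r ρ) (Hq ∪ q '' annulusIoc r ρ) p q ρ ρ' V ψ) :
    ∃ ψ', GluedMap Hp Hq p q r ρ' V ψ' := by
  classical
  have hrρ' := h1.trans h2
  have hsub : annulus r ρ' ⊆ annulus r R := annulus_subset_annulus le_rfl h3.le
  have hqr := hq.conf.mono (isOpen_annulus r ρ') hsub
  set χ := Function.invFunOn q (annulus r ρ') with hχ
  have hχq : ∀ w ∈ annulus r ρ', χ (q w) = w := fun w hw => hqr.2.2.leftInvOn_invFunOn hw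
  -- The welding defines the outer function only beyond the circle `|w| = ρ`. The gluing relation
  -- itself continues it inwards to all of `Hqᶜ`.
  set ψ' := fun z => if z ∈ q '' annulus r ρ' then V (p (χ z)) else ψ z with hψ'
  have hring : ∀ w ∈ annulus r ρ', ψ' (q w) = V (p w) := by
    intro w hw
    simp only [hψ']
    rw [if_pos (mem_image_of_mem q hw), hχq w hw]
  have hout : ∀ z ∈ (Hq ∪ q '' annulusIoc r ρ)ᶜ, ψ' z = ψ z := by
    intro z hz
    by_cases hzq : z ∈ q '' annulus r ρ'
    · obtain ⟨w, hw, rfl⟩ := hzq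
      have hw' : w ∈ annulus ρ ρ' :=
        ⟨not_le.1 fun hle => hz (Or.inr (mem_image_of_mem q ⟨hw.1, hle⟩)), hw.2⟩
      rw [hring w hw, h.glue w hw']
    · simp only [hψ', if_neg hzq]
  have hVd := h.diff_inner
  rw [Collar.restrict_union r h1.le h2] at hVd
  have hp' := hp.restrict le_rfl hrρ' h3.le
  have hq' := hq.restrict le_rfl hrρ' h3.le
  rw [annulusIoc_self, image_empty, union_empty] at hp' hq'
  refine ⟨ψ', hp', hq', hVd, ?_, fun w hw => (hring w hw).symm, ?_⟩
  · intro z hz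
    refine DifferentiableAt.differentiableWithinAt ?_
    by_cases hzq : z ∈ q '' annulus r ρ'
    · have hopen : IsOpen (q '' annulus r ρ') := hqr.isOpen_image hqr.1 subset_rfl
      have hd : DifferentiableOn ℂ (fun z => V (p (χ z))) (q '' annulus r ρ') := by
        refine hVd.comp ((hp.conf.2.1.mono hsub).comp hqr.differentiableOn_invFunOn ?_) ?_
        · exact fun y hy => Function.invFunOn_mem hy
        · exact fun y hy => Or.inr (mem_image_of_mem p (Function.invFunOn_mem hy))
      refine (hd.differentiableAt (hopen.mem_nhds hzq)).congr_of_eventuallyEq ?_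
      filter_upwards [hopen.mem_nhds hzq] with y hy
      simp only [hψ', if_pos hy]
    · have hz' : z ∈ (Hq ∪ q '' annulusIoc r ρ)ᶜ := by
        rintro (h5 | h5)
        exacts [hz h5, hzq (image_mono (annulusIoc_subset_annulus h2) h5)]
      have hopen := h.outer.isClosed.isOpen_compl
      refine (h.diff_outer.differentiableAt (hopen.mem_nhds hz')).congr_of_eventuallyEq ?_
      filter_upwards [hopen.mem_nhds hz'] with y hy using hout y hy
  · refine h.lim.congr' ?_
    filter_upwards [isBounded_def.1 h.isBounded_outer] with z hz
    rw [hout z hz]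

section Lift

variable {H Ω : Set ℂ} {W V V' : ℂ → ℂ}

theorem exists_isConformalLift (hH : IsNondegenerateHull H) (hΩ : unitCircle ⊆ Ω)
    (hW : IsConformalOn W Ω) (hWT : W '' unitCircle = unitCircle)
    (hor : PreservesCircleOrientation W) (hmaps : MapsTo W (Ω ∩ exteriorDisc) exteriorDisc) :
    ∃ V : ℂ → ℂ, IsNondegenerateHull (V '' H) ∧ IsConformalLift H Ω W V := by
  classical
  have hp0 := isExteriorMap_exteriorMap (exists_isExteriorMap hH)
  obtain ⟨R, hRΩ, hq⟩ := exists_collar_closedBall hW hΩ hWT hor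
  have hp := hp0.collar hH.1 hq.lt
  obtain ⟨ρ, h1, h1'⟩ := exists_between hq.lt
  obtain ⟨ρ', h2, h3⟩ := exists_between h1'
  obtain ⟨V, ψ₀, hV₀⟩ := hp.exists_gluedMap hq h1 h2 h3
  obtain ⟨ψ, h⟩ := hV₀.exists_extension hp hq h1 h2 h3
  have hpc := hp0.isConformalOn
  set p := exteriorMap H with hpdef
  set φ := Function.invFunOn p exteriorDisc with hφ
  have hφp : ∀ w ∈ exteriorDisc, φ (p w) = w := fun w hw => hpc.2.2.leftInvOn_invFunOn hw
  have hnotMem : ∀ w ∈ exteriorDisc, p w ∉ H := fun w hw => hp0.2.1.mapsTo hw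
  -- The glued `V` is defined only on a thin collar. The formula `ψ ∘ W ∘ ψ_H⁻¹` agrees with it
  -- there and extends it to all of `Ω^H`.
  set V' := fun z => if z ∈ H then V z else ψ (W (φ z)) with hV'
  have hV'H : ∀ z ∈ H, V' z = V z := fun z hz => if_pos hz
  have hV'p : ∀ w ∈ exteriorDisc, V' (p w) = ψ (W w) := fun w hw => by
    simp only [hV', if_neg (hnotMem w hw), hφp w hw]
  have himage : V' '' H = V '' H := image_congr hV'H
  have hcompl := h.image_inner
  rw [← exteriorDisc_eq] at hcompl
  have hψd := h.diff_outer
  have hψi := h.injOn_outer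
  rw [← exteriorDisc_eq] at hψd hψi
  have hVi := h.injOn_inner
  have hdisj : ∀ z ∈ H, ∀ w ∈ exteriorDisc, V z ≠ ψ w := by
    intro z hz w hw h4
    have : V z ∈ (ψ '' exteriorDisc)ᶜ := hcompl ▸ mem_image_of_mem V hz
    exact this ⟨w, hw, h4.symm⟩
  have hψext : IsExteriorMap (V' '' H) ψ := by
    refine ⟨hψd, ?_, 1, one_pos, by simpa using h.tendsto_div 0 0⟩
    rw [himage, hcompl, compl_compl]
    exact ⟨mapsTo_image _ _, hψi, surjOn_image _ _⟩
  have hVc : ContinuousOn V H := (h.diff_inner.mono subset_union_left).continuousOn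
  have hhull : IsNondegenerateHull (V' '' H) := by
    rw [himage]
    refine ⟨⟨hH.1.1.image_of_continuousOn hVc, hH.1.2.1.image V hVc, ?_⟩,
      hH.2.image_of_injOn (hVi.mono subset_union_left)⟩
    rw [hcompl, compl_compl]
    refine ⟨⟨ψ 2, 2, ?_, rfl⟩, isPreconnected_exteriorDisc.image ψ hψd.continuousOn⟩
    change (1 : ℝ) < ‖(2 : ℂ)‖
    norm_num
  refine ⟨V', hhull, ⟨?_, ?_, ?_⟩, fun w hw => ?_⟩
  · have : liftDomain H Ω = (H ∪ p '' annulus 1 ρ') ∪ p '' (Ω ∩ exteriorDisc) := by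
      have hsub : annulus 1 ρ' ∪ (Ω ∩ exteriorDisc) = Ω ∩ exteriorDisc :=
        union_eq_right.2 fun w hw => ⟨hRΩ ⟨hw.1, hw.2.trans h3⟩, hw.1⟩
      rw [liftDomain, union_assoc, ← image_union, hsub]
    rw [this]
    exact h.inner.isOpen_union.union
      (hpc.isOpen_image (hW.1.inter isOpen_exteriorDisc) inter_subset_right)
  · rintro z hz
    refine DifferentiableAt.differentiableWithinAt ?_
    rcases hz with hz | hz
    · have hnhds := h.inner.isOpen_union.mem_nhds (Or.inl hz)
      refine (h.diff_inner.differentiableAt hnhds).congr_of_eventuallyEq ?_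
      filter_upwards [hnhds] with y hy
      rcases hy with hy | ⟨w, hw, rfl⟩
      · exact hV'H y hy
      · rw [hV'p w hw.1, h.glue w hw]
    · have hopen : IsOpen (p '' (Ω ∩ exteriorDisc)) :=
        hpc.isOpen_image (hW.1.inter isOpen_exteriorDisc) inter_subset_right
      have hmem : ∀ y ∈ p '' (Ω ∩ exteriorDisc), φ y ∈ Ω ∩ exteriorDisc := by
        rintro _ ⟨w, hw, rfl⟩
        rw [hφp w hw.2]
        exact hw
      have hd : DifferentiableOn ℂ (fun z => ψ (W (φ z))) (p '' (Ω ∩ exteriorDisc)) :=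
        hψd.comp (hW.2.1.comp (hpc.differentiableOn_invFunOn.mono (image_mono inter_subset_right))
          fun y hy => (hmem y hy).1) fun y hy => hmaps (hmem y hy)
      refine (hd.differentiableAt (hopen.mem_nhds hz)).congr_of_eventuallyEq ?_
      filter_upwards [hopen.mem_nhds hz]
      rintro _ ⟨w, hw, rfl⟩
      rw [hV'p w hw.2, hφp w hw.2]
  · rintro z (hz | ⟨w, hw, rfl⟩) z' (hz' | ⟨w', hw', rfl⟩) heq
    · rw [hV'H z hz, hV'H z' hz'] at heq
      exact hVi (Or.inl hz) (Or.inl hz') heq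
    · rw [hV'H z hz, hV'p w' hw'.2] at heq
      exact absurd heq (hdisj z hz _ (hmaps hw'))
    · rw [hV'p w hw.2, hV'H z' hz'] at heq
      exact absurd heq.symm (hdisj z' hz' _ (hmaps hw))
    · rw [hV'p w hw.2, hV'p w' hw'.2] at heq
      rw [hW.2.2 hw.1 hw'.1 (hψi (hmaps hw) (hmaps hw') heq)]
  · rw [hV'p w hw.2, hψext.eqOn_exteriorMap hhull.1.1.isBounded (hmaps hw)]

/-- An entire function asymptotic to `m z` at infinity is affine. -/
theorem eq_affine_of_tendsto_div {F : ℂ → ℂ} (hF : Differentiable ℂ F) {m : ℂ}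
    (hlim : Tendsto (fun z => F z / z) (cobounded ℂ) (𝓝 m)) (z : ℂ) : F z = m * z + F 0 := by
  have hd : Differentiable ℂ (dslope F 0) := by
    rw [← differentiableOn_univ] at hF ⊢
    exact (differentiableOn_dslope univ_mem).2 hF
  have h1 : Tendsto (dslope F 0) (cocompact ℂ) (𝓝 m) := by
    rw [← cobounded_eq_cocompact]
    have h2 := hlim.sub ((tendsto_inv₀_cobounded (α := ℂ)).const_mul (F 0))
    rw [mul_zero, sub_zero] at h2
    refine h2.congr' ?_
    filter_upwards [eventually_ne_cobounded (0 : ℂ)] with y hy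
    rw [dslope_of_ne _ hy, slope_def_field, sub_zero, sub_div, ← div_eq_mul_inv]
  rcases eq_or_ne z 0 with rfl | hz
  · simp
  · have h3 := hd.apply_eq_of_tendsto_cocompact z h1
    rw [dslope_of_ne _ hz, slope_def_field, sub_zero, div_eq_iff hz] at h3
    linear_combination h3

/-- A lift is not assumed to map `H` to a hull. If `V '' H` had no exterior map, the default value
would make `exteriorMap` zero. Then `V` would vanish at two distinct points coming from near `1` and
`-1`, against injectivity. -/
theorem _root_.IsConformalLift.isExteriorMap (h : IsConformalLift H Ω W V) (hW : IsOpen Ω)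
    (hΩ : unitCircle ⊆ Ω) (hH : IsNondegenerateHull H) :
    IsExteriorMap (V '' H) (exteriorMap (V '' H)) := by
  by_cases hex : ∃ ψ, IsExteriorMap (V '' H) ψ
  · exact isExteriorMap_exteriorMap hex
  exfalso
  have hp := isExteriorMap_exteriorMap (exists_isExteriorMap hH)
  have hzero : ∀ w ∈ Ω ∩ exteriorDisc, V (exteriorMap H w) = 0 := by
    intro w hw
    rw [h.2 w hw, exteriorMap, dif_neg hex]
  have hnhds : ∀ z : ℂ, ‖z‖ = 1 → ∃ w ∈ Ω ∩ exteriorDisc, ∃ t : ℝ, 1 < t ∧ w = t * z := by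
    intro z hz
    have hc : ContinuousAt (fun t : ℝ => (t : ℂ) * z) 1 := by fun_prop
    have hev : ∀ᶠ t : ℝ in 𝓝 1, (t : ℂ) * z ∈ Ω :=
      hc.eventually_mem (hW.mem_nhds (by simpa using hΩ hz))
    obtain ⟨t, ht, ht1⟩ := ((hev.filter_mono nhdsWithin_le_nhds).and
      (self_mem_nhdsWithin : Ioi (1 : ℝ) ∈ 𝓝[>] 1)).exists
    refine ⟨t * z, ⟨ht, ?_⟩, t, ht1, rfl⟩
    change (1 : ℝ) < ‖(t : ℂ) * z‖
    rw [norm_mul, hz, mul_one, Complex.norm_real, Real.norm_of_nonneg (zero_le_one.trans ht1.le)]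
    exact ht1
  obtain ⟨w₁, hw₁, t₁, ht₁, rfl⟩ := hnhds 1 norm_one
  obtain ⟨w₂, hw₂, t₂, ht₂, rfl⟩ := hnhds (-1) (by simp)
  have h1 := h.1.2.2 (Or.inr (mem_image_of_mem _ hw₁)) (Or.inr (mem_image_of_mem _ hw₂))
    ((hzero _ hw₁).trans (hzero _ hw₂).symm)
  have h2 := hp.2.1.injOn hw₁.2 hw₂.2 h1
  have h3 : t₁ = -t₂ := by
    have : ((t₁ : ℝ) : ℂ) = ((-t₂ : ℝ) : ℂ) := by simpa using h2
    exact_mod_cast this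
  linarith

theorem _root_.IsConformalLift.isBounded_image (h : IsConformalLift H Ω W V)
    (hH : IsNondegenerateHull H) : IsBounded (V '' H) :=
  (hH.1.1.image_of_continuousOn
    (h.1.2.1.continuousOn.mono subset_union_left)).isBounded

/-- Positive affine maps transform lifts into lifts. -/
theorem _root_.IsConformalLift.affine (h : IsConformalLift H Ω W V) (hW : IsOpen Ω)
    (hΩ : unitCircle ⊆ Ω) (hH : IsNondegenerateHull H)
    (hmaps : MapsTo W (Ω ∩ exteriorDisc) exteriorDisc) {a : ℝ} {b : ℂ} (ha : 0 < a)
    (hV' : ∀ z ∈ liftDomain H Ω, V' z = a * V z + b) : IsConformalLift H Ω W V' := by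
  have ha0 : (a : ℂ) ≠ 0 := by exact_mod_cast ha.ne'
  have himage : V' '' H = (fun z => a * z + b) '' (V '' H) := by
    rw [image_image]
    exact image_congr fun z hz => hV' z (Or.inl hz)
  have hbdd : IsBounded (V' '' H) := by
    have hc : ContinuousOn V H := h.1.2.1.continuousOn.mono subset_union_left
    rw [himage]
    exact ((hH.1.1.image_of_continuousOn hc).image (by fun_prop)).isBounded
  have hext := (h.isExteriorMap hW hΩ hH).affine ha b
  rw [← himage] at hext
  refine ⟨⟨h.1.1, ((h.1.2.1.const_mul (a : ℂ)).add_const b).congr hV', ?_⟩, fun w hw => ?_⟩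
  · intro z hz z' hz' heq
    rw [hV' z hz, hV' z' hz'] at heq
    exact h.1.2.2 hz hz' (mul_left_cancel₀ ha0 (add_right_cancel heq))
  · rw [hV' _ (Or.inr (mem_image_of_mem _ hw)), h.2 w hw, hext.eqOn_exteriorMap hbdd (hmaps hw)]

/-- Any two lifts differ by a positive affine map. -/
theorem _root_.IsConformalLift.exists_affine (h : IsConformalLift H Ω W V)
    (h' : IsConformalLift H Ω W V') (hW : IsOpen Ω)
    (hΩ : unitCircle ⊆ Ω) (hH : IsNondegenerateHull H)
    (hmaps : MapsTo W (Ω ∩ exteriorDisc) exteriorDisc) :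
    ∃ (a : ℝ) (b : ℂ), 0 < a ∧ ∀ z ∈ liftDomain H Ω, V' z = a * V z + b := by
  classical
  have hψ := h.isExteriorMap hW hΩ hH
  have hψ' := h'.isExteriorMap hW hΩ hH
  have hb := h.isBounded_image hH
  set ψ := exteriorMap (V '' H)
  set ψ' := exteriorMap (V' '' H)
  set D := liftDomain H Ω with hD
  set U := Function.invFunOn V D with hU
  set φ := Function.invFunOn ψ exteriorDisc with hφ
  have hUV : ∀ x ∈ D, U (V x) = x := fun x hx => h.1.2.2.leftInvOn_invFunOn hx
  have hφψ : ∀ w ∈ exteriorDisc, φ (ψ w) = w := fun w hw => hψ.2.1.injOn.leftInvOn_invFunOn hw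
  -- `F` equals `V' ∘ V⁻¹` on the open set `V(Ω^H)` and `ψ' ∘ ψ⁻¹` off `V(H)`. The two lift
  -- equations make these agree on the overlap, so `F` is entire.
  set F := fun z => if z ∈ V '' H then V' (U z) else ψ' (φ z) with hF
  have hFout : ∀ w ∈ exteriorDisc, F (ψ w) = ψ' w := fun w hw => by
    simp only [hF]
    rw [if_neg (hψ.2.1.mapsTo hw), hφψ w hw]
  have hFin : ∀ x ∈ D, F (V x) = V' x := by
    rintro x (hx | ⟨w, hw, rfl⟩)
    · simp only [hF]
      rw [if_pos (mem_image_of_mem V hx), hUV x (Or.inl hx)]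
    · rw [h.2 w hw, h'.2 w hw, hFout _ (hmaps hw)]
  have hFd : Differentiable ℂ F := by
    intro z
    by_cases hz : z ∈ V '' H
    · obtain ⟨x, hx, rfl⟩ := hz
      have hopen : IsOpen (V '' D) := h.1.isOpen_image h.1.1 subset_rfl
      have hnhds := hopen.mem_nhds (mem_image_of_mem V (Or.inl hx : x ∈ D))
      have hd : DifferentiableOn ℂ (fun z => V' (U z)) (V '' D) :=
        h'.1.2.1.comp h.1.differentiableOn_invFunOn fun y hy => Function.invFunOn_mem hy
      refine (hd.differentiableAt hnhds).congr_of_eventuallyEq ?_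
      filter_upwards [hnhds]
      rintro _ ⟨y, hy, rfl⟩
      rw [hFin y hy, hUV y hy]
    · have him : ψ '' exteriorDisc = (V '' H)ᶜ := hψ.2.1.image_eq
      have hopen : IsOpen (V '' H)ᶜ := him ▸ hψ.isConformalOn.isOpen_image isOpen_exteriorDisc
        subset_rfl
      have hd : DifferentiableOn ℂ (fun z => ψ' (φ z)) (V '' H)ᶜ := by
        rw [← him]
        exact hψ'.1.comp hψ.isConformalOn.differentiableOn_invFunOn
          fun y hy => Function.invFunOn_mem hy
      refine (hd.differentiableAt (hopen.mem_nhds hz)).congr_of_eventuallyEq ?_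
      filter_upwards [hopen.mem_nhds hz] with y hy
      simp only [hF]
      rw [if_neg hy]
  obtain ⟨c, hc, hlim⟩ := hψ.2.2
  obtain ⟨c', hc', hlim'⟩ := hψ'.2.2
  have hcne : (c : ℂ) ≠ 0 := by exact_mod_cast hc.ne'
  -- With `w = ψ⁻¹(z)`, the quotient `F z / z` is `(ψ' w / w) / (ψ w / w)`, whose limit is the
  -- positive number `c' / c`.
  have hlimF : Tendsto (fun z => F z / z) (cobounded ℂ) (𝓝 ((c' / c : ℝ) : ℂ)) := by
    have h1 := (hlim'.div hlim hcne).comp (hψ.tendsto_invFunOn hb)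
    push_cast
    refine h1.congr' ?_
    filter_upwards [isBounded_def.1 hb, (hψ.tendsto_invFunOn hb).eventually_ne_cobounded 0]
      with z hz hφz
    have hzim : z ∈ ψ '' exteriorDisc := hψ.2.1.surjOn hz
    have h2 : ψ (φ z) = z := Function.invFunOn_eq hzim
    have h3 : F z = ψ' (φ z) := by rw [← hFout _ (Function.invFunOn_mem hzim), h2]
    simp only [Function.comp_apply, Pi.div_apply]
    rw [h2, h3, div_div_div_cancel_right₀ hφz]
  refine ⟨c' / c, F 0, div_pos hc' hc, fun x hx => ?_⟩
  rw [← hFin x hx]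
  exact eq_affine_of_tendsto_div hFd hlimF (V x)

end Lift

end ConformalWelding

theorem mainTheorem7 (H Ω : Set ℂ) (W : ℂ → ℂ)
    (hH : IsNondegenerateHull H)
    (hΩ : unitCircle ⊆ Ω)
    (hW : IsConformalOn W Ω)
    (hWT : W '' unitCircle = unitCircle)
    (hor : PreservesCircleOrientation W)
    (hdom : IsConnected Ω ∨ MapsTo W (Ω ∩ exteriorDisc) exteriorDisc) :
    (∃ V : ℂ → ℂ, IsNondegenerateHull (V '' H) ∧ IsConformalLift H Ω W V) ∧
    (∀ V V' : ℂ → ℂ, IsConformalLift H Ω W V →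
      (IsConformalLift H Ω W V' ↔
        ∃ (a : ℝ) (b : ℂ), 0 < a ∧ ∀ z ∈ liftDomain H Ω, V' z = a * V z + b)) := by
  have hmaps : MapsTo W (Ω ∩ exteriorDisc) exteriorDisc :=
    hdom.elim (ConformalWelding.mapsTo_exteriorDisc hW hΩ hWT hor) id
  refine ⟨ConformalWelding.exists_isConformalLift hH hΩ hW hWT hor hmaps, fun V V' h => ⟨fun h' =>
    h.exists_affine h' hW.1 hΩ hH hmaps, ?_⟩⟩
  rintro ⟨a, b, ha, hV'⟩
  exact h.affine hW.1 hΩ hH hmaps ha hV'
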